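/- **Theorem 1.3.** Let $\mathcal T$ be an oriented ideal triangulation with tetrahedra $\Delta_1,\dots,\Delta_N$ and exactly one cusp, whose cross-section, triangulated by $\mathcal T$, is a torus. The three pairs of opposite edges of $\Delta_i$ carry non-degenerate shapes in $\mathbb C\setminus\{0,1\}$, of the form $\zeta_i,\ 1/(1-\zeta_i),\ 1-1/\zeta_i$ in the cyclic order given by the orientation. Fix a slope (the meridian), i.e. an isotopy class of unoriented essential simple closed curves on the cusp torus, and assume that the shapes solve the gluing equations of all edges (the product of the shapes around each edge is $1$) and of the meridian (the product of the shapes $s^{\pm1}$ of the angles subtended by a meridian loop, with sign $+$ for counterclockwise and $-$ for clockwise, is $1$). For example, $\mathcal T$ may be a regular ideal triangulation of a one-cusped hyperbolic 3-manifold, with the shapes of the complete hyperbolic structure. Make the following choices. 1. A quad type: for each $i$ a pair of opposite edges of $\Delta_i$, whose shape is called $z_i$; the next two pairs in cyclic order then have the shapes $z_i'=1/(1-z_i)$ and $z_i''=1-1/z_i$. 2. An enumeration of the $N$ edges of $\mathcal T$ and one edge, which is omitted. 3. A meridian loop: an oriented simple closed curve on the cusp torus that represents the meridian slope and is in normal position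 with respect to the triangulation of the torus. 4. A combinatorial flattening: integers $f_i,f_i',f_i''$ attached to the pairs of opposite edges carrying $z_i,z_i',z_i''$, such that $f_i+f_i'+f_i''=1$ for all $i$, the integers attached to the tetrahedron edges incident to each edge of $\mathcal T$ add up to $2$, and the signed sum of the integers attached to the angles subtended by the meridian loop is $0$. For each edge $I$ of $\mathcal T$ let $G_{Ii},G_{Ii}',G_{Ii}''$ be the numbers of edges of $\Delta_i$ with shape $z_i,z_i',z_i''$ that are incident to $I$; for the meridian loop let them be the signed numbers of angles with shape $z_i,z_i',z_i''$ that it subtends. Let $\mathbf A=(G_{Ij}-G'_{Ij})$ and $\mathbf B=(G''_{Ij}-G'_{Ij})$ be the $N\times N$ integer matrices with rows indexed by the edges, the row of the omitted edge being replaced by that of the meridian loop. Put $$\tau_{\mathcal T}=\tfrac12\det\big(\mathbf A\,\Delta_{z''}+\mathbf B\,\Delta_z^{-1}\big)\prod_{i=1}^N z_i^{f_i''}(z_i'')^{-f_i},\qquad \Delta_z=\mathrm{diag}(z_1,\dots,z_N),\quad \Delta_{z''}=\mathrm{diag}(z_1'',\dots,z_N'').$$ Then any two systems of such choices give the same value of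 $\tau_{\mathcal T}$ up to sign: up to sign, $\tau_{\mathcal T}$ does not depend on the quad type, the enumeration of the edges, the omitted edge, the meridian loop representing the slope, or the combinatorial flattening. -/

import Mathlib

open scoped BigOperators

noncomputable section

/-- An oriented ideal triangulation with `N` tetrahedra, each with vertices `0, 1, 2, 3`. The numbering
of the vertices is compatible with the orientation: all tetrahedra are oriented so that, seen from the
ideal vertex `0`, the vertices `1, 2, 3` are in counterclockwise order. The face of `t` opposite to the
vertex `f` is glued to a face of `adj t f`, and `glue t f` says where the vertices go: for `v ≠ f`
the vertex `v` of `t` is matched with the vertex `glue t f v` of `adj t f`, and the face `f` of `t` becomes the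
face `glue t f f` of `adj t f`. Odd permutations are exactly the gluings that respect orientations. -/
structure IdealTriangulation (N : ℕ) where
  adj : Fin N → Fin 4 → Fin N
  glue : Fin N → Fin 4 → Equiv.Perm (Fin 4)
  adj_adj : ∀ t f, adj (adj t f) (glue t f f) = t
  glue_glue : ∀ t f, glue (adj t f) (glue t f f) = (glue t f)⁻¹
  not_self_glued : ∀ t f, (adj t f, glue t f f) ≠ (t, f)
  sign_glue : ∀ t f, Equiv.Perm.sign (glue t f) = -1

/-- A corner `(tet, v, w)` with `v ≠ w`: the directed edge of the tetrahedron `tet` from `v` to `w`.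
Truncating the ideal vertex `v` leaves a triangle `(tet, v)` of the boundary surface, and
`(tet, v, w)` is the corner of that triangle that lies on the edge `vw`. The sides of the triangle
`(tet, v)` lie on the three faces of `tet` opposite to the vertices other than `v`. -/
@[ext] structure Corner (N : ℕ) where
  tet : Fin N
  v : Fin 4
  w : Fin 4
  ne : v ≠ w

/-- The three pairs of opposite edges: `01|23` is `0`, `02|13` is `1`, `03|12` is `2`. Seen from
any ideal vertex of an oriented tetrahedron they occur in the cyclic order `0, 1, 2`
counterclockwise. (The diagonal values are never used.) -/
def oppositePair (v w : Fin 4) : Fin 3 :=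
  (!![0, 0, 1, 2;
      0, 0, 2, 1;
      1, 2, 0, 0;
      2, 1, 0, 0] : Matrix (Fin 4) (Fin 4) (Fin 3)) v w

/-- The point at parameter `s` on the segment from the corner `w` to the corner `b`, in barycentric
coordinates. -/
def sidePoint (w b : Fin 4) (s : ℝ) : Fin 4 → ℝ :=
  (1 - s) • Pi.single w (1 : ℝ) + s • Pi.single b (1 : ℝ)

/-- The shape parameters `(z, z', z'') = (z, 1/(1-z), 1 - 1/z)` of a tetrahedron, attached to its pairs of
opposite edges `0, 1, 2`. -/
def shapeParam (z : ℂ) : Fin 3 → ℂ := ![z, (1 - z)⁻¹, 1 - z⁻¹]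

namespace IdealTriangulation

variable {N : ℕ} (T : IdealTriangulation N)

/-- Two triangles of the boundary surface share a side. -/
def CuspRel (x y : Fin N × Fin 4) : Prop :=
  ∃ f : Fin 4, f ≠ x.2 ∧ y = (T.adj x.1 f, T.glue x.1 f x.2)

/-- The cusps: the connected components of the boundary surface. -/
def Cusp : Type := Quot T.CuspRel

/-- Two corners are identified by gluing along a face that contains the edge. -/
def LinkRel (c d : Corner N) : Prop :=
  ∃ f : Fin 4, f ≠ c.v ∧ f ≠ c.w ∧
    d.tet = T.adj c.tet f ∧ d.v = T.glue c.tet f c.v ∧ d.w = T.glue c.tet f c.w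

/-- The vertices of the triangulated boundary surface, i.e. the directed edges of the triangulation. -/
def LinkVertex : Type := Quot T.LinkRel

/-- The edges of the ideal triangulation (undirected). -/
def Edge : Type :=
  Quot (fun c d : Corner N => T.LinkRel c d ∨ (d.tet = c.tet ∧ d.v = c.w ∧ d.w = c.v))

/-- The edge of the triangulation on which a directed edge of a tetrahedron lies. -/
def edgeOf (c : Corner N) : T.Edge := Quot.mk _ c

/-- The vertex of the boundary surface at which a corner lies. -/
def vertexOf (c : Corner N) : T.LinkVertex := Quot.mk _ c

/-- The triangulated space has exactly one cusp, and its cross-section is a torus: the boundary surface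
(automatically a closed oriented surface, with `4N` triangles and `6N` sides) is connected with Euler
characteristic `0`. -/
structure IsOneCusped : Prop where
  card_cusp : Nat.card T.Cusp = 1
  euler : (Nat.card T.LinkVertex : ℤ) - 6 * N + 4 * N = 0

/-- The edge gluing matrices: `edgeGluing I i k` is the number of edges of the tetrahedron `i` in the
opposite pair `k` that are incident to the edge `I`. -/
def edgeGluing (I : T.Edge) (i : Fin N) (k : Fin 3) : ℤ :=
  (Nat.card {c : Corner N // c.tet = i ∧ c.v < c.w ∧ oppositePair c.v c.w = k ∧ T.edgeOf c = I} : ℤ)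

/-- An oriented simple closed curve on the boundary surface in general (normal) position with
respect to its triangulation. It consists of `n + 1` arcs, indexed cyclically by `Fin (n + 1)`.
With `p = flag i`, the `i`-th arc lies in the triangle `(tet i, p 0)`, cuts off its corner `p 1`,
enters through the side on the face `p 2` (this side joins the corners `p 1` and `p 3`) and leaves
through the side on the face `p 3` (this side joins the corners `p 1` and `p 2`). It is realized as
the straight segment between a point `entry i` and a point `exit i` in the interiors of these two
sides. -/
structure PeripheralCurve where
  n : ℕ
  tet : Fin (n + 1) → Fin N
  flag : Fin (n + 1) → Equiv.Perm (Fin 4)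
  entryParam : Fin (n + 1) → ℝ
  exitParam : Fin (n + 1) → ℝ
  entryParam_mem : ∀ i, entryParam i ∈ Set.Ioo (0 : ℝ) 1
  exitParam_mem : ∀ i, exitParam i ∈ Set.Ioo (0 : ℝ) 1
  /-- each arc continues, across the side through which it leaves, as the next arc -/
  tet_succ : ∀ i, tet (i + 1) = T.adj (tet i) (flag i 3)
  flag_zero_succ : ∀ i, flag (i + 1) 0 = T.glue (tet i) (flag i 3) (flag i 0)
  flag_two_succ : ∀ i, flag (i + 1) 2 = T.glue (tet i) (flag i 3) (flag i 3)
  point_succ : ∀ i k,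
    sidePoint (flag (i + 1) 1) (flag (i + 1) 3) (entryParam (i + 1)) (T.glue (tet i) (flag i 3) k) =
      sidePoint (flag i 1) (flag i 2) (exitParam i) k
  /-- the curve has no self-intersections -/
  simple : ∀ i j, i ≠ j → tet i = tet j → flag i 0 = flag j 0 →
    Disjoint
      (segment ℝ (sidePoint (flag i 1) (flag i 3) (entryParam i))
        (sidePoint (flag i 1) (flag i 2) (exitParam i)))
      (segment ℝ (sidePoint (flag j 1) (flag j 3) (entryParam j))
        (sidePoint (flag j 1) (flag j 2) (exitParam j)))

variable {T}

namespace PeripheralCurve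

/-- The coefficients of the gluing equation of the curve: each arc contributes the edge parameter of the
angle that it subtends, with sign `+1` if it turns counterclockwise around that corner as seen from the
cusp, and `-1` if it turns clockwise. The arc with flag `p` turns counterclockwise iff
`(p 0, p 1, p 3, p 2)` is an even permutation, i.e. iff `p` is odd. -/
def gluing (γ : T.PeripheralCurve) (i : Fin N) (k : Fin 3) : ℤ :=
  ∑ s : Fin (γ.n + 1),
    if γ.tet s = i ∧ oppositePair (γ.flag s 0) (γ.flag s 1) = k then
      -((Equiv.Perm.sign (γ.flag s) : ℤˣ) : ℤ) else 0

/-- The signed number of crossings of the curve with the side, directed from the corner `σ 1` to the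
corner `σ 2`, of the triangle `(t, σ 0)`. (The side lies on the face `σ 3`.) As a function of the
directed side this is a simplicial 1-cocycle of the boundary surface, Poincaré dual to the curve. -/
def crossing (γ : T.PeripheralCurve) (t : Fin N) (σ : Equiv.Perm (Fin 4)) : ℤ :=
  ((Equiv.Perm.sign σ : ℤˣ) : ℤ) *
    ((Nat.card {s // γ.tet s = t ∧ γ.flag s 0 = σ 0 ∧ γ.flag s 3 = σ 3} : ℤ) -
      (Nat.card {s // γ.tet s = t ∧ γ.flag s 0 = σ 0 ∧ γ.flag s 2 = σ 3} : ℤ))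

end PeripheralCurve

variable (T) in
/-- A function on the directed sides of the boundary triangulation is the coboundary of an integral
function on the vertices. -/
def IsCoboundary (u : Fin N → Equiv.Perm (Fin 4) → ℤ) : Prop :=
  ∃ c : T.LinkVertex → ℤ, ∀ (t : Fin N) (σ : Equiv.Perm (Fin 4)),
    u t σ = c (T.vertexOf ⟨t, σ 0, σ 2, by simp⟩) - c (T.vertexOf ⟨t, σ 0, σ 1, by simp⟩)

namespace PeripheralCurve

/-- The curve is not contractible on the boundary torus (on a torus: not null-homologous). -/
def IsEssential (γ : T.PeripheralCurve) : Prop := ¬ T.IsCoboundary γ.crossing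

/-- The two curves represent the same free homotopy class on the boundary torus, up to orientation. (On a
torus, loops are freely homotopic iff they are homologous, and essential simple loops are
then isotopic.) -/
def SameSlope (γ δ : T.PeripheralCurve) : Prop :=
  T.IsCoboundary (fun t σ => γ.crossing t σ - δ.crossing t σ) ∨
    T.IsCoboundary (fun t σ => γ.crossing t σ + δ.crossing t σ)

end PeripheralCurve

variable (T) in
/-- A combinatorial flattening, with respect to the peripheral curve `γ`: integers attached to
the pairs of opposite edges of the tetrahedra. -/
structure IsFlattening (γ : T.PeripheralCurve) (f : Fin N → Fin 3 → ℤ) : Prop where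
  tet : ∀ i, ∑ k, f i k = 1
  edge : ∀ I : T.Edge, ∑ i, ∑ k, T.edgeGluing I i k * f i k = 2
  curve : ∑ i, ∑ k, γ.gluing i k * f i k = 0

variable (T) in
/-- Non-degenerate shapes that solve the (exponentiated) gluing equations of all edges and of the
peripheral curve `γ`. Here `z i` is the shape of the tetrahedron `i` at its pair `0` of opposite edges. -/
structure IsShapeSolution (γ : T.PeripheralCurve) (z : Fin N → ℂ) : Prop where
  ne_zero : ∀ i, z i ≠ 0
  ne_one : ∀ i, z i ≠ 1
  edge : ∀ I : T.Edge, ∏ i, ∏ k, shapeParam (z i) k ^ T.edgeGluing I i k = 1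
  curve : ∏ i, ∏ k, shapeParam (z i) k ^ γ.gluing i k = 1

variable (T) in
/-- The choices that enter the enhanced Neumann-Zagier datum: a quad type (the pair of opposite edges of
the tetrahedron `i` that carries `Z_i` is `quad i`, so that `Z_i'` and `Z_i''` belong to `quad i + 1` and
`quad i + 2`), an enumeration of the edges, the omitted edge, a meridian loop, and a combinatorial
flattening. -/
structure NZChoice where
  quad : Fin N → Fin 3
  enum : Fin N ≃ T.Edge
  omitted : Fin N
  loop : T.PeripheralCurve
  essential : loop.IsEssential
  flat : Fin N → Fin 3 → ℤ
  isFlattening : T.IsFlattening loop flat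

namespace NZChoice

variable (c : T.NZChoice)

/-- The rows of the gluing matrices that are used: those of the edges, with the row of the omitted edge
replaced by the row of the meridian. -/
def row (i j : Fin N) (k : Fin 3) : ℤ :=
  if i = c.omitted then c.loop.gluing j k else T.edgeGluing (c.enum i) j k

/-- The Neumann-Zagier matrix `A = G - G'`. -/
def A : Matrix (Fin N) (Fin N) ℤ :=
  Matrix.of fun i j => c.row i j (c.quad j) - c.row i j (c.quad j + 1)

/-- The Neumann-Zagier matrix `B = G'' - G'`. -/
def B : Matrix (Fin N) (Fin N) ℤ :=
  Matrix.of fun i j => c.row i j (c.quad j + 2) - c.row i j (c.quad j + 1)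

/-- The shapes `z_i` with respect to the chosen quad type. -/
def z (ζ : Fin N → ℂ) (i : Fin N) : ℂ := shapeParam (ζ i) (c.quad i)

/-- The shapes `z_i''` with respect to the chosen quad type. -/
def z'' (ζ : Fin N → ℂ) (i : Fin N) : ℂ := shapeParam (ζ i) (c.quad i + 2)

/-- The 1-loop expression `½ det(A Δ_{z''} + B Δ_z⁻¹) z^{f''} z''^{-f}`. -/
def oneLoop (ζ : Fin N → ℂ) : ℂ :=
  (1 / 2 : ℂ) *
    (c.A.map (Int.cast : ℤ → ℂ) * Matrix.diagonal (c.z'' ζ) +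
      c.B.map (Int.cast : ℤ → ℂ) * (Matrix.diagonal (c.z ζ))⁻¹).det *
    ∏ i, (c.z ζ i ^ c.flat i (c.quad i + 2) * c.z'' ζ i ^ (-c.flat i (c.quad i)))

end NZChoice

end IdealTriangulation

end

noncomputable section

set_option linter.unusedSectionVars false

/-! Quad type and rows. Once a factor `loopFactor` is pulled out of each column, the 1-loop matrix
has the entries `loopEntry`, which no longer involve the quad type. By f + f' + f'' = 1 and z z' z''
= -1 these factors combine with the monomial of the flattening to something that is, up to sign,
independent of the quad type. A tetrahedron has two edges in each opposite pair and `loopEntry`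
kills the triples (a, a, a), so the rows of all edges add up to zero. Therefore the omitted edge and
the enumeration matter only up to sign, and multiples of edge rows may be added to the meridian row.
Homologous loops have gluing vectors that differ, up to the sign of the orientation, exactly by edge
vectors and triples (a, a, a).

Changing the loop in a flattening. On the cusp torus a flattening is an assignment of angles to
corners with sum 1 in each triangle and 2 around each vertex, and the loop equation says that the
loop has rotation number 0. For simple closed curves this number depends only on the homology class
(`SimpleLoop.rotation_eq`). No isotopies are used. Instead, take a rank-one local system with
nontrivial holonomy along the loop. The twisted cohomology of the torus vanishes, so there is a
cochain on the product of the torus with itself whose coboundary is dual to the diagonal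
(`exists_isPropagator`). Twice its restriction to the diagonal again has sum 1 in triangles and 2
around vertices. By Stokes on the product of the loop with itself, cut open along its diagonal, it
has total 0 along every simple loop with nontrivial holonomy, because distinct points of the loop
never meet. The flattening minus this cochain is a cocycle, and its integrals are homological.

Changing the flattening. The difference w of two flattenings for the same loop is a closed cochain
on the torus orthogonal to the loop, hence a multiple of the dual of the loop plus a coboundary. A
simple essential loop is primitive, by a coloring of its complement; this makes the multiple
half-integral and yields integers C on the edges (`exists_edge_potential`). With y the resulting
integral combination of gluing vectors of the edges and the loop, 2w is the cyclic difference of y.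
The squares of the two monomials then differ by a product of gluing equations, which is 1, and by a
sign whose exponent is shown to be even. So the monomials agree up to sign. -/

/-- A closed oriented triangulated surface, encoded by its corners. The side of a triangle opposite to
the corner `c` is also denoted by `c`. The permutation `rot` rotates the triangles counterclockwise, and
`flip` matches the two triangles at a side. -/
structure TriangulatedSurface (C V F : Type*) where
  rot : Equiv.Perm C
  flip : Equiv.Perm C
  vertex : C → V
  face : C → F
  rot_rot_rot : ∀ c, rot (rot (rot c)) = c
  rot_ne : ∀ c, rot c ≠ c
  flip_flip : ∀ c, flip (flip c) = c
  flip_ne : ∀ c, flip c ≠ c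
  vertex_surjective : Function.Surjective vertex
  face_surjective : Function.Surjective face
  vertex_link : ∀ c, vertex (rot (flip (rot c))) = vertex c
  exists_link : ∀ c d, vertex c = vertex d → ∃ n : ℕ, (fun x => rot (flip (rot x)))^[n] c = d
  face_eq_iff : ∀ c d, face c = face d ↔ d = c ∨ d = rot c ∨ d = rot (rot c)
  connected : ∀ P : C → Prop, (∀ c, P c → P (rot c)) → (∀ c, P c → P (flip c)) → ∀ c d, P c → P d

/-! ### The combinatorics of corners and sides. -/

namespace TriangulatedSurface

variable {C V F : Type*} (M : TriangulatedSurface C V F)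

/-- The rotation of the corners at a vertex. -/
def link : Equiv.Perm C := (M.rot.trans M.flip).trans M.rot

theorem link_apply (c : C) : M.link c = M.rot (M.flip (M.rot c)) := rfl

theorem rot_rot_ne (c : C) : M.rot (M.rot c) ≠ c := fun h =>
  M.rot_ne c (by have := M.rot_rot_rot c; rw [h] at this; exact this)

theorem rot_rot_ne_rot (c : C) : M.rot (M.rot c) ≠ M.rot c := M.rot_ne _

theorem face_rot (c : C) : M.face (M.rot c) = M.face c :=
  ((M.face_eq_iff c (M.rot c)).2 (Or.inr (Or.inl rfl))).symm

theorem vertex_link' (c : C) : M.vertex (M.link c) = M.vertex c := M.vertex_link c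

theorem vertex_rot_flip (h : C) : M.vertex (M.rot (M.flip h)) = M.vertex (M.rot (M.rot h)) := by
  have := M.vertex_link (M.rot (M.rot h))
  rwa [M.rot_rot_rot] at this

theorem vertex_rot_rot_flip (h : C) :
    M.vertex (M.rot (M.rot (M.flip h))) = M.vertex (M.rot h) := by
  rw [← M.vertex_rot_flip (M.flip h), M.flip_flip]

theorem rot_rot_link (c : C) : M.rot (M.rot (M.link c)) = M.flip (M.rot c) := by
  rw [link_apply, M.rot_rot_rot]

variable [Fintype C] [DecidableEq C]

theorem sum_rot {R : Type*} [AddCommMonoid R] (g : C → R) : ∑ c, g (M.rot c) = ∑ c, g c :=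
  Equiv.sum_comp M.rot g

theorem sum_flip {R : Type*} [AddCommMonoid R] (g : C → R) : ∑ c, g (M.flip c) = ∑ c, g c :=
  Equiv.sum_comp M.flip g

theorem sum_face [DecidableEq F] {R : Type*} [AddCommMonoid R] (b : C → R) (c₀ : C) :
    ∑ c, (if M.face c = M.face c₀ then b c else 0) =
      b c₀ + b (M.rot c₀) + b (M.rot (M.rot c₀)) := by
  rw [← Finset.sum_filter]
  have : (Finset.univ.filter fun c => M.face c = M.face c₀) = {c₀, M.rot c₀, M.rot (M.rot c₀)} := by
    ext c
    simp only [Finset.mem_filter, Finset.mem_univ, true_and, Finset.mem_insert,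
      Finset.mem_singleton]
    rw [eq_comm, M.face_eq_iff]
  rw [this, Finset.sum_insert, Finset.sum_insert, Finset.sum_singleton, add_assoc]
  · simpa using (M.rot_rot_ne_rot c₀).symm
  · simpa using ⟨(M.rot_ne c₀).symm, (M.rot_rot_ne c₀).symm⟩

include M in
theorem card_face [Fintype F] : Fintype.card C = 3 * Fintype.card F := by
  classical
  have h := Finset.card_eq_sum_card_fiberwise (f := M.face) (s := Finset.univ)
    (t := Finset.univ) (by intro x _; simp)
  rw [Finset.card_univ] at h
  rw [h, Finset.sum_const_nat (m := 3)]
  · rw [Finset.card_univ, mul_comm]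
  · intro f _
    obtain ⟨c, rfl⟩ := M.face_surjective f
    have := M.sum_face (fun _ => 1) c
    simpa using this

/-! ### Cochains with coefficients in a local system of rank one -/

/-- The monodromy across a side of the local system given by the transport `θ` from the triangles to
their vertices. -/
def monodromy (θ : C → ℚ) (h : C) : ℚ := θ (M.rot (M.flip h)) / θ (M.rot (M.rot h))

/-- `θ` defines a flat local system of rank one. -/
structure IsLocalSystem (θ : C → ℚ) : Prop where
  ne_zero : ∀ c, θ c ≠ 0
  flat : ∀ h, θ (M.rot (M.flip h)) * θ (M.rot h) =
    θ (M.rot (M.rot h)) * θ (M.rot (M.rot (M.flip h)))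

variable {M} {θ : C → ℚ}

namespace IsLocalSystem

omit [Fintype C] [DecidableEq C]

variable (hθ : M.IsLocalSystem θ)
include hθ

theorem monodromy_ne_zero (h : C) : M.monodromy θ h ≠ 0 :=
  div_ne_zero (hθ.ne_zero _) (hθ.ne_zero _)

theorem monodromy_mul (h : C) : M.monodromy θ h * M.monodromy θ (M.flip h) = 1 := by
  have h1 := hθ.flat h
  have := hθ.ne_zero
  unfold monodromy
  rw [M.flip_flip, div_mul_div_comm, h1, div_self (mul_ne_zero (this _) (this _))]

theorem monodromy_flip (h : C) : M.monodromy θ (M.flip h) = (M.monodromy θ h)⁻¹ :=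
  eq_inv_of_mul_eq_one_right (hθ.monodromy_mul h)

theorem mul_monodromy (h : C) :
    θ (M.rot (M.rot h)) * M.monodromy θ h = θ (M.rot (M.flip h)) :=
  mul_div_cancel₀ _ (hθ.ne_zero _)

theorem mul_monodromy' (h : C) :
    θ (M.rot h) * M.monodromy θ h = θ (M.rot (M.rot (M.flip h))) := by
  unfold monodromy
  have := hθ.ne_zero (M.rot (M.rot h))
  field_simp
  linarith [hθ.flat h]

theorem inv : M.IsLocalSystem θ⁻¹ where
  ne_zero c := inv_ne_zero (hθ.ne_zero c)
  flat h := by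
    simp only [Pi.inv_apply, ← mul_inv, hθ.flat h]

omit hθ in
theorem monodromy_inv (h : C) : M.monodromy θ⁻¹ h = (M.monodromy θ h)⁻¹ := by
  simp [monodromy, div_eq_mul_inv, mul_comm]

end IsLocalSystem

variable (M θ) in
/-- The incidence matrix of the coboundary map from the 1-cochains to the 2-cochains. -/
def faceMatrix [DecidableEq V] [DecidableEq F] : Matrix (F ⊕ V) C ℚ :=
  Matrix.of fun x c => Sum.elim (fun f => if M.face c = f then 1 else 0)
    (fun v => if M.vertex c = v then θ c else 0) x

variable (M θ) in
/-- The 0-cochains: functions on the sides with values in the local system. -/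
def sideCochains : Submodule ℚ (C → ℚ) where
  carrier := {g | ∀ h, g h = M.monodromy θ h * g (M.flip h)}
  add_mem' {a b} ha hb h := by
    simp only [Set.mem_ofPred_eq] at ha hb
    simp only [Pi.add_apply, mul_add, ← ha, ← hb]
  zero_mem' h := by simp
  smul_mem' q a ha h := by
    simp only [Set.mem_ofPred_eq] at ha
    simp only [Pi.smul_apply, smul_eq_mul]
    rw [ha h]; ring

theorem mem_sideCochains {g : C → ℚ} :
    g ∈ M.sideCochains θ ↔ ∀ h, g h = M.monodromy θ h * g (M.flip h) := Iff.rfl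

variable (M) in
/-- The coboundary of a function on the sides. -/
def sideCoboundary : (C → ℚ) →ₗ[ℚ] (C → ℚ) where
  toFun g c := g (M.rot c) - g (M.rot (M.rot c))
  map_add' a b := by ext c; simp only [Pi.add_apply]; ring
  map_smul' q a := by ext c; simp only [Pi.smul_apply, smul_eq_mul, RingHom.id_apply]; ring

theorem sideCoboundary_apply (g : C → ℚ) (c : C) :
    M.sideCoboundary g c = g (M.rot c) - g (M.rot (M.rot c)) := rfl

omit [DecidableEq C] in
theorem faceMatrix_mulVec_inl [DecidableEq V] [DecidableEq F] (b : C → ℚ) (f : F) :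
    (M.faceMatrix θ).mulVec b (Sum.inl f) = ∑ c, if M.face c = f then b c else 0 := by
  simp [Matrix.mulVec, dotProduct, faceMatrix]

omit [DecidableEq C] in
theorem faceMatrix_mulVec_inr [DecidableEq V] [DecidableEq F] (b : C → ℚ) (v : V) :
    (M.faceMatrix θ).mulVec b (Sum.inr v) = ∑ c, if M.vertex c = v then θ c * b c else 0 := by
  simp [Matrix.mulVec, dotProduct, faceMatrix]

omit [Fintype C] [DecidableEq C] in
theorem faceMatrix_transpose_mulVec [DecidableEq V] [DecidableEq F] [Fintype V] [Fintype F]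
    (y : F ⊕ V → ℚ) (c : C) :
    (M.faceMatrix θ).transpose.mulVec y c =
      y (Sum.inl (M.face c)) + θ c * y (Sum.inr (M.vertex c)) := by
  simp [Matrix.mulVec, dotProduct, faceMatrix]

omit [DecidableEq C] in
theorem sum_vertex_link [DecidableEq V] (g : C → ℚ) (v : V) :
    ∑ c, (if M.vertex c = v then g (M.link c) else 0) =
      ∑ c, if M.vertex c = v then g c else 0 := by
  rw [← Equiv.sum_comp M.link (fun c => if M.vertex c = v then g c else 0)]
  simp only [M.vertex_link']

/-- Consecutive corners at a vertex share a side; the transports to the vertex identify its values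
seen from the two triangles. This makes sums around a vertex telescope. -/
theorem IsLocalSystem.mul_rot (hθ : M.IsLocalSystem θ) {g : C → ℚ} (hg : g ∈ M.sideCochains θ)
    (c : C) : θ c * g (M.rot c) = θ (M.link c) * g (M.rot (M.rot (M.link c))) := by
  rw [hg (M.rot c), M.rot_rot_link, ← mul_assoc]
  congr 1
  have := hθ.mul_monodromy (M.rot c)
  rwa [M.rot_rot_rot] at this

/-- This is d² = 0 for the medial cell structure: its 0-cells are the sides, its 1-cells the arcs
around the corners, its 2-cells the triangles and the vertices. The boundary of each 2-cell is a
cyclic chain of arcs. -/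
theorem faceMatrix_mulVec_sideCoboundary [DecidableEq V] [DecidableEq F]
    (hθ : M.IsLocalSystem θ) {g : C → ℚ} (hg : g ∈ M.sideCochains θ) :
    (M.faceMatrix θ).mulVec (M.sideCoboundary g) = 0 := by
  funext x
  rcases x with f | v
  · obtain ⟨c, rfl⟩ := M.face_surjective f
    rw [faceMatrix_mulVec_inl, M.sum_face]
    simp only [sideCoboundary_apply, M.rot_rot_rot, Pi.zero_apply]
    ring
  · rw [faceMatrix_mulVec_inr]
    have h := sum_vertex_link (M := M) (fun c => θ c * g (M.rot (M.rot c))) v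
    simp only [← hθ.mul_rot hg] at h
    rw [← sub_eq_zero, ← Finset.sum_sub_distrib] at h
    refine Eq.trans (Finset.sum_congr rfl fun c _ => ?_) h
    rw [sideCoboundary_apply]
    split_ifs <;> ring

/-- One equation for each undirected side suffices, since the equation of the flipped side is
equivalent. -/
theorem card_le_finrank_sideCochains (hθ : M.IsLocalSystem θ) :
    Fintype.card C ≤ 2 * Module.finrank ℚ (M.sideCochains θ) := by
  classical
  let e := Fintype.equivFin C
  -- An arbitrary enumeration selects one direction of each side.
  let S : Finset C := Finset.univ.filter fun h => e h < e (M.flip h)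
  have hS : 2 * S.card = Fintype.card C := by
    have h1 : (Finset.univ.filter fun h => ¬ e h < e (M.flip h)).card = S.card := by
      symm
      refine Finset.card_bij (fun h _ => M.flip h) ?_ ?_ ?_
      · intro a ha
        simp only [S, Finset.mem_filter, Finset.mem_univ, true_and] at ha ⊢
        rw [M.flip_flip]; exact not_lt.2 ha.le
      · intro a _ b _ h; exact M.flip.injective h
      · intro b hb
        simp only [Finset.mem_filter, Finset.mem_univ, true_and, not_lt] at hb
        refine ⟨M.flip b, ?_, M.flip_flip b⟩
        simp only [S, Finset.mem_filter, Finset.mem_univ, true_and]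
        rw [M.flip_flip]
        exact lt_of_le_of_ne hb fun h => M.flip_ne b (e.injective h)
    have h2 : S.card + (Finset.univ.filter fun h => ¬ e h < e (M.flip h)).card =
        Fintype.card C :=
      Finset.card_filter_add_card_filter_not (s := (Finset.univ : Finset C))
        (fun h => e h < e (M.flip h))
    omega
  let φ : (C → ℚ) →ₗ[ℚ] (S → ℚ) :=
    { toFun := fun g h => g h - M.monodromy θ h * g (M.flip h)
      map_add' := fun a b => by ext h; simp only [Pi.add_apply]; ring
      map_smul' := fun q a => by
        ext h; simp only [Pi.smul_apply, smul_eq_mul, RingHom.id_apply]; ring }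
  have hker : LinearMap.ker φ ≤ M.sideCochains θ := by
    intro g hg h
    have hg' : ∀ x ∈ S, g x = M.monodromy θ x * g (M.flip x) := fun x hx =>
      sub_eq_zero.1 (congrFun (LinearMap.mem_ker.1 hg) ⟨x, hx⟩)
    by_cases hh : h ∈ S
    · exact hg' h hh
    · have hf : M.flip h ∈ S := by
        simp only [S, Finset.mem_filter, Finset.mem_univ, true_and, not_lt] at hh ⊢
        rw [M.flip_flip]
        exact lt_of_le_of_ne hh fun h' => M.flip_ne h (e.injective h')
      rw [hg' _ hf, M.flip_flip, ← mul_assoc, hθ.monodromy_mul, one_mul]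
  have h1 := LinearMap.finrank_range_add_finrank_ker φ
  have h2 : Module.finrank ℚ (LinearMap.range φ) ≤ S.card := by
    refine (Submodule.finrank_le _).trans ?_
    simp
  have h3 := Submodule.finrank_mono hker
  rw [Module.finrank_fintype_fun_eq_card] at h1
  omega

/-- The 1-cocycles have the dimension predicted by the Euler characteristic. -/
theorem finrank_ker_faceMatrix [DecidableEq V] [DecidableEq F] [Fintype V] [Fintype F]
    (hE : Fintype.card C = 6 * Fintype.card V) :
    2 * Module.finrank ℚ (LinearMap.ker (M.faceMatrix θ).mulVecLin) =
      Fintype.card C + 2 * Module.finrank ℚ (LinearMap.ker (M.faceMatrix θ).transpose.mulVecLin) := by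
  have h1 := LinearMap.finrank_range_add_finrank_ker (M.faceMatrix θ).mulVecLin
  have h2 := LinearMap.finrank_range_add_finrank_ker (M.faceMatrix θ).transpose.mulVecLin
  have h3 := Matrix.rank_transpose (M.faceMatrix θ)
  unfold Matrix.rank at h3
  rw [Module.finrank_fintype_fun_eq_card] at h1 h2
  rw [Fintype.card_sum] at h2
  -- With |C| = 3|F| and |C| = 6|V| there are |F| + |V| = |C|/2 rows, and the matrix and its
  -- transpose have the same rank.
  have h4 := card_face M
  omega

end TriangulatedSurface

/-! ### Vanishing of twisted cohomology on a torus. -/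

namespace TriangulatedSurface

variable {C V F : Type*} {M : TriangulatedSurface C V F} [Fintype C] [DecidableEq C] {θ : C → ℚ}

variable (M θ) in
/-- The local system has no nonzero global sections. -/
def NoSections : Prop :=
  ∀ A : C → ℚ, (∀ c, A (M.rot c) = A c) → A ∈ M.sideCochains θ → A = 0

/-- A vector in the left kernel is determined on the triangles around a vertex by its value at that
vertex. Comparing the two triangles at a side through a common vertex gives a section of the inverse
local system. -/
theorem transpose_eq_monodromy [DecidableEq V] [DecidableEq F] [Fintype V] [Fintype F]
    (hθ : M.IsLocalSystem θ) {y : F ⊕ V → ℚ} (hy : (M.faceMatrix θ).transpose.mulVec y = 0) :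
    (fun c => y (Sum.inl (M.face c))) ∈ M.sideCochains θ⁻¹ := by
  intro h
  have h1 := congrFun hy (M.rot (M.rot h))
  have h2 := congrFun hy (M.rot (M.flip h))
  rw [faceMatrix_transpose_mulVec, Pi.zero_apply] at h1 h2
  rw [M.face_rot, M.face_rot] at h1
  rw [M.face_rot, M.vertex_rot_flip, ← hθ.mul_monodromy] at h2
  rw [IsLocalSystem.monodromy_inv]
  have h3 := hθ.monodromy_ne_zero h
  field_simp
  linear_combination M.monodromy θ h * h1 - h2

/-- Poincaré duality: the cokernel is dual to the sections of the inverse local system, so the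
second cohomology vanishes. -/
theorem faceMatrix_surjective [DecidableEq V] [DecidableEq F] [Fintype V] [Fintype F]
    (hθ : M.IsLocalSystem θ) (hn : M.NoSections θ⁻¹) :
    LinearMap.range (M.faceMatrix θ).mulVecLin = ⊤ := by
  have hker : LinearMap.ker (M.faceMatrix θ).transpose.mulVecLin = ⊥ := by
    rw [LinearMap.ker_eq_bot']
    intro y hy
    rw [Matrix.mulVecLin_apply] at hy
    have h1 := hn _ (fun c => by rw [M.face_rot]) (transpose_eq_monodromy hθ hy)
    funext x
    rcases x with f | v
    · obtain ⟨c, rfl⟩ := M.face_surjective f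
      exact congrFun h1 c
    · obtain ⟨c, rfl⟩ := M.vertex_surjective v
      have h2 := congrFun hy c
      rw [faceMatrix_transpose_mulVec, congrFun h1 c] at h2
      simpa [hθ.ne_zero c] using h2
  have h2 := LinearMap.finrank_range_add_finrank_ker (M.faceMatrix θ).transpose.mulVecLin
  have h3 := Matrix.rank_transpose (M.faceMatrix θ)
  unfold Matrix.rank at h3
  rw [hker, finrank_bot, add_zero, h3] at h2
  exact Submodule.eq_top_of_finrank_eq h2

/-- The Euler characteristic is 0 and the cohomology in degrees 0 and 2 vanishes, so it vanishes in
degree 1 as well. -/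
theorem exists_sideCoboundary_eq [DecidableEq V] [DecidableEq F] [Fintype V] [Fintype F]
    (hE : Fintype.card C = 6 * Fintype.card V) (hθ : M.IsLocalSystem θ)
    (hn : M.NoSections θ) (hn' : M.NoSections θ⁻¹) {b : C → ℚ}
    (hb : (M.faceMatrix θ).mulVec b = 0) :
    ∃ g ∈ M.sideCochains θ, M.sideCoboundary g = b := by
  have hle : (M.sideCochains θ).map M.sideCoboundary ≤
      LinearMap.ker (M.faceMatrix θ).mulVecLin := by
    rintro _ ⟨g, hg, rfl⟩
    exact faceMatrix_mulVec_sideCoboundary hθ hg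
  have hinj : Set.InjOn M.sideCoboundary (M.sideCochains θ) := by
    intro g hg g' hg' h
    rw [← sub_eq_zero]
    refine hn _ (fun c => ?_) (Submodule.sub_mem _ hg hg')
    have := congrFun h (M.rot (M.rot c))
    simp only [sideCoboundary_apply, M.rot_rot_rot] at this
    simp only [Pi.sub_apply]
    linarith
  have h1 : Module.finrank ℚ ((M.sideCochains θ).map M.sideCoboundary) =
      Module.finrank ℚ (M.sideCochains θ) := by
    rw [← LinearMap.range_domRestrict]
    exact LinearMap.finrank_range_of_inj fun x y h => Subtype.ext (hinj x.2 y.2 h)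
  have h2 := card_le_finrank_sideCochains hθ
  have h3 := finrank_ker_faceMatrix (M := M) (θ := θ) hE
  have h4 := faceMatrix_surjective hθ hn'
  have h5 := LinearMap.finrank_range_add_finrank_ker (M.faceMatrix θ).mulVecLin
  have h6 := card_face M
  rw [h4, finrank_top, Module.finrank_fintype_fun_eq_card, Module.finrank_fintype_fun_eq_card,
    Fintype.card_sum] at h5
  have h7 := Submodule.eq_of_le_of_finrank_le hle (by rw [h1]; omega)
  have h8 : b ∈ LinearMap.ker (M.faceMatrix θ).mulVecLin := hb
  rw [← h7] at h8
  obtain ⟨g, hg, rfl⟩ := h8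
  exact ⟨g, hg, rfl⟩

/-! ### The propagator -/

variable (M) in
/-- The algebraic intersection number of two arcs in a triangle. -/
def arcPairing (c b : C) : ℚ :=
  (if b = M.rot c then 1 / 2 else 0) - (if b = M.rot (M.rot c) then 1 / 2 else 0)

variable (M θ) in
/-- Half the sum of the two endpoints of a side. -/
def endpointWeight [DecidableEq V] (h : C) (v : V) : ℚ :=
  (if M.vertex (M.rot h) = v then θ (M.rot h) / 2 else 0) +
    (if M.vertex (M.rot (M.rot h)) = v then θ (M.rot (M.rot h)) / 2 else 0)

theorem endpointWeight_flip [DecidableEq V] (hθ : M.IsLocalSystem θ) (h : C) (v : V) :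
    M.endpointWeight θ (M.flip h) v = M.monodromy θ h * M.endpointWeight θ h v := by
  unfold endpointWeight
  rw [M.vertex_rot_flip, M.vertex_rot_rot_flip, ← hθ.mul_monodromy, ← hθ.mul_monodromy']
  split_ifs <;> ring

variable (M θ) in
/-- A cochain on the product of the surface with itself, with coefficients in the local system, whose
coboundary is dual to the diagonal. -/
structure IsPropagator [DecidableEq V] (K₁ K₂ : C → C → ℚ) : Prop where
  flip₁ : ∀ h c, K₁ (M.flip h) c = M.monodromy θ h * K₁ h c
  face₁ : ∀ h c, K₁ h c + K₁ h (M.rot c) + K₁ h (M.rot (M.rot c)) = 0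
  vertex₁ : ∀ h v, ∑ c, (if M.vertex c = v then θ c * K₁ h c else 0) = M.endpointWeight θ h v
  flip₂ : ∀ c h, K₂ c h = M.monodromy θ h * K₂ c (M.flip h)
  square : ∀ c b, K₂ c (M.rot b) - K₂ c (M.rot (M.rot b)) =
    K₁ (M.rot c) b - K₁ (M.rot (M.rot c)) b + M.arcPairing c b
  face₂ : ∀ c h, K₂ c h + K₂ (M.rot c) h + K₂ (M.rot (M.rot c)) h = 0
  vertex₂ : ∀ v h, ∑ c, (if M.vertex c = v then (θ c)⁻¹ * K₂ c h else 0) =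
    M.endpointWeight θ⁻¹ h v

theorem eq_zero_of_sideCoboundary_eq_zero (hn : M.NoSections θ) {g : C → ℚ}
    (hg : g ∈ M.sideCochains θ) (h : ∀ b, g (M.rot b) - g (M.rot (M.rot b)) = 0) : g = 0 := by
  refine hn g (fun c => ?_) hg
  have := h (M.rot (M.rot c))
  simp only [M.rot_rot_rot] at this
  linarith

theorem arcPairing_face (c b : C) : M.arcPairing c b + M.arcPairing c (M.rot b) +
    M.arcPairing c (M.rot (M.rot b)) = 0 := by
  classical
  have h1 := M.sum_face (fun x => M.arcPairing c x) b
  rw [← h1]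
  have h2 : ∀ x, (if M.face x = M.face b then M.arcPairing c x else 0) =
      (if x = M.rot c then (if M.face x = M.face b then 1 / 2 else 0) else 0) -
      (if x = M.rot (M.rot c) then (if M.face x = M.face b then 1 / 2 else 0) else 0) := by
    intro x; unfold arcPairing; split_ifs <;> simp
  simp only [h2, Finset.sum_sub_distrib, Finset.sum_ite_eq', Finset.mem_univ, if_true,
    M.face_rot, sub_self]

theorem arcPairing_face' (c b : C) : M.arcPairing c b + M.arcPairing (M.rot c) b +
    M.arcPairing (M.rot (M.rot c)) b = 0 := by
  have h : ∀ c b, M.arcPairing c b = - M.arcPairing b c := by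
    intro c b
    unfold arcPairing
    have h1 : b = M.rot c ↔ c = M.rot (M.rot b) := by
      constructor <;> rintro rfl
      · rw [M.rot_rot_rot]
      · rw [M.rot_rot_rot]
    have h2 : b = M.rot (M.rot c) ↔ c = M.rot b := by
      constructor <;> rintro rfl
      · rw [M.rot_rot_rot]
      · rw [M.rot_rot_rot]
    rw [if_congr h1 rfl rfl, if_congr h2 rfl rfl]; ring
  rw [h c, h (M.rot c), h (M.rot (M.rot c))]
  linarith [M.arcPairing_face b c]

theorem sum_arcPairing (c : C) (y : C → ℚ) :
    ∑ b, y b * M.arcPairing c b = y (M.rot c) / 2 - y (M.rot (M.rot c)) / 2 := by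
  unfold arcPairing
  simp only [mul_sub, Finset.sum_sub_distrib, mul_ite, mul_zero, Finset.sum_ite_eq',
    Finset.mem_univ, if_true]
  ring

theorem sum_arcPairing' (b : C) (y : C → ℚ) :
    ∑ c, y c * M.arcPairing c b = y (M.rot (M.rot b)) / 2 - y (M.rot b) / 2 := by
  have h1 : ∀ c, b = M.rot c ↔ c = M.rot (M.rot b) := by
    intro c
    constructor <;> rintro rfl
    · rw [M.rot_rot_rot]
    · rw [M.rot_rot_rot]
  have h2 : ∀ c, b = M.rot (M.rot c) ↔ c = M.rot b := by
    intro c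
    constructor <;> rintro rfl
    · rw [M.rot_rot_rot]
    · rw [M.rot_rot_rot]
  have h3 : ∀ c, M.arcPairing c b = (if c = M.rot (M.rot b) then 1 / 2 else 0) -
      (if c = M.rot b then 1 / 2 else 0) := fun c => by
    unfold arcPairing
    rw [if_congr (h1 c) rfl rfl, if_congr (h2 c) rfl rfl]
  simp only [h3, mul_sub, Finset.sum_sub_distrib, mul_ite, mul_zero, Finset.sum_ite_eq',
    Finset.mem_univ, if_true]
  ring

/-- The component `K₁` exists because the second cohomology vanishes, `K₂` because the first one
does, and the face and vertex conditions on `K₂` are forced because there are no sections. -/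
theorem exists_isPropagator [DecidableEq V] [DecidableEq F] [Fintype V] [Fintype F]
    (hE : Fintype.card C = 6 * Fintype.card V) (hθ : M.IsLocalSystem θ)
    (hn : M.NoSections θ) (hn' : M.NoSections θ⁻¹) :
    ∃ K₁ K₂, M.IsPropagator θ K₁ K₂ := by
  -- A linear choice of preimages makes `K₁` inherit the transformation rule of the endpoint weights
  -- under `flip`.
  obtain ⟨S, hS⟩ := LinearMap.exists_rightInverse_of_surjective _ (faceMatrix_surjective hθ hn')
  have hS' : ∀ y, (M.faceMatrix θ).mulVec (S y) = y := fun y => LinearMap.congr_fun hS y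
  let E : C → F ⊕ V → ℚ := fun h => Sum.elim (fun _ => 0) (M.endpointWeight θ h)
  let K₁ : C → C → ℚ := fun h => S (E h)
  have hflip₁ : ∀ h c, K₁ (M.flip h) c = M.monodromy θ h * K₁ h c := by
    intro h c
    have : E (M.flip h) = M.monodromy θ h • E h := by
      funext x
      rcases x with f | v
      · simp [E]
      · simp only [E, Sum.elim_inr, Pi.smul_apply, smul_eq_mul]
        exact endpointWeight_flip hθ h v
    simp only [K₁, this, map_smul, Pi.smul_apply, smul_eq_mul]
  have hface₁ : ∀ h c, K₁ h c + K₁ h (M.rot c) + K₁ h (M.rot (M.rot c)) = 0 := by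
    intro h c
    have := congrFun (hS' (E h)) (Sum.inl (M.face c))
    rw [faceMatrix_mulVec_inl, M.sum_face] at this
    exact this
  have hvertex₁ : ∀ h v, ∑ c, (if M.vertex c = v then θ c * K₁ h c else 0) =
      M.endpointWeight θ h v := by
    intro h v
    have := congrFun (hS' (E h)) (Sum.inr v)
    rw [faceMatrix_mulVec_inr] at this
    exact this
  -- The right-hand side of the square equation is a cocycle in b: around a vertex, the difference
  -- of the endpoint weights of two sides of the triangle cancels against the arc pairing.
  have hex : ∀ c, ∃ g ∈ M.sideCochains θ, M.sideCoboundary g =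
      fun b => K₁ (M.rot c) b - K₁ (M.rot (M.rot c)) b + M.arcPairing c b := by
    intro c
    refine exists_sideCoboundary_eq hE hθ hn hn' ?_
    funext x
    rcases x with f | v
    · obtain ⟨b, rfl⟩ := M.face_surjective f
      rw [faceMatrix_mulVec_inl, M.sum_face, Pi.zero_apply]
      linarith [hface₁ (M.rot c) b, hface₁ (M.rot (M.rot c)) b, M.arcPairing_face c b]
    · rw [faceMatrix_mulVec_inr, Pi.zero_apply]
      have h1 := hvertex₁ (M.rot c) v
      have h2 := hvertex₁ (M.rot (M.rot c)) v
      have h3 := M.sum_arcPairing c (fun b => if M.vertex b = v then θ b else 0)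
      have h4 : ∑ b, (if M.vertex b = v then θ b *
          (K₁ (M.rot c) b - K₁ (M.rot (M.rot c)) b + M.arcPairing c b) else 0) =
          ∑ b, (if M.vertex b = v then θ b * K₁ (M.rot c) b else 0) -
          ∑ b, (if M.vertex b = v then θ b * K₁ (M.rot (M.rot c)) b else 0) +
          ∑ b, (if M.vertex b = v then θ b else 0) * M.arcPairing c b := by
        rw [← Finset.sum_sub_distrib, ← Finset.sum_add_distrib]
        refine Finset.sum_congr rfl fun b _ => ?_
        split_ifs <;> ring
      rw [h4, h1, h2, h3]
      unfold endpointWeight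
      simp only [M.rot_rot_rot]
      split_ifs <;> ring
  choose K₂ hK₂ hK₂' using hex
  have hsq : ∀ c b, K₂ c (M.rot b) - K₂ c (M.rot (M.rot b)) =
      K₁ (M.rot c) b - K₁ (M.rot (M.rot c)) b + M.arcPairing c b :=
    fun c b => congrFun (hK₂' c) b
  refine ⟨K₁, K₂, hflip₁, hface₁, hvertex₁, fun c => hK₂ c, hsq, ?_, ?_⟩
  · intro c
    -- The sum has coboundary zero, as the `K₁` terms telescope and the arc pairings cancel; without
    -- sections it must vanish.
    have : K₂ c + K₂ (M.rot c) + K₂ (M.rot (M.rot c)) = 0 := by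
      refine eq_zero_of_sideCoboundary_eq_zero hn
        (Submodule.add_mem _ (Submodule.add_mem _ (hK₂ _) (hK₂ _)) (hK₂ _)) fun b => ?_
      have h0 := hsq c b
      have h1 := hsq (M.rot c) b
      have h2 := hsq (M.rot (M.rot c)) b
      have h3 := M.arcPairing_face' c b
      simp only [M.rot_rot_rot] at h0 h1 h2
      simp only [Pi.add_apply]
      linarith
    exact fun h => congrFun this h
  · intro v
    -- Same uniqueness argument: the difference is a cochain with zero coboundary, since the `K₁`
    -- terms telescope around the vertex.
    have : (∑ c, if M.vertex c = v then (θ c)⁻¹ • K₂ c else 0) -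
        (fun h => M.endpointWeight θ⁻¹ h v) = 0 := by
      refine eq_zero_of_sideCoboundary_eq_zero hn (Submodule.sub_mem _
        (Submodule.sum_mem _ fun c _ => ?_) ?_) fun b => ?_
      · split_ifs
        · exact Submodule.smul_mem _ _ (hK₂ c)
        · exact Submodule.zero_mem _
      · intro h
        show M.endpointWeight θ⁻¹ h v = _ * M.endpointWeight θ⁻¹ (M.flip h) v
        rw [endpointWeight_flip hθ.inv, IsLocalSystem.monodromy_inv, ← mul_assoc,
          mul_inv_cancel₀ (hθ.monodromy_ne_zero h), one_mul]
      · have happ : ∀ h, (∑ c, if M.vertex c = v then (θ c)⁻¹ • K₂ c else 0) h =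
            ∑ c, if M.vertex c = v then (θ c)⁻¹ * K₂ c h else 0 := by
          intro h
          rw [Finset.sum_apply]
          refine Finset.sum_congr rfl fun c _ => ?_
          split_ifs <;> simp
        simp only [Pi.sub_apply, happ]
        have hK₁ : (fun h => K₁ h b) ∈ M.sideCochains θ⁻¹ := by
          intro h
          show K₁ h b = _ * K₁ (M.flip h) b
          rw [hflip₁, IsLocalSystem.monodromy_inv, ← mul_assoc,
            inv_mul_cancel₀ (hθ.monodromy_ne_zero h), one_mul]
        have h1 := sum_vertex_link (M := M) (fun c => θ⁻¹ c * K₁ (M.rot (M.rot c)) b) v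
        have h5 := fun c => hθ.inv.mul_rot hK₁ c
        simp only [← h5] at h1
        have h3 := M.sum_arcPairing' b (fun b => if M.vertex b = v then (θ b)⁻¹ else 0)
        have h4 : ∑ c, (if M.vertex c = v then (θ c)⁻¹ * K₂ c (M.rot b) else 0) -
            ∑ c, (if M.vertex c = v then (θ c)⁻¹ * K₂ c (M.rot (M.rot b)) else 0) =
            ∑ c, (if M.vertex c = v then θ⁻¹ c * K₁ (M.rot c) b else 0) -
            ∑ c, (if M.vertex c = v then θ⁻¹ c * K₁ (M.rot (M.rot c)) b else 0) +
            ∑ c, (if M.vertex c = v then (θ c)⁻¹ else 0) * M.arcPairing c b := by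
          rw [← Finset.sum_sub_distrib, ← Finset.sum_sub_distrib, ← Finset.sum_add_distrib]
          refine Finset.sum_congr rfl fun c _ => ?_
          have := hsq c b
          simp only [Pi.inv_apply]
          split_ifs
          · linear_combination (θ c)⁻¹ * this
          · ring
        have h6 : M.endpointWeight θ⁻¹ (M.rot b) v - M.endpointWeight θ⁻¹ (M.rot (M.rot b)) v =
            (if M.vertex (M.rot (M.rot b)) = v then (θ (M.rot (M.rot b)))⁻¹ else 0) / 2 -
            (if M.vertex (M.rot b) = v then (θ (M.rot b))⁻¹ else 0) / 2 := by
          unfold endpointWeight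
          simp only [M.rot_rot_rot, Pi.inv_apply]
          split_ifs <;> ring
        linarith
    intro h
    have h1 := congrFun this h
    simp only [Pi.sub_apply, Finset.sum_apply, Pi.zero_apply] at h1
    rw [← sub_eq_zero]
    refine Eq.trans (congrArg (· - _) ?_) h1
    refine Finset.sum_congr rfl fun c _ => ?_
    split_ifs <;> simp

variable (M) in
/-- The restriction of the propagator to the diagonal. -/
def diagonalCochain (K₁ K₂ : C → C → ℚ) (c : C) : ℚ :=
  K₁ (M.rot (M.rot c)) c + K₂ c (M.rot c)

theorem arcPairing_self (c : C) : M.arcPairing c c = 0 := by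
  unfold arcPairing
  rw [if_neg (M.rot_ne c).symm, if_neg (M.rot_rot_ne c).symm, sub_zero]

theorem arcPairing_rot_rot (c : C) : M.arcPairing c (M.rot (M.rot c)) = -1 / 2 := by
  unfold arcPairing
  rw [if_neg (M.rot_rot_ne_rot c), if_pos rfl]; norm_num

/-- The diagonal of triangle × triangle is pushed across two squares onto {side} × triangle and
triangle × {side}, where the face conditions give 0. Only one of the squares meets the diagonal,
with weight 1/2. -/
theorem IsPropagator.diagonalCochain_face [DecidableEq V] {K₁ K₂ : C → C → ℚ}
    (hK : M.IsPropagator θ K₁ K₂) (c : C) :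
    M.diagonalCochain K₁ K₂ c + M.diagonalCochain K₁ K₂ (M.rot c) +
      M.diagonalCochain K₁ K₂ (M.rot (M.rot c)) = 1 / 2 := by
  have h1 := hK.square c (M.rot (M.rot c))
  have h2 := hK.square (M.rot c) (M.rot c)
  have h3 := hK.face₂ c c
  have h4 := hK.face₁ (M.rot (M.rot c)) c
  rw [arcPairing_rot_rot] at h1
  rw [arcPairing_self] at h2
  unfold diagonalCochain
  simp only [M.rot_rot_rot] at *
  linarith

end TriangulatedSurface

/-! ### Stokes' theorem for the propagator along paths. -/

namespace TriangulatedSurface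

variable {C V F : Type*} {M : TriangulatedSurface C V F} {θ : C → ℚ}

variable (M) in
/-- A path in normal position: a sequence of arcs, each of which turns around a corner of a triangle. -/
structure NormalPath where
  corner : ℕ → C
  ccw : ℕ → Bool
  step : ∀ i, (if ccw (i + 1) then M.rot (M.rot (corner (i + 1))) else M.rot (corner (i + 1))) =
    M.flip (if ccw i then M.rot (corner i) else M.rot (M.rot (corner i)))

namespace NormalPath

variable (p : M.NormalPath)

/-- The side through which an arc enters. -/
def entry (i : ℕ) : C :=
  if p.ccw i then M.rot (M.rot (p.corner i)) else M.rot (p.corner i)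

/-- The side through which an arc leaves. -/
def exit (i : ℕ) : C :=
  if p.ccw i then M.rot (p.corner i) else M.rot (M.rot (p.corner i))

/-- The sign of an arc: positive if it turns counterclockwise around its corner. -/
def sign (i : ℕ) : ℤ := if p.ccw i then 1 else -1

theorem entry_succ (i : ℕ) : p.entry (i + 1) = M.flip (p.exit i) := p.step i

theorem entry_ne_exit (i : ℕ) : p.entry i ≠ p.exit i := by
  unfold entry exit
  split_ifs
  · exact M.rot_rot_ne_rot _
  · exact (M.rot_rot_ne_rot _).symm

/-- The parallel transport along the path. -/
def transport (θ : C → ℚ) : ℕ → ℚ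
  | 0 => 1
  | i + 1 => transport θ i * M.monodromy θ (p.exit i)

theorem transport_ne_zero (hθ : M.IsLocalSystem θ) (i : ℕ) : p.transport θ i ≠ 0 := by
  induction i with
  | zero => exact one_ne_zero
  | succ i ih => exact mul_ne_zero ih (hθ.monodromy_ne_zero _)

variable [Fintype C] [DecidableEq C]

section Square

variable [DecidableEq V] {K₁ K₂ : C → C → ℚ} (hK : M.IsPropagator θ K₁ K₂)
  {ρ : ℕ → ℚ} (hρ0 : ∀ i, ρ i ≠ 0) (hρ : ∀ i, ρ (i + 1) = ρ i * M.monodromy θ (p.exit i))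
include hK hρ0 hρ

/-- The square equation for the i-th and the j-th arc of a path, transported to a common base by
`ρ`, so that the equations of adjacent squares can be added. -/
theorem propagator_square (i j : ℕ) :
    (ρ i)⁻¹ * ρ (j + 1) * (p.sign i * K₂ (p.corner i) (p.entry (j + 1))) -
      (ρ i)⁻¹ * ρ j * (p.sign i * K₂ (p.corner i) (p.entry j)) =
    (ρ (i + 1))⁻¹ * ρ j * (p.sign j * K₁ (p.entry (i + 1)) (p.corner j)) -
      (ρ i)⁻¹ * ρ j * (p.sign j * K₁ (p.entry i) (p.corner j)) +
      (ρ i)⁻¹ * ρ j * (p.sign i * p.sign j * M.arcPairing (p.corner i) (p.corner j)) := by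
  have h1 := hK.flip₂ (p.corner i) (p.exit j)
  have h2 := hK.flip₁ (p.exit i) (p.corner j)
  have h0 : M.monodromy θ (p.exit i) ≠ 0 := by
    intro h; have := hρ i; rw [h, mul_zero] at this; exact hρ0 _ this
  rw [← p.entry_succ] at h1 h2
  have h3 : ρ (j + 1) * K₂ (p.corner i) (p.entry (j + 1)) =
      ρ j * K₂ (p.corner i) (p.exit j) := by rw [hρ, h1]; ring
  have h4 : (ρ (i + 1))⁻¹ * K₁ (p.entry (i + 1)) (p.corner j) =
      (ρ i)⁻¹ * K₁ (p.exit i) (p.corner j) := by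
    rw [hρ, h2]; have := hρ0 i; field_simp
  have h5 : K₂ (p.corner i) (p.exit j) - K₂ (p.corner i) (p.entry j) =
      p.sign j * (K₁ (M.rot (p.corner i)) (p.corner j) -
        K₁ (M.rot (M.rot (p.corner i))) (p.corner j) +
        M.arcPairing (p.corner i) (p.corner j)) := by
    have := hK.square (p.corner i) (p.corner j)
    unfold exit entry sign
    split_ifs <;> push_cast <;> linarith
  have h6 : K₁ (p.exit i) (p.corner j) - K₁ (p.entry i) (p.corner j) =
      p.sign i * (K₁ (M.rot (p.corner i)) (p.corner j) -
        K₁ (M.rot (M.rot (p.corner i))) (p.corner j)) := by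
    unfold exit entry sign
    split_ifs <;> push_cast <;> ring
  linear_combination (ρ i)⁻¹ * p.sign i * h3 - ρ j * p.sign j * h4 +
    (ρ i)⁻¹ * ρ j * p.sign i * h5 - (ρ i)⁻¹ * ρ j * p.sign j * h6

/-- The diagonal of an arc times itself is homotopic to the second factor moving first and the first
factor afterwards; the square in between contributes nothing, because an arc has pairing 0 with
itself. -/
theorem propagator_diagonal (i : ℕ) :
    (ρ i)⁻¹ * ρ i * (p.sign i * K₁ (p.entry i) (p.corner i)) +
      (ρ i)⁻¹ * ρ (i + 1) * (p.sign i * K₂ (p.corner i) (p.entry (i + 1))) =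
    p.sign i * M.diagonalCochain K₁ K₂ (p.corner i) := by
  have h1 := hK.flip₂ (p.corner i) (p.exit i)
  rw [← p.entry_succ] at h1
  have h3 : (ρ i)⁻¹ * ρ (i + 1) * K₂ (p.corner i) (p.entry (i + 1)) =
      K₂ (p.corner i) (p.exit i) := by rw [hρ, h1]; have := hρ0 i; field_simp
  rw [inv_mul_cancel₀ (hρ0 i)]
  have h2 := hK.square (p.corner i) (p.corner i)
  rw [arcPairing_self] at h2
  have h4 : K₁ (p.entry i) (p.corner i) + K₂ (p.corner i) (p.exit i) =
      M.diagonalCochain K₁ K₂ (p.corner i) := by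
    unfold exit entry diagonalCochain
    split_ifs
    · rfl
    · linarith
  linear_combination (p.sign i : ℚ) * h3 + (p.sign i : ℚ) * h4

end Square

end NormalPath

/-- Stokes on the squares (i, j) with j ≤ i < d: the boundary consists of the staircase along the
diagonal, the right side i = d and the bottom j = 0. -/
theorem sum_triangle_stokes (X W D : ℕ → ℕ → ℚ)
    (h : ∀ i j, W i (j + 1) - W i j = X (i + 1) j - X i j + D i j) (d : ℕ) :
    ∑ i ∈ Finset.range d, (X i i + W i (i + 1)) =
      ∑ j ∈ Finset.range d, X d j + ∑ i ∈ Finset.range d, W i 0 +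
        ∑ i ∈ Finset.range d, ∑ j ∈ Finset.range (i + 1), D i j := by
  induction d with
  | zero => simp
  | succ d ih =>
    have h1 : W d (d + 1) = W d 0 +
        ∑ j ∈ Finset.range (d + 1), (X (d + 1) j - X d j + D d j) := by
      rw [← Finset.sum_congr rfl fun j _ => h d j, Finset.sum_range_sub]; ring
    rw [Finset.sum_range_succ, ih, Finset.sum_range_succ (fun i => W i 0),
      Finset.sum_range_succ (fun i => ∑ j ∈ Finset.range (i + 1), D i j), h1,
      Finset.sum_add_distrib, Finset.sum_sub_distrib,
      Finset.sum_range_succ (fun j => X d j)]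
    ring

theorem sum_range_shift_of_periodic {R : Type*} [AddCommGroup R] (g : ℕ → R) {L : ℕ}
    (h : g L = g 0) : ∑ i ∈ Finset.range L, g (i + 1) = ∑ i ∈ Finset.range L, g i := by
  have := Finset.sum_range_succ' g L
  rw [Finset.sum_range_succ, h] at this
  exact (add_right_cancel this).symm

/-- Stokes on the squares (i, j) with i < j ≤ i + L, modulo translation by (L, L). The boundary of
this annulus is the staircase along the diagonal and its translate by (0, L), which carries the
factor q. -/
theorem sum_strip_stokes (X W D : ℕ → ℕ → ℚ)
    (h : ∀ i j, W i (j + 1) - W i j = X (i + 1) j - X i j + D i j) {L : ℕ} {q : ℚ}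
    (hX : ∀ i j, X i (j + L) = q * X i j) (hW : ∀ i j, W i (j + L) = q * W i j)
    (hX' : ∀ i j, X (i + L) (j + L) = X i j) :
    (q - 1) * ∑ i ∈ Finset.range L, (X i i + W i (i + 1)) =
      ∑ i ∈ Finset.range L, ∑ m ∈ Finset.range L, D i (i + m + 1) := by
  have h1 : ∀ i, (q - 1) * W i (i + 1) = ∑ m ∈ Finset.range L,
      (X (i + 1) (i + m + 1) - X i (i + m + 1) + D i (i + m + 1)) := by
    intro i
    rw [← Finset.sum_congr rfl fun m _ => h i (i + m + 1),
      Finset.sum_congr rfl fun m _ =>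
        (by rw [add_assoc i m 1] : W i (i + m + 1 + 1) - W i (i + m + 1) =
          W i (i + (m + 1) + 1) - W i (i + m + 1)),
      Finset.sum_range_sub (fun m => W i (i + m + 1)), show i + L + 1 = i + 1 + L by ring, hW]
    simp only [add_zero]
    ring
  have h2 : ∀ i, ∑ m ∈ Finset.range L, X (i + 1) (i + m + 1) =
      ∑ m ∈ Finset.range L, X (i + 1) (i + 1 + m + 1) + (1 - q) * X (i + 1) (i + 1) := by
    intro i
    have h3 := Finset.sum_range_succ (fun m => X (i + 1) (i + m + 1)) L
    rw [Finset.sum_range_succ'] at h3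
    rw [show i + L + 1 = i + 1 + L by ring, hX] at h3
    have h4 : ∀ m, i + (m + 1) + 1 = i + 1 + m + 1 := fun m => by ring
    simp only [h4, add_zero] at h3
    linarith
  have h5 := sum_range_shift_of_periodic
    (fun i => ∑ m ∈ Finset.range L, X i (i + m + 1)) (L := L) (by
      refine Finset.sum_congr rfl fun m _ => ?_
      have := hX' 0 (0 + m + 1)
      rw [zero_add] at this
      rw [← this]; congr 1; ring)
  have h6 := sum_range_shift_of_periodic (fun i => X i i) (L := L) (by
      have := hX' 0 0
      simpa using this)
  rw [Finset.sum_add_distrib, mul_add, Finset.mul_sum (f := fun i => W i (i + 1)),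
    Finset.sum_congr rfl fun i _ => h1 i]
  simp only [Finset.sum_add_distrib, Finset.sum_sub_distrib, h2, ← Finset.mul_sum]
  rw [h5, h6]
  ring

section VertexSum

variable [Fintype C] [DecidableEq C] [DecidableEq V]

theorem iterate_link_vertex (c : C) (i : ℕ) : M.vertex (M.link^[i] c) = M.vertex c := by
  induction i with
  | zero => rfl
  | succ i ih => rw [Function.iterate_succ_apply', M.vertex_link', ih]

/-- The corners at a vertex form a single orbit of `link`. -/
theorem sum_vertex_eq_sum_range {R : Type*} [AddCommMonoid R] (g : C → R) (c₀ : C) :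
    ∑ c, (if M.vertex c = M.vertex c₀ then g c else 0) =
      ∑ i ∈ Finset.range (Function.minimalPeriod M.link c₀), g (M.link^[i] c₀) := by
  rw [← Finset.sum_filter]
  symm
  refine Finset.sum_bij (fun i _ => M.link^[i] c₀) ?_ ?_ ?_ ?_
  · intro i _
    simp [iterate_link_vertex]
  · intro i hi j hj h
    simp only [Finset.mem_range] at hi hj
    exact Function.iterate_injOn_Iio_minimalPeriod hi hj h
  · intro c hc
    simp only [Finset.mem_filter, Finset.mem_univ, true_and] at hc
    obtain ⟨n, hn⟩ := M.exists_link c₀ c hc.symm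
    have hpos : 0 < Function.minimalPeriod M.link c₀ :=
      Function.minimalPeriod_pos_of_mem_periodicPts
        (M.link.injective.mem_periodicPts c₀)
    refine ⟨n % Function.minimalPeriod M.link c₀, Finset.mem_range.2 (Nat.mod_lt _ hpos), ?_⟩
    rw [Function.iterate_mod_minimalPeriod_eq]
    exact hn
  · intro i _; rfl

variable (M) in
/-- The loop around a vertex. -/
def vertexLoop (c₀ : C) : M.NormalPath where
  corner i := M.link^[i] c₀
  ccw _ := true
  step i := by
    simp only [if_true]
    rw [Function.iterate_succ_apply', M.rot_rot_link]

/-- Stokes on a triangle, for the loop around the vertex. Its two straight sides are evaluated by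
the vertex conditions on `K₁` and `K₂` and contribute 1/2 each; what remains cancels. -/
theorem IsPropagator.diagonalCochain_vertex (hθ : M.IsLocalSystem θ) {K₁ K₂ : C → C → ℚ}
    (hK : M.IsPropagator θ K₁ K₂) (v : V) :
    ∑ c, (if M.vertex c = v then M.diagonalCochain K₁ K₂ c else 0) = 1 := by
  obtain ⟨c₀, rfl⟩ := M.vertex_surjective v
  set d := Function.minimalPeriod M.link c₀ with hd
  have hcd : M.link^[d] c₀ = c₀ := Function.iterate_minimalPeriod
  let p := M.vertexLoop c₀
  let k : ℕ → C := fun i => M.link^[i] c₀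
  have hk : ∀ i, k (i + 1) = M.link (k i) := fun i => Function.iterate_succ_apply' _ _ _
  -- Around a vertex the transport is `θ` itself, with trivial holonomy, so the strip argument would
  -- say nothing here.
  have hρ : ∀ i, θ (k (i + 1)) = θ (k i) * M.monodromy θ (p.exit i) := by
    intro i
    have := hθ.mul_monodromy (M.rot (k i))
    rw [M.rot_rot_rot] at this
    rw [hk]; exact this.symm
  have hsq := p.propagator_square hK (fun i => hθ.ne_zero (k i)) hρ
  have hdiag := p.propagator_diagonal hK (fun i => hθ.ne_zero (k i)) hρ
  have hsign : ∀ i, p.sign i = 1 := fun i => rfl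
  have hcorner : ∀ i, p.corner i = k i := fun i => rfl
  have hentry : ∀ i, p.entry i = M.rot (M.rot (k i)) := fun i => rfl
  simp only [hsign, hcorner, hentry, Int.cast_one, one_mul] at hsq hdiag
  have hst := sum_triangle_stokes
    (fun i j => (θ (k i))⁻¹ * θ (k j) * K₁ (M.rot (M.rot (k i))) (k j))
    (fun i j => (θ (k i))⁻¹ * θ (k j) * K₂ (k i) (M.rot (M.rot (k j)))) _ hsq d
  simp only [hdiag] at hst
  rw [show k d = c₀ from hcd] at hst
  rw [sum_vertex_eq_sum_range, ← hd]
  have hX : ∑ j ∈ Finset.range d, (θ c₀)⁻¹ * θ (k j) * K₁ (M.rot (M.rot c₀)) (k j) =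
      1 / 2 + (if M.vertex (M.rot c₀) = M.vertex c₀ then (θ c₀)⁻¹ * θ (M.rot c₀) / 2 else 0) := by
    have h1 := hK.vertex₁ (M.rot (M.rot c₀)) (M.vertex c₀)
    rw [sum_vertex_eq_sum_range, ← hd] at h1
    have h2 := congrArg ((θ c₀)⁻¹ * ·) h1
    simp only [Finset.mul_sum, ← mul_assoc] at h2
    rw [h2]
    unfold endpointWeight
    simp only [M.rot_rot_rot, if_true]
    have := hθ.ne_zero c₀
    split_ifs <;> field_simp
    ring
  have hW : ∑ i ∈ Finset.range d, (θ (k i))⁻¹ * θ (k 0) * K₂ (k i) (M.rot (M.rot (k 0))) =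
      1 / 2 + (if M.vertex (M.rot c₀) = M.vertex c₀ then θ c₀ * (θ (M.rot c₀))⁻¹ / 2 else 0) := by
    have h1 := hK.vertex₂ (M.vertex c₀) (M.rot (M.rot c₀))
    rw [sum_vertex_eq_sum_range, ← hd] at h1
    have h2 := congrArg (θ c₀ * ·) h1
    simp only [Finset.mul_sum] at h2
    refine Eq.trans (Finset.sum_congr rfl fun i _ => ?_) (h2.trans ?_)
    · show _ * θ c₀ * K₂ _ (M.rot (M.rot c₀)) = _
      ring
    · unfold endpointWeight
      simp only [M.rot_rot_rot, if_true, Pi.inv_apply]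
      have := hθ.ne_zero c₀
      split_ifs <;> field_simp
      ring
  -- The two parts of the arc pairing. They can be nonzero only if some triangle has several corners
  -- at the vertex.
  let α : ℕ → ℕ → ℚ := fun i j => if k j = M.rot (k i) then (θ (k i))⁻¹ * θ (k j) else 0
  let β : ℕ → ℕ → ℚ := fun i j => if k j = M.rot (M.rot (k i)) then (θ (k i))⁻¹ * θ (k j) else 0
  -- Both sides detect that the side crossed between the corners i and i + 1 is the flipped version
  -- of the one crossed between j and j + 1.
  have hαβ : ∀ i j, α (i + 1) j = β i (j + 1) := by
    intro i j
    have hiff : k j = M.rot (k (i + 1)) ↔ k (j + 1) = M.rot (M.rot (k i)) := by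
      rw [hk, hk, M.link_apply, M.link_apply]
      constructor
      · intro h; rw [h, M.rot_rot_rot, M.flip_flip]
      · intro h
        have h1 := M.flip.injective (M.rot.injective (h.trans
          (by rw [M.flip_flip] :
            M.rot (M.rot (k i)) = M.rot (M.flip (M.flip (M.rot (k i)))))))
        apply M.rot.injective
        rw [h1, M.rot_rot_rot]
    simp only [α, β]
    by_cases h : k j = M.rot (k (i + 1))
    · rw [if_pos h, if_pos (hiff.1 h), hiff.1 h, h, hk, M.link_apply]
      have h1 := hθ.flat (M.rot (k i))
      rw [M.rot_rot_rot] at h1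
      have := hθ.ne_zero
      field_simp
      rw [div_eq_div_iff (this _) (this _)]
      linarith
    · rw [if_neg h, if_neg fun h' => h (hiff.2 h')]
  have hα0 : ∀ i, α i i = 0 := fun i => if_neg (M.rot_ne _).symm
  have hα1 : ∀ i, α (i + 1) i = 0 := by
    intro i
    refine if_neg fun h => ?_
    rw [hk, M.link_apply] at h
    have h1 := congrArg M.rot h
    rw [M.rot_rot_rot] at h1
    exact M.flip_ne _ h1.symm
  have hD : ∀ i j, (θ (k i))⁻¹ * θ (k j) * M.arcPairing (k i) (k j) =
      (α i j - β i j) / 2 := by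
    intro i j
    simp only [α, β]
    unfold arcPairing
    split_ifs <;> ring
  -- By the shift relation the double sum telescopes to boundary terms, which cancel the
  -- contributions to `hX` and `hW` of a side with both endpoints at the vertex.
  have hDsum : ∑ i ∈ Finset.range d, ∑ j ∈ Finset.range (i + 1), (α i j - β i j) =
      -(∑ j ∈ Finset.range d, α d j) - ∑ i ∈ Finset.range d, β i 0 := by
    have h1 : ∀ i, ∑ j ∈ Finset.range (i + 1), (α i j - β i j) =
        -(∑ j ∈ Finset.range (i + 1), α (i + 1) j - ∑ j ∈ Finset.range i, α i j) - β i 0 := by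
      intro i
      rw [Finset.sum_sub_distrib, Finset.sum_range_succ' (fun j => β i j)]
      simp only [← hαβ]
      rw [Finset.sum_range_succ (fun j => α i j), Finset.sum_range_succ (fun j => α (i + 1) j),
        hα0, hα1]
      ring
    rw [Finset.sum_congr rfl fun i _ => h1 i, Finset.sum_sub_distrib, Finset.sum_neg_distrib,
      Finset.sum_range_sub (fun i => ∑ j ∈ Finset.range i, α i j)]
    simp
  have hαsum : ∑ j ∈ Finset.range d, α d j =
      if M.vertex (M.rot c₀) = M.vertex c₀ then (θ c₀)⁻¹ * θ (M.rot c₀) else 0 := by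
    have h1 := sum_vertex_eq_sum_range (M := M)
      (fun c => if c = M.rot c₀ then (θ c₀)⁻¹ * θ c else 0) c₀
    simp only [α, show k d = c₀ from hcd]
    rw [← hd] at h1
    refine h1.symm.trans ?_
    rw [Finset.sum_eq_single (M.rot c₀)]
    · simp
    · intro b _ hb; simp [hb]
    · simp
  have hβsum : ∑ i ∈ Finset.range d, β i 0 =
      if M.vertex (M.rot c₀) = M.vertex c₀ then θ c₀ * (θ (M.rot c₀))⁻¹ else 0 := by
    have h1 := sum_vertex_eq_sum_range (M := M)
      (fun c => if c₀ = M.rot (M.rot c) then (θ c)⁻¹ * θ c₀ else 0) c₀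
    rw [← hd] at h1
    refine h1.symm.trans ?_
    rw [Finset.sum_eq_single (M.rot c₀)]
    · simp [M.rot_rot_rot, mul_comm]
    · intro b _ hb
      rw [if_neg (c := c₀ = M.rot (M.rot b)), ite_self]
      rintro rfl
      exact hb (M.rot_rot_rot b).symm
    · simp
  simp only [hD, ← Finset.sum_div] at hst
  rw [hX, hW, hDsum, hαsum, hβsum] at hst
  refine hst.trans ?_
  split_ifs <;> ring

end VertexSum

end TriangulatedSurface

/-! ### Simple loops and the propagator on the diagonal. -/

namespace TriangulatedSurface

variable {C V F : Type*} {M : TriangulatedSurface C V F} {θ : C → ℚ}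

variable (M) in
/-- A simple closed curve in normal position. The `i`-th arc cuts off the corner `corner i` and joins the
points of the adjacent sides at distance `distPrev i` and `distNext i` from this corner. -/
structure SimpleLoop extends M.NormalPath where
  length : ℕ
  corner_add : ∀ i, corner (i + length) = corner i
  ccw_add : ∀ i, ccw (i + length) = ccw i
  distPrev : ℕ → ℝ
  distNext : ℕ → ℝ
  distPrev_add : ∀ i, distPrev (i + length) = distPrev i
  distNext_add : ∀ i, distNext (i + length) = distNext i
  distPrev_mem : ∀ i, distPrev i ∈ Set.Ioo (0 : ℝ) 1
  distNext_mem : ∀ i, distNext i ∈ Set.Ioo (0 : ℝ) 1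
  pos_step : ∀ i, (if ccw (i + 1) then distPrev (i + 1) else 1 - distNext (i + 1)) =
    1 - (if ccw i then 1 - distNext i else distPrev i)
  nested : ∀ i j, i % length ≠ j % length → corner i = corner j →
    (distPrev i < distPrev j ∧ distNext i < distNext j) ∨
      (distPrev j < distPrev i ∧ distNext j < distNext i)
  noncrossing : ∀ i j, i % length ≠ j % length → corner j = M.rot (corner i) →
    distPrev i + distNext j < 1

/-- The sign of a real number, as a rational number. -/
def ratSign (x : ℝ) : ℚ := if 0 < x then 1 else if x < 0 then -1 else 0

theorem ratSign_pos {x : ℝ} (h : 0 < x) : ratSign x = 1 := if_pos h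

theorem ratSign_neg {x : ℝ} (h : x < 0) : ratSign x = -1 := by
  rw [ratSign, if_neg h.not_gt, if_pos h]

theorem ratSign_zero : ratSign 0 = 0 := by simp [ratSign]

namespace SimpleLoop

variable (γ : M.SimpleLoop)

/-- The position at which an arc enters, on the side directed counterclockwise around the triangle. -/
def entryPos (i : ℕ) : ℝ := if γ.ccw i then γ.distPrev i else 1 - γ.distNext i

/-- The position at which an arc leaves, on the side directed counterclockwise around the triangle. -/
def exitPos (i : ℕ) : ℝ := if γ.ccw i then 1 - γ.distNext i else γ.distPrev i

theorem entryPos_succ (i : ℕ) : γ.entryPos (i + 1) = 1 - γ.exitPos i := γ.pos_step i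

theorem entry_add (i : ℕ) : γ.entry (i + γ.length) = γ.entry i := by
  simp only [NormalPath.entry, γ.corner_add, γ.ccw_add]

theorem exit_add (i : ℕ) : γ.exit (i + γ.length) = γ.exit i := by
  simp only [NormalPath.exit, γ.corner_add, γ.ccw_add]

theorem sign_add (i : ℕ) : γ.sign (i + γ.length) = γ.sign i := by
  simp only [NormalPath.sign, γ.ccw_add]

theorem entryPos_add (i : ℕ) : γ.entryPos (i + γ.length) = γ.entryPos i := by
  simp only [entryPos, γ.distPrev_add, γ.distNext_add, γ.ccw_add]

theorem exitPos_add (i : ℕ) : γ.exitPos (i + γ.length) = γ.exitPos i := by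
  simp only [exitPos, γ.distPrev_add, γ.distNext_add, γ.ccw_add]

/-- The holonomy of a local system along the loop. -/
def holonomy (θ : C → ℚ) : ℚ := γ.transport θ γ.length

theorem transport_add (i : ℕ) :
    γ.transport θ (i + γ.length) = γ.holonomy θ * γ.transport θ i := by
  induction i with
  | zero => simp [holonomy, NormalPath.transport]
  | succ i ih =>
    rw [show i + 1 + γ.length = i + γ.length + 1 by ring, NormalPath.transport, ih,
      NormalPath.transport, γ.exit_add, mul_assoc]

variable [Fintype C] [DecidableEq C]

/-- Disjoint arcs do not intersect, so their pairing only records the order of their endpoints: half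
a sign for each side on which both have an endpoint. In this form the pairings cancel between the
two triangles at a side. -/
theorem arcPairing_eq {i j : ℕ} (hij : i % γ.length ≠ j % γ.length) :
    γ.sign i * γ.sign j * M.arcPairing (γ.corner i) (γ.corner j) =
      ((if γ.entry j = γ.entry i then ratSign (γ.entryPos i - γ.entryPos j) else 0) +
        (if γ.entry j = γ.exit i then ratSign (γ.entryPos j - γ.exitPos i) else 0) -
        (if γ.exit j = γ.entry i then ratSign (γ.entryPos i - γ.exitPos j) else 0) -
        (if γ.exit j = γ.exit i then ratSign (γ.exitPos j - γ.exitPos i) else 0)) / 2 := by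
  have r3 := M.rot_rot_rot
  have r1 := M.rot_ne
  have r1' := fun c => (M.rot_ne c).symm
  have r2 := M.rot_rot_ne
  have r2' := fun c => (M.rot_rot_ne c).symm
  by_cases h0 : γ.corner j = γ.corner i
  · have hn := γ.nested i j hij h0.symm
    unfold arcPairing
    simp only [NormalPath.entry, NormalPath.exit, NormalPath.sign, entryPos, exitPos, h0]
    rcases hn with ⟨ha, hb⟩ | ⟨ha, hb⟩
    · have e1 : ratSign (γ.distPrev i - γ.distPrev j) = -1 := ratSign_neg (by linarith)
      have e2 : ratSign (γ.distPrev j - γ.distPrev i) = 1 := ratSign_pos (by linarith)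
      have e3 : ratSign (γ.distNext j - γ.distNext i) = 1 := ratSign_pos (by linarith)
      have e4 : ratSign (γ.distNext i - γ.distNext j) = -1 := ratSign_neg (by linarith)
      cases γ.ccw i <;> cases γ.ccw j <;>
        simp [r1, r1', r2', e1, e2, e3, e4]
    · have e1 : ratSign (γ.distPrev i - γ.distPrev j) = 1 := ratSign_pos (by linarith)
      have e2 : ratSign (γ.distPrev j - γ.distPrev i) = -1 := ratSign_neg (by linarith)
      have e3 : ratSign (γ.distNext j - γ.distNext i) = -1 := ratSign_neg (by linarith)
      have e4 : ratSign (γ.distNext i - γ.distNext j) = 1 := ratSign_pos (by linarith)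
      cases γ.ccw i <;> cases γ.ccw j <;>
        simp [r1, r1', r2', e1, e2, e3, e4]
  · by_cases h1 : γ.corner j = M.rot (γ.corner i)
    · have hn := γ.noncrossing i j hij h1
      unfold arcPairing
      simp only [NormalPath.entry, NormalPath.exit, NormalPath.sign, entryPos, exitPos, h1, r3]
      have e1 : ratSign (γ.distPrev i - (1 - γ.distNext j)) = -1 := ratSign_neg (by linarith)
      have e2 : ratSign (1 - γ.distNext j - γ.distPrev i) = 1 := ratSign_pos (by linarith)
      cases γ.ccw i <;> cases γ.ccw j <;>
        simp [r1, r1', r2', e1, e2] <;> norm_num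
    · by_cases h2 : γ.corner i = M.rot (γ.corner j)
      · have hn := γ.noncrossing j i hij.symm h2
        unfold arcPairing
        simp only [NormalPath.entry, NormalPath.exit, NormalPath.sign, entryPos, exitPos, h2, r3]
        have e1 : ratSign (γ.distPrev j - (1 - γ.distNext i)) = -1 := ratSign_neg (by linarith)
        have e2 : ratSign (1 - γ.distNext i - γ.distPrev j) = 1 := ratSign_pos (by linarith)
        cases γ.ccw i <;> cases γ.ccw j <;>
          simp [r1, r1', r2, r2', e1, e2] <;> norm_num
      · have h3 : γ.corner j ≠ M.rot (M.rot (γ.corner i)) := fun h => h2 (by rw [h, r3])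
        have h4 : M.rot (γ.corner j) ≠ γ.corner i := fun h => h2 h.symm
        unfold arcPairing
        simp only [NormalPath.entry, NormalPath.exit, NormalPath.sign, entryPos, exitPos]
        rcases Bool.eq_false_or_eq_true (γ.ccw i) with hi | hi <;>
          rcases Bool.eq_false_or_eq_true (γ.ccw j) with hj | hj <;>
          simp [hi, hj, h0, h1, h3, h4]

/-- Stokes on the strip gives (q - 1) times the sum as the total self-pairing of the loop; the
latter vanishes because the loop is simple, and q ≠ 1. -/
theorem diagonalCochain_sum [DecidableEq V] (hθ : M.IsLocalSystem θ) {K₁ K₂ : C → C → ℚ}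
    (hK : M.IsPropagator θ K₁ K₂) (hγ : γ.holonomy θ ≠ 1) :
    ∑ i ∈ Finset.range γ.length, γ.sign i * M.diagonalCochain K₁ K₂ (γ.corner i) = 0 := by
  set L := γ.length with hL
  set q := γ.holonomy θ with hq
  let ρ := γ.transport θ
  have hρ0 : ∀ i, ρ i ≠ 0 := γ.transport_ne_zero hθ
  have hρ : ∀ i, ρ (i + 1) = ρ i * M.monodromy θ (γ.exit i) := fun i => rfl
  have hρL : ∀ i, ρ (i + L) = q * ρ i := γ.transport_add
  have hq0 : q ≠ 0 := hρ0 L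
  have hρρ : ∀ i j, (ρ (i + L))⁻¹ * ρ (j + L) = (ρ i)⁻¹ * ρ j := by
    intro i j
    rw [hρL, hρL]; field_simp
  let D : ℕ → ℕ → ℚ := fun i j => (ρ i)⁻¹ * ρ j *
    (γ.sign i * γ.sign j * M.arcPairing (γ.corner i) (γ.corner j))
  have hst := sum_strip_stokes
    (fun i j => (ρ i)⁻¹ * ρ j * (γ.sign j * K₁ (γ.entry i) (γ.corner j)))
    (fun i j => (ρ i)⁻¹ * ρ j * (γ.sign i * K₂ (γ.corner i) (γ.entry j))) D
    (γ.propagator_square hK hρ0 hρ) (L := L) (q := q)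
    (fun i j => by simp only [hρL]; rw [γ.sign_add, γ.corner_add]; ring)
    (fun i j => by simp only [hρL]; rw [γ.entry_add]; ring)
    (fun i j => by simp only [hρρ]; rw [γ.sign_add, γ.corner_add, γ.entry_add])
  simp only [γ.propagator_diagonal hK hρ0 hρ] at hst
  suffices h : ∑ i ∈ Finset.range L, ∑ m ∈ Finset.range L, D i (i + m + 1) = 0 by
    rw [h] at hst
    exact (mul_eq_zero.1 hst).resolve_left (sub_ne_zero.2 hγ)
  -- The endpoint terms for two strands entering through the same side, and below for the mixed
  -- cases. Seen across a side, exit/exit becomes entry/entry (`hU`), and the two mixed cases are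
  -- interchanged (`hZ`).
  let U : ℕ → ℕ → ℚ := fun i j =>
    if γ.entry j = γ.entry i then (ρ i)⁻¹ * ρ j * ratSign (γ.entryPos i - γ.entryPos j) else 0
  let W : ℕ → ℕ → ℚ := fun i j =>
    if γ.entry j = γ.exit i then (ρ i)⁻¹ * ρ j * ratSign (γ.entryPos j - γ.exitPos i) else 0
  let Z : ℕ → ℕ → ℚ := fun i j =>
    if γ.exit j = γ.entry i then (ρ i)⁻¹ * ρ j * ratSign (γ.entryPos i - γ.exitPos j) else 0
  have hU : ∀ i j, U (i + 1) (j + 1) = if γ.exit j = γ.exit i then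
      (ρ i)⁻¹ * ρ j * ratSign (γ.exitPos j - γ.exitPos i) else 0 := by
    intro i j
    have h1 := hθ.monodromy_ne_zero (γ.exit i)
    simp only [U, γ.entry_succ, γ.entryPos_succ, M.flip.injective.eq_iff]
    by_cases h : γ.exit j = γ.exit i
    · rw [if_pos h, if_pos h, hρ, hρ, h]
      have := hρ0 i
      rw [show 1 - γ.exitPos i - (1 - γ.exitPos j) = γ.exitPos j - γ.exitPos i by ring]
      field_simp
    · rw [if_neg h, if_neg h]
  have hZ : ∀ i j, Z (i + 1) j = W i (j + 1) := by
    intro i j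
    have h1 := hθ.monodromy_ne_zero (γ.exit i)
    simp only [Z, W, γ.entry_succ, γ.entryPos_succ]
    by_cases h : γ.exit j = M.flip (γ.exit i)
    · have h' : M.flip (γ.exit j) = γ.exit i := by rw [h, M.flip_flip]
      rw [if_pos h, if_pos h', hρ, hρ, h, hθ.monodromy_flip]
      rw [show 1 - γ.exitPos i - γ.exitPos j = 1 - γ.exitPos j - γ.exitPos i by ring]
      rw [mul_inv]
      ring
    · have h' : M.flip (γ.exit j) ≠ γ.exit i := fun h' => h (by rw [← h', M.flip_flip])
      rw [if_neg h, if_neg h']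
  have hD : ∀ i, ∀ m ∈ Finset.range L, D i (i + m + 1) =
      (U i (i + m + 1) + W i (i + m + 1) - Z i (i + m + 1) -
        U (i + 1) (i + 1 + m + 1)) / 2 := by
    intro i m hm
    have hm := Finset.mem_range.1 hm
    rw [show i + 1 + m + 1 = i + m + 1 + 1 by ring, hU]
    -- For j = i + L the two arcs coincide and both sides of the claim vanish.
    by_cases hmL : m + 1 = L
    · rw [add_assoc, hmL]
      simp only [D, U, W, Z, hL, γ.entry_add, γ.exit_add, γ.entryPos_add, γ.exitPos_add,
        γ.corner_add, sub_self, ratSign_zero, arcPairing_self, mul_zero, ite_self]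
      rw [if_neg (γ.entry_ne_exit i), if_neg (γ.entry_ne_exit i).symm]
      ring
    · have hij : i % γ.length ≠ (i + m + 1) % γ.length := by
        intro h
        have h1 : (i + m + 1 - i) % L = 0 := Nat.sub_mod_eq_zero_of_mod_eq h.symm
        rw [show i + m + 1 - i = m + 1 by omega, Nat.mod_eq_of_lt (by omega)] at h1
        omega
      simp only [D, U, W, Z]
      rw [γ.arcPairing_eq hij]
      split_ifs <;> ring
  have hper : ∀ (G : ℕ → ℕ → ℚ), (∀ m, G L (L + m + 1) = G 0 (0 + m + 1)) →
      ∀ s, ∑ i ∈ Finset.range L, ∑ m ∈ Finset.range s, G (i + 1) (i + 1 + m + 1) =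
      ∑ i ∈ Finset.range L, ∑ m ∈ Finset.range s, G i (i + m + 1) := fun G hG s =>
    sum_range_shift_of_periodic (fun i => ∑ m ∈ Finset.range s, G i (i + m + 1))
      (Finset.sum_congr rfl fun m _ => hG m)
  have hUper := hper U (fun m => by
    have h := hρρ 0 (0 + m + 1)
    have e : L + m + 1 = 0 + m + 1 + L := by ring
    have h1 := γ.entry_add 0
    have h2 := γ.entryPos_add 0
    simp only [U, e]
    simp only [zero_add] at h h1 h2 ⊢
    simp only [hL, γ.entry_add, γ.entryPos_add, h1, h2] at h ⊢
    rw [h]) L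
  have hZper := hper Z (fun m => by
    have h := hρρ 0 (0 + m + 1)
    have e : L + m + 1 = 0 + m + 1 + L := by ring
    have h1 := γ.entry_add 0
    have h2 := γ.entryPos_add 0
    simp only [Z, e]
    simp only [zero_add] at h h1 h2 ⊢
    simp only [hL, γ.exit_add, γ.exitPos_add, h1, h2] at h ⊢
    rw [h]) L
  -- The shift in `hZ` moves the window of summation by two indices. The two terms dropped here
  -- vanish, and so do the two gained, which are their translates by a period.
  have hW1 : ∀ i, W i (i + 1) = 0 := fun i => if_neg (by
    rw [γ.entry_succ]; exact M.flip_ne _)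
  have hW2 : ∀ i, W i (i + 2) = 0 := fun i => if_neg (by
    rw [show i + 2 = i + 1 + 1 by ring, γ.entry_succ]
    intro h
    refine γ.entry_ne_exit (i + 1) ?_
    rw [γ.entry_succ, ← h, M.flip_flip])
  have hWL : ∀ i j, W i (j + L) = q * W i j := by
    intro i j
    simp only [W, hρL]
    rw [γ.entry_add, γ.entryPos_add]
    split_ifs <;> ring
  have hWsum : ∀ i, ∑ m ∈ Finset.range L, W i (i + m + 1) =
      ∑ m ∈ Finset.range L, Z (i + 1) (i + 1 + m + 1) := by
    intro i
    have h1 : ∑ m ∈ Finset.range L, W i (i + m + 1) + W i (i + L + 1) + W i (i + (L + 1) + 1) =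
        ∑ m ∈ Finset.range L, W i (i + (m + 1 + 1) + 1) + W i (i + (0 + 1) + 1) +
          W i (i + 0 + 1) := by
      rw [← Finset.sum_range_succ (fun m => W i (i + m + 1)),
        ← Finset.sum_range_succ (fun m => W i (i + m + 1)),
        ← Finset.sum_range_succ' (fun m => W i (i + (m + 1) + 1)),
        ← Finset.sum_range_succ' (fun m => W i (i + m + 1))]
    rw [show i + L + 1 = i + 1 + L by ring, show i + (L + 1) + 1 = i + 2 + L by ring, hWL, hWL,
      show i + 0 + 1 = i + 1 by ring, show i + (0 + 1) + 1 = i + 2 by ring, hW1, hW2] at h1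
    simp only [hZ]
    have h4 : ∀ m, i + (m + 1 + 1) + 1 = i + 1 + m + 1 + 1 := fun m => by ring
    simp only [h4] at h1
    linarith
  rw [Finset.sum_congr rfl fun i _ => Finset.sum_congr rfl (hD i)]
  simp only [← Finset.sum_div, Finset.sum_sub_distrib, Finset.sum_add_distrib, hWsum]
  rw [hUper, hZper]
  ring

end SimpleLoop

end TriangulatedSurface

/-! ### Normal chains, homology and duality. -/

namespace TriangulatedSurface

variable {C V F : Type*} {M : TriangulatedSurface C V F} {θ : C → ℚ}

variable (M) in
/-- The flux of a closed normal chain through the two directed versions of a side is opposite. -/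
def IsBalanced (m : C → ℤ) : Prop :=
  ∀ h, m (M.rot (M.flip h)) - m (M.rot (M.rot (M.flip h))) =
    -(m (M.rot h) - m (M.rot (M.rot h)))

variable (M) in
/-- A normal chain is, up to multiples of the triangles, a combination of vertices. -/
def IsNullHomologous (m : C → ℤ) : Prop :=
  ∃ B : V → ℤ, ∀ c, m (M.rot c) - m c = B (M.vertex (M.rot c)) - B (M.vertex c)

theorem exists_vertex_function {R : Type*} (g : C → R) (hg : ∀ c, g (M.link c) = g c) :
    ∃ B : V → R, ∀ c, g c = B (M.vertex c) := by
  have h1 : ∀ n c, g (M.link^[n] c) = g c := by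
    intro n c
    induction n with
    | zero => rfl
    | succ n ih => rw [Function.iterate_succ_apply', hg, ih]
  choose s hs using M.vertex_surjective
  refine ⟨fun v => g (s v), fun c => ?_⟩
  obtain ⟨n, hn⟩ := M.exists_link c (s (M.vertex c)) (hs _).symm
  exact ((h1 n c).symm.trans (congrArg g hn))

theorem eq_of_rot_of_flip {R : Type*} {A : C → R} (h1 : ∀ c, A (M.rot c) = A c)
    (h2 : ∀ c, A (M.flip c) = A c) (c d : C) : A d = A c :=
  M.connected (fun x => A x = A c) (fun x hx => (h1 x).trans hx) (fun x hx => (h2 x).trans hx)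
    c d rfl

/-- If the coboundaries of m and φ agree, then m is, up to functions of the triangles, a function B
of the vertices, and φ is minus the sum of B over the endpoints of a side, up to a constant. -/
theorem IsBalanced.isNullHomologous {m : C → ℤ} (hm : M.IsBalanced m) {φ : C → ℚ}
    (hφ : ∀ h, φ (M.flip h) = φ h)
    (h : ∀ c, (m (M.rot c) : ℚ) - m (M.rot (M.rot c)) = φ (M.rot c) - φ (M.rot (M.rot c))) :
    M.IsNullHomologous m := by
  have hm' : ∀ h, (m (M.rot (M.flip h)) : ℚ) - m (M.rot (M.rot (M.flip h))) =
      -(m (M.rot h) - m (M.rot (M.rot h))) := fun h => by exact_mod_cast hm h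
  obtain ⟨B, hB⟩ := exists_vertex_function (M := M)
    -- The half-sum of B(c) + B(rot c) and B(c) - B(rot c), expressed by φ and m.
    (fun c => (-φ (M.rot (M.rot c)) + m c - m (M.rot c)) / 2) (fun c => by
      have h1 := hm' (M.rot c)
      have h2 := h c
      have h3 := hφ (M.rot c)
      simp only [M.rot_rot_link]
      rw [M.link_apply, h3]
      rw [M.rot_rot_rot] at h1
      linarith)
  have hB' : ∀ c, (m (M.rot c) : ℚ) - m c = B (M.vertex (M.rot c)) - B (M.vertex c) := by
    intro c
    rw [← hB, ← hB]
    have h1 := h (M.rot c)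
    simp only [M.rot_rot_rot] at h1 ⊢
    linarith
  -- The values of B at the corners of a triangle differ by integers, so taking floors preserves the
  -- differences.
  refine ⟨fun v => ⌊B v⌋, fun c => ?_⟩
  have h1 : B (M.vertex (M.rot c)) = B (M.vertex c) + ((m (M.rot c) - m c : ℤ) : ℚ) := by
    push_cast; linarith [hB' c]
  simp only
  rw [h1, Int.floor_add_intCast]; ring

variable [Fintype C] [DecidableEq C]

/-- Summation by parts: the pairing of arcs is skew. -/
theorem sum_mul_coboundary {R : Type*} [CommRing R] (x y : C → R) :
    ∑ c, x c * (y (M.rot c) - y (M.rot (M.rot c))) =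
      -∑ c, (x (M.rot c) - x (M.rot (M.rot c))) * y c := by
  have h1 := M.sum_rot (fun c => x (M.rot (M.rot c)) * y c)
  have h2 := M.sum_rot (fun c => x (M.rot c) * y c)
  have h3 := M.sum_rot (fun c => x (M.rot (M.rot c)) * y (M.rot c))
  have h4 := M.sum_rot (fun c => x c * y (M.rot (M.rot c)))
  simp only [M.rot_rot_rot] at h1 h2 h3 h4
  have h5 := M.sum_rot (fun c => x (M.rot c) * y (M.rot (M.rot (M.rot c))))
  simp only [M.rot_rot_rot] at h5
  simp only [mul_sub, sub_mul, Finset.sum_sub_distrib]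
  rw [h1, ← h4]
  ring

theorem sum_mul_eq_zero_of_balanced {R : Type*} [Field R] [CharZero R] (x y : C → R)
    (hx : ∀ h, x (M.flip h) = - x h) (hy : ∀ h, y (M.flip h) = y h) : ∑ c, x c * y c = 0 := by
  have h1 := M.sum_flip (fun c => x c * y c)
  simp only [hx, hy, neg_mul, Finset.sum_neg_distrib] at h1
  exact self_eq_neg.1 h1.symm

/-- Nondegeneracy of the intersection form: a linear functional that vanishes on coboundaries but
not on the dual of m is itself given by a balanced chain, up to denominators. -/
theorem IsBalanced.exists_pairing_ne_zero {m : C → ℤ} (hm : M.IsBalanced m)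
    (h : ¬ M.IsNullHomologous m) :
    ∃ ϑ : C → ℤ, M.IsBalanced ϑ ∧
      ∑ c, m c * (ϑ (M.rot c) - ϑ (M.rot (M.rot c))) ≠ 0 := by
  let S : Submodule ℚ (C → ℚ) :=
    { carrier := {x | ∃ φ : C → ℚ, (∀ h, φ (M.flip h) = φ h) ∧ M.sideCoboundary φ = x}
      add_mem' := by
        rintro _ _ ⟨φ, hφ, rfl⟩ ⟨ψ, hψ, rfl⟩
        exact ⟨φ + ψ, fun h => by simp [hφ, hψ], map_add _ _ _⟩
      zero_mem' := ⟨0, fun h => rfl, map_zero _⟩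
      smul_mem' := by
        rintro q _ ⟨φ, hφ, rfl⟩
        exact ⟨q • φ, fun h => by simp [hφ], map_smul _ _ _⟩ }
  have hS : M.sideCoboundary (fun c => (m c : ℚ)) ∉ S := by
    rintro ⟨φ, hφ, hφ'⟩
    exact h (hm.isNullHomologous hφ fun c => (congrFun hφ' c).symm)
  obtain ⟨f, hf, hfS⟩ := Submodule.exists_le_ker_of_notMem hS
  let y : C → ℚ := fun c => f fun j => if c = j then 1 else 0
  have hfy : ∀ x, f x = ∑ c, x c * y c := fun x => by
    rw [LinearMap.pi_apply_eq_sum_univ]; rfl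
  obtain ⟨b, hb⟩ := IsLocalization.exist_integer_multiples_of_finite (nonZeroDivisors ℤ) y
  choose ϑ hϑ using hb
  have hb0 : ((b : ℤ) : ℚ) ≠ 0 := by exact_mod_cast nonZeroDivisors.coe_ne_zero b
  have hϑ' : ∀ c, (ϑ c : ℚ) = (b : ℤ) * y c := fun c => by
    have := hϑ c
    simpa [Algebra.smul_def] using this
  have hy : ∀ h, y (M.rot (M.flip h)) - y (M.rot (M.rot (M.flip h))) =
      -(y (M.rot h) - y (M.rot (M.rot h))) := by
    intro h
    -- Vanishing on the coboundary of the indicator of an undirected side is exactly the balance at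
    -- this side.
    let φ : C → ℚ := fun c => (if c = h then 1 else 0) + (if c = M.flip h then 1 else 0)
    have hφ : M.sideCoboundary φ ∈ S := ⟨φ, fun c => by
      have h1 : M.flip c = h ↔ c = M.flip h := by
        constructor
        · rintro rfl; rw [M.flip_flip]
        · rintro rfl; rw [M.flip_flip]
      simp only [φ, h1, M.flip.injective.eq_iff]; ring, rfl⟩
    have h1 := hfS hφ
    rw [LinearMap.mem_ker, hfy] at h1
    simp only [sideCoboundary_apply] at h1
    rw [← neg_eq_zero, ← sum_mul_coboundary] at h1
    simp only [φ, add_mul, Finset.sum_add_distrib, ite_mul, one_mul, zero_mul,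
      Finset.sum_ite_eq', Finset.mem_univ, if_true] at h1
    linarith
  refine ⟨ϑ, fun h => ?_, fun h0 => hf ?_⟩
  · have : ((ϑ (M.rot (M.flip h)) : ℚ) - ϑ (M.rot (M.rot (M.flip h))) =
      -(ϑ (M.rot h) - ϑ (M.rot (M.rot h)))) := by
      simp only [hϑ']
      linear_combination ((b : ℤ) : ℚ) * hy h
    exact_mod_cast this
  · have h1 : ∑ c, (m c : ℚ) * ((ϑ (M.rot c) : ℚ) - ϑ (M.rot (M.rot c))) = 0 := by
      exact_mod_cast h0
    rw [sum_mul_coboundary (M := M) (fun c => (m c : ℚ)) (fun c => (ϑ c : ℚ))] at h1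
    rw [hfy]
    simp only [hϑ', sideCoboundary_apply] at h1 ⊢
    have h2 : ∀ c, ((m (M.rot c) : ℚ) - m (M.rot (M.rot c))) * ((b : ℤ) * y c) =
        (b : ℤ) * (((m (M.rot c) : ℚ) - m (M.rot (M.rot c))) * y c) := fun c => by ring
    simp only [h2, ← Finset.mul_sum] at h1
    exact (mul_eq_zero.1 (neg_eq_zero.1 h1)).resolve_left hb0

theorem sum_mul_face {A x : C → ℚ} (hA : ∀ c, A (M.rot c) = A c) {a : ℚ}
    (hx : ∀ c, x c + x (M.rot c) + x (M.rot (M.rot c)) = a) :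
    3 * ∑ c, A c * x c = a * ∑ c, A c := by
  have h1 := M.sum_rot (fun c => A c * x c)
  have h2 := M.sum_rot (fun c => A (M.rot c) * x (M.rot c))
  simp only [hA] at h1 h2
  have h3 : ∀ c, a * A c = A c * x c + A c * x (M.rot c) + A c * x (M.rot (M.rot c)) :=
    fun c => by rw [← hx c]; ring
  rw [Finset.mul_sum Finset.univ A, Finset.sum_congr rfl fun c _ => h3 c,
    Finset.sum_add_distrib, Finset.sum_add_distrib, h2, h1]
  ring

theorem sum_vertex_mul [DecidableEq V] [Fintype V] (B : V → ℚ) (x : C → ℚ) :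
    ∑ c, B (M.vertex c) * x c = ∑ v, B v * ∑ c, if M.vertex c = v then x c else 0 := by
  simp only [Finset.mul_sum]
  rw [Finset.sum_comm]
  refine Finset.sum_congr rfl fun c _ => ?_
  simp

/-- Subtracting B from m leaves a function that is constant on triangles. The triangle part pairs to
0 by the face conditions, the vertex part by the vertex conditions. -/
theorem IsNullHomologous.sum_mul_eq_zero [DecidableEq V] [Fintype V] {m : C → ℤ}
    (hm : M.IsNullHomologous m) {x : C → ℚ}
    (hface : ∀ c, x c + x (M.rot c) + x (M.rot (M.rot c)) = 0)
    (hvertex : ∀ v, ∑ c, (if M.vertex c = v then x c else 0) = 0) :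
    ∑ c, (m c : ℚ) * x c = 0 := by
  obtain ⟨B, hB⟩ := hm
  have h1 := sum_mul_face (M := M) (A := fun c => (m c : ℚ) - B (M.vertex c)) (fun c => by
    have : (m (M.rot c) : ℚ) - m c = B (M.vertex (M.rot c)) - B (M.vertex c) := by
      exact_mod_cast hB c
    linarith) hface
  have h2 := sum_vertex_mul (M := M) (fun v => (B v : ℚ)) x
  simp only [hvertex, mul_zero, Finset.sum_const_zero] at h2
  simp only [sub_mul, Finset.sum_sub_distrib, zero_mul, h2] at h1
  linarith

/-- The dual cochain of a balanced chain is closed: around a vertex its terms telescope. -/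
theorem IsBalanced.coboundary_vertex [DecidableEq V] {m : C → ℤ} (hm : M.IsBalanced m) (v : V) :
    ∑ c, (if M.vertex c = v then (m (M.rot c) : ℚ) - m (M.rot (M.rot c)) else 0) = 0 := by
  have h1 := sum_vertex_link (M := M)
    (fun c => ((m c : ℚ) - m (M.rot c))) v
  rw [← sub_eq_zero, ← Finset.sum_sub_distrib] at h1
  refine Eq.trans (Finset.sum_congr rfl fun c _ => ?_) h1
  split_ifs
  · have h2 : (m (M.rot (M.flip (M.rot c))) : ℚ) - m (M.rot (M.rot (M.flip (M.rot c)))) =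
      -(m (M.rot (M.rot c)) - m (M.rot (M.rot (M.rot c)))) := by exact_mod_cast hm (M.rot c)
    rw [M.rot_rot_rot] at h2
    rw [M.link_apply]
    linarith
  · ring

/-! ### Loops -/

namespace SimpleLoop

variable (γ : M.SimpleLoop)

/-- The signed number of arcs of the loop around a corner. -/
def chain (c : C) : ℤ := ∑ i ∈ Finset.range γ.length, if γ.corner i = c then γ.sign i else 0

theorem sum_chain_mul (g : C → ℚ) :
    ∑ c, (γ.chain c : ℚ) * g c = ∑ i ∈ Finset.range γ.length, γ.sign i * g (γ.corner i) := by
  simp only [chain, Int.cast_sum, Finset.sum_mul]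
  rw [Finset.sum_comm]
  refine Finset.sum_congr rfl fun i _ => ?_
  simp [ite_mul]

/-- The flux of the loop through a side. -/
theorem chain_flux (h : C) : γ.chain (M.rot (M.rot h)) - γ.chain (M.rot h) =
    ∑ i ∈ Finset.range γ.length,
      ((if γ.exit i = h then 1 else 0) - (if γ.entry i = h then 1 else 0)) := by
  unfold chain
  rw [← Finset.sum_sub_distrib]
  refine Finset.sum_congr rfl fun i _ => ?_
  have h1 : ∀ c, c = M.rot (M.rot h) ↔ M.rot c = h := fun c =>
    ⟨fun e => by rw [e, M.rot_rot_rot], fun e => by rw [← e, M.rot_rot_rot]⟩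
  have h2 : ∀ c, c = M.rot h ↔ M.rot (M.rot c) = h := fun c =>
    ⟨fun e => by rw [e, M.rot_rot_rot], fun e => by rw [← e, M.rot_rot_rot]⟩
  rw [if_congr (h1 _) rfl rfl, if_congr (h2 _) rfl rfl]
  unfold NormalPath.exit NormalPath.entry NormalPath.sign
  by_cases hc : γ.ccw i
  · simp only [hc, if_true]
  · simp only [hc, if_false, Bool.false_eq_true]
    split_ifs <;> ring

/-- Leaving through a side is entering through the flipped side, one index later. -/
theorem chain_isBalanced : M.IsBalanced γ.chain := by
  have h0 : ∀ h, ∑ i ∈ Finset.range γ.length, (if γ.exit i = M.flip h then (1 : ℤ) else 0) =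
      ∑ i ∈ Finset.range γ.length, (if γ.entry i = h then 1 else 0) := by
    intro h
    rw [← sum_range_shift_of_periodic (fun i => if γ.entry i = h then (1 : ℤ) else 0)
      (by have := γ.entry_add 0; rw [zero_add] at this; simp only [this])]
    refine Finset.sum_congr rfl fun i _ => ?_
    rw [γ.entry_succ]
    have : γ.exit i = M.flip h ↔ M.flip (γ.exit i) = h :=
      ⟨fun e => by rw [e, M.flip_flip], fun e => by rw [← e, M.flip_flip]⟩
    rw [if_congr this rfl rfl]
  intro h
  have h1 := γ.chain_flux h
  have h2 := γ.chain_flux (M.flip h)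
  rw [Finset.sum_sub_distrib] at h1 h2
  have h3 := h0 h
  have h4 := h0 (M.flip h)
  rw [M.flip_flip] at h4
  linarith

variable {ϑ : C → ℤ} (hϑ : M.IsBalanced ϑ)
include hϑ

/-- Exponentiating a balanced chain gives a flat local system. The base 2 ensures that the holonomy
is 1 only if its exponent is 0. -/
theorem _root_.TriangulatedSurface.IsBalanced.isLocalSystem :
    M.IsLocalSystem (fun c => (2 : ℚ) ^ ϑ c) where
  ne_zero c := zpow_ne_zero _ two_ne_zero
  flat h := by
    rw [← zpow_add₀ two_ne_zero, ← zpow_add₀ two_ne_zero]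
    congr 1
    linarith [hϑ h]

theorem transport_eq (i : ℕ) : γ.transport (fun c => (2 : ℚ) ^ ϑ c) i =
    2 ^ ∑ j ∈ Finset.range i,
      (ϑ (M.rot (M.flip (γ.exit j))) - ϑ (M.rot (M.rot (γ.exit j)))) := by
  induction i with
  | zero => simp [NormalPath.transport]
  | succ i ih =>
    rw [Finset.sum_range_succ, zpow_add₀ two_ne_zero, ← ih, NormalPath.transport, monodromy,
      zpow_sub₀ two_ne_zero]

/-- Balance allows the jump of ϑ across a side to be averaged over its two endpoints; the averages
regroup into one term per arc, which is the pairing with ϑ. -/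
theorem two_mul_holonomy_exponent :
    2 * ∑ j ∈ Finset.range γ.length,
      (ϑ (M.rot (M.flip (γ.exit j))) - ϑ (M.rot (M.rot (γ.exit j)))) =
    ∑ c, γ.chain c * (ϑ (M.rot c) - ϑ (M.rot (M.rot c))) := by
  have h0 := γ.sum_chain_mul (fun c => (ϑ (M.rot c) : ℚ) - ϑ (M.rot (M.rot c)))
  have h1 : ∑ c, γ.chain c * (ϑ (M.rot c) - ϑ (M.rot (M.rot c))) =
      ∑ i ∈ Finset.range γ.length,
        γ.sign i * (ϑ (M.rot (γ.corner i)) - ϑ (M.rot (M.rot (γ.corner i)))) := by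
    exact_mod_cast h0
  let σ : C → ℤ := fun h => ϑ (M.rot h) + ϑ (M.rot (M.rot h))
  have h2 := sum_range_shift_of_periodic (fun i => σ (γ.entry i)) (L := γ.length)
    (by have := γ.entry_add 0; rw [zero_add] at this; simp only [this])
  have h3 : ∀ i, 2 * (ϑ (M.rot (M.flip (γ.exit i))) - ϑ (M.rot (M.rot (γ.exit i)))) =
      σ (γ.entry (i + 1)) - σ (γ.exit i) := by
    intro i
    simp only [σ]
    rw [γ.entry_succ]
    linarith [hϑ (γ.exit i)]
  have h4 : ∀ i, γ.sign i * (ϑ (M.rot (γ.corner i)) - ϑ (M.rot (M.rot (γ.corner i)))) =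
      σ (γ.entry i) - σ (γ.exit i) := by
    intro i
    simp only [σ, NormalPath.entry, NormalPath.exit, NormalPath.sign]
    split_ifs <;> simp only [M.rot_rot_rot] <;> ring
  rw [h1, Finset.mul_sum, Finset.sum_congr rfl fun i _ => h3 i,
    Finset.sum_congr rfl fun i _ => h4 i, Finset.sum_sub_distrib, Finset.sum_sub_distrib, h2]

theorem holonomy_ne_one (h : ∑ c, γ.chain c * (ϑ (M.rot c) - ϑ (M.rot (M.rot c))) ≠ 0) :
    γ.holonomy (fun c => (2 : ℚ) ^ ϑ c) ≠ 1 := by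
  intro h1
  rw [holonomy, γ.transport_eq hϑ, zpow_eq_one_iff_right₀ (by norm_num) (by norm_num)] at h1
  rw [← γ.two_mul_holonomy_exponent hϑ, h1, mul_zero] at h
  exact h rfl

omit hϑ

/-- A section returns to itself multiplied by the holonomy, so it vanishes on a triangle of the loop
and, by connectedness, everywhere. -/
theorem noSections (hθ : M.IsLocalSystem θ) (hγ : γ.holonomy θ ≠ 1) : M.NoSections θ := by
  intro A hA hA'
  have h0 : ∀ i, A (γ.entry i) = A (γ.exit i) := by
    intro i
    unfold NormalPath.entry NormalPath.exit
    split_ifs <;> simp only [hA]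
  have h1 : ∀ i, A (γ.entry 0) = γ.transport θ i * A (γ.entry i) := by
    intro i
    induction i with
    | zero => simp [NormalPath.transport]
    | succ i ih =>
      rw [ih, NormalPath.transport, h0, hA' (γ.exit i), γ.entry_succ]
      ring
  have h2 := h1 γ.length
  have h3 := γ.entry_add 0
  rw [zero_add] at h3
  rw [h3] at h2
  have h4 : A (γ.entry 0) = 0 := by
    have : (γ.holonomy θ - 1) * A (γ.entry 0) = 0 := by
      unfold holonomy; linarith
    exact (mul_eq_zero.1 this).resolve_left (sub_ne_zero.2 hγ)
  funext d
  refine M.connected (fun x => A x = 0) (fun x hx => (hA x).trans hx) (fun x hx => ?_) _ d h4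
  rw [hA' x] at hx
  exact (mul_eq_zero.1 hx).resolve_left (hθ.monodromy_ne_zero x)

theorem transport_inv (i : ℕ) : γ.transport θ⁻¹ i = (γ.transport θ i)⁻¹ := by
  induction i with
  | zero => simp [NormalPath.transport]
  | succ i ih =>
    rw [NormalPath.transport, NormalPath.transport, ih, IsLocalSystem.monodromy_inv, mul_inv]

theorem noSections_inv (hθ : M.IsLocalSystem θ) (hγ : γ.holonomy θ ≠ 1) : M.NoSections θ⁻¹ :=
  γ.noSections hθ.inv (by rw [holonomy, transport_inv]; exact inv_ne_one.2 hγ)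

/-- Homologous simple closed curves on a torus have the same rotation number with respect to a flat
structure. -/
theorem rotation_eq [DecidableEq V] [DecidableEq F] [Fintype V] [Fintype F]
    (hE : Fintype.card C = 6 * Fintype.card V) (δ : M.SimpleLoop)
    (hγ : ¬ M.IsNullHomologous γ.chain) {ε : ℤ}
    (hγδ : M.IsNullHomologous (fun c => γ.chain c - ε * δ.chain c)) {f : C → ℚ}
    (hface : ∀ c, f c + f (M.rot c) + f (M.rot (M.rot c)) = 1)
    (hvertex : ∀ v, ∑ c, (if M.vertex c = v then f c else 0) = 2) :
    ∑ c, (γ.chain c : ℚ) * f c = ε * ∑ c, (δ.chain c : ℚ) * f c := by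
  obtain ⟨ϑ, hϑ, hne⟩ := γ.chain_isBalanced.exists_pairing_ne_zero hγ
  have hcomp : ∀ x : C → ℚ, ∑ c, (((γ.chain c - ε * δ.chain c : ℤ)) : ℚ) * x c =
      ∑ c, (γ.chain c : ℚ) * x c - ε * ∑ c, (δ.chain c : ℚ) * x c := by
    intro x
    rw [Finset.mul_sum, ← Finset.sum_sub_distrib]
    refine Finset.sum_congr rfl fun c _ => ?_
    push_cast; ring
  -- The pairing with ϑ is homological, so the same local system has nontrivial holonomy along δ.
  have hneδ : ∑ c, δ.chain c * (ϑ (M.rot c) - ϑ (M.rot (M.rot c))) ≠ 0 := by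
    intro h0
    have h1 := hγδ.sum_mul_eq_zero (x := fun c => (ϑ (M.rot c) : ℚ) - ϑ (M.rot (M.rot c)))
      (fun c => by simp only [M.rot_rot_rot]; ring) hϑ.coboundary_vertex
    rw [hcomp] at h1
    have h2 : ∑ c, (δ.chain c : ℚ) * ((ϑ (M.rot c) : ℚ) - ϑ (M.rot (M.rot c))) = 0 := by
      exact_mod_cast h0
    rw [h2, mul_zero, sub_zero] at h1
    exact hne (by exact_mod_cast h1)
  have hθ := hϑ.isLocalSystem
  have hhol := γ.holonomy_ne_one hϑ hne
  obtain ⟨K₁, K₂, hK⟩ := exists_isPropagator hE hθ (γ.noSections hθ hhol)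
    (γ.noSections_inv hθ hhol)
  have h1 := γ.diagonalCochain_sum hθ hK hhol
  have h2 := δ.diagonalCochain_sum hθ hK (δ.holonomy_ne_one hϑ hneδ)
  rw [← sum_chain_mul] at h1 h2
  -- The angles minus twice the diagonal cochain form a cocycle: triangles give 1 - 2 · 1/2 and
  -- vertices 2 - 2 · 1.
  have h3 := hγδ.sum_mul_eq_zero (x := fun c => f c - 2 * M.diagonalCochain K₁ K₂ c)
    (fun c => by linarith [hface c, hK.diagonalCochain_face c])
    (fun v => by
      have h4 := hvertex v
      have h5 := hK.diagonalCochain_vertex hθ v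
      have h6 : ∀ c, (if M.vertex c = v then f c - 2 * M.diagonalCochain K₁ K₂ c else 0) =
          (if M.vertex c = v then f c else 0) -
          2 * (if M.vertex c = v then M.diagonalCochain K₁ K₂ c else 0) := fun c => by
        split_ifs <;> ring
      rw [Finset.sum_congr rfl fun c _ => h6 c, Finset.sum_sub_distrib, ← Finset.mul_sum, h4, h5]
      norm_num)
  rw [hcomp] at h3
  have h7 : ∀ m : C → ℤ, ∑ c, (m c : ℚ) * (f c - 2 * M.diagonalCochain K₁ K₂ c) =
      ∑ c, (m c : ℚ) * f c - 2 * ∑ c, (m c : ℚ) * M.diagonalCochain K₁ K₂ c := by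
    intro m
    rw [Finset.mul_sum, ← Finset.sum_sub_distrib]
    exact Finset.sum_congr rfl fun c _ => by ring
  rw [h7, h7, h1, h2] at h3
  linarith

end SimpleLoop

end TriangulatedSurface

namespace TriangulatedSurface

variable {C V F : Type*} {M : TriangulatedSurface C V F} [Fintype C] [DecidableEq C]

/-! ### Simple closed curves are primitive -/

namespace SimpleLoop

variable (γ : M.SimpleLoop)

theorem ne_of_corner_ne {i j : ℕ} (hi : i < γ.length) (hj : j < γ.length) (h : i ≠ j) :
    i % γ.length ≠ j % γ.length := by
  rwa [Nat.mod_eq_of_lt hi, Nat.mod_eq_of_lt hj]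

/-- The signed number of strands that cross a side before a given position. -/
def crossingBefore (h : C) (x : ℝ) : ℤ :=
  ∑ j ∈ Finset.range γ.length, ((if γ.exit j = h ∧ γ.exitPos j < x then 1 else 0) -
    (if γ.entry j = h ∧ γ.entryPos j < x then 1 else 0))

/-- The signed number of strands that cross a side at a given position. -/
def crossingAt (h : C) (x : ℝ) : ℤ :=
  ∑ j ∈ Finset.range γ.length, ((if γ.exit j = h ∧ γ.exitPos j = x then 1 else 0) -
    (if γ.entry j = h ∧ γ.entryPos j = x then 1 else 0))

/-- The signed number of arcs that separate an arc from its corner. -/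
def innerCount (i : ℕ) : ℤ :=
  ∑ j ∈ Finset.range γ.length,
    if γ.corner j = γ.corner i ∧ γ.distPrev j < γ.distPrev i then γ.sign j else 0

/-- Between the corner and the endpoint of the arc only arcs around the same corner can end; arcs
around the next corner end farther away, by disjointness. -/
theorem crossingBefore_prev {i : ℕ} (hi : i < γ.length) :
    γ.crossingBefore (M.rot (M.rot (γ.corner i))) (γ.distPrev i) = -γ.innerCount i := by
  unfold crossingBefore innerCount
  rw [← Finset.sum_neg_distrib]
  refine Finset.sum_congr rfl fun j hj => ?_
  have hj := Finset.mem_range.1 hj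
  by_cases h0 : γ.corner j = γ.corner i
  · have r1 := M.rot_rot_ne_rot (γ.corner i)
    simp only [NormalPath.entry, NormalPath.exit, NormalPath.sign, entryPos, exitPos, h0]
    rcases Bool.eq_false_or_eq_true (γ.ccw j) with hc | hc <;>
      simp [hc, r1.symm]
    split_ifs <;> rfl
  · by_cases h1 : γ.corner j = M.rot (γ.corner i)
    · have h2 := γ.noncrossing i j (γ.ne_of_corner_ne hi hj fun e => h0 (by rw [e])) h1
      have h3 : ¬ (1 - γ.distNext j < γ.distPrev i) := by linarith
      have r1 := M.rot_ne (γ.corner i)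
      have r2 := (M.rot_rot_ne (γ.corner i)).symm
      simp only [NormalPath.entry, NormalPath.exit, NormalPath.sign, entryPos, exitPos, h1,
        M.rot_rot_rot]
      rcases Bool.eq_false_or_eq_true (γ.ccw j) with hc | hc <;> simp [hc, r1, r2, h3]
    · simp only [NormalPath.entry, NormalPath.exit, NormalPath.sign, entryPos, exitPos]
      rcases Bool.eq_false_or_eq_true (γ.ccw j) with hc | hc <;> simp [hc, h0, h1]

/-- This side is directed towards the corner, so the strands before the endpoint are all strands
except the inner ones and the arc itself. -/
theorem crossingBefore_next {i : ℕ} (hi : i < γ.length) :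
    γ.crossingBefore (M.rot (γ.corner i)) (1 - γ.distNext i) =
      γ.chain (γ.corner i) - γ.chain (M.rot (M.rot (γ.corner i))) - γ.innerCount i - γ.sign i := by
  have h0 := γ.chain_flux (M.rot (γ.corner i))
  rw [M.rot_rot_rot] at h0
  have hs : γ.sign i = ∑ j ∈ Finset.range γ.length, if j = i then γ.sign j else 0 := by
    rw [Finset.sum_ite_eq', if_pos (Finset.mem_range.2 hi)]
  rw [h0, hs]
  unfold crossingBefore innerCount
  rw [← Finset.sum_sub_distrib, ← Finset.sum_sub_distrib]
  refine Finset.sum_congr rfl fun j hj => ?_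
  have hj := Finset.mem_range.1 hj
  by_cases h0 : γ.corner j = γ.corner i
  · have r1 := M.rot_rot_ne_rot (γ.corner i)
    simp only [NormalPath.entry, NormalPath.exit, NormalPath.sign, entryPos, exitPos, h0]
    by_cases hij : j = i
    · subst hij
      rcases Bool.eq_false_or_eq_true (γ.ccw j) with hc | hc <;> simp [hc, r1]
    · rcases γ.nested j i (γ.ne_of_corner_ne hj hi hij) h0 with ⟨ha, hb⟩ | ⟨ha, hb⟩
      · rcases Bool.eq_false_or_eq_true (γ.ccw j) with hc | hc <;>
          simp [hc, M.rot_ne, hij, ha, hb.not_gt]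
      · rcases Bool.eq_false_or_eq_true (γ.ccw j) with hc | hc <;>
          simp [hc, M.rot_ne, hij, ha.not_gt, hb]
  · have hij : j ≠ i := fun e => h0 (by rw [e])
    by_cases h1 : γ.corner i = M.rot (γ.corner j)
    · have h2 := γ.noncrossing j i (γ.ne_of_corner_ne hj hi hij) h1
      have h3 : γ.distPrev j < 1 - γ.distNext i := by linarith
      have r1 := (M.rot_rot_ne_rot (γ.corner j)).symm
      simp only [NormalPath.entry, NormalPath.exit, NormalPath.sign, entryPos, exitPos, h1]
      have r2 := (M.rot_ne (γ.corner j)).symm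
      rcases Bool.eq_false_or_eq_true (γ.ccw j) with hc | hc <;>
        simp [hc, r2, h3, hij]
    · have h1' : ¬ M.rot (γ.corner j) = γ.corner i := fun e => h1 e.symm
      simp only [NormalPath.entry, NormalPath.exit, NormalPath.sign, entryPos, exitPos]
      rcases Bool.eq_false_or_eq_true (γ.ccw j) with hc | hc <;> simp [hc, h0, h1', hij]

theorem exitPos_ne {i j : ℕ} (hi : i < γ.length) (hj : j < γ.length) (hij : j ≠ i)
    (h : γ.exit j = γ.exit i) : γ.exitPos j ≠ γ.exitPos i := by
  have hm := γ.ne_of_corner_ne hj hi hij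
  unfold NormalPath.exit at h
  unfold exitPos
  rcases Bool.eq_false_or_eq_true (γ.ccw i) with hi' | hi' <;>
    rcases Bool.eq_false_or_eq_true (γ.ccw j) with hj' | hj' <;>
    simp only [hi', hj', if_true, if_false, Bool.false_eq_true, EmbeddingLike.apply_eq_iff_eq]
      at h ⊢
  · rcases γ.nested j i hm h with ⟨ha, hb⟩ | ⟨ha, hb⟩ <;> intro e <;> linarith
  · have := γ.noncrossing j i hm h.symm
    intro e; linarith
  · have := γ.noncrossing i j hm.symm h
    intro e; linarith
  · rcases γ.nested j i hm h with ⟨ha, hb⟩ | ⟨ha, hb⟩ <;> intro e <;> linarith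

theorem entryPos_ne_exitPos {i j : ℕ} (hi : i < γ.length) (hj : j < γ.length)
    (h : γ.entry j = γ.exit i) : γ.entryPos j ≠ γ.exitPos i := by
  have hij : j ≠ i := fun e => γ.entry_ne_exit i (by rw [← h, e])
  have hm := γ.ne_of_corner_ne hj hi hij
  unfold NormalPath.exit NormalPath.entry at h
  unfold exitPos entryPos
  rcases Bool.eq_false_or_eq_true (γ.ccw i) with hi' | hi' <;>
    rcases Bool.eq_false_or_eq_true (γ.ccw j) with hj' | hj' <;>
    simp only [hi', hj', if_true, if_false, Bool.false_eq_true, EmbeddingLike.apply_eq_iff_eq]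
      at h ⊢
  · have := γ.noncrossing j i hm h.symm
    intro e; linarith
  · rcases γ.nested j i hm h with ⟨ha, hb⟩ | ⟨ha, hb⟩ <;> intro e <;> linarith
  · rcases γ.nested j i hm h with ⟨ha, hb⟩ | ⟨ha, hb⟩ <;> intro e <;> linarith
  · have := γ.noncrossing i j hm.symm h
    intro e; linarith

theorem entryPos_ne {i j : ℕ} (hi : i < γ.length) (hj : j < γ.length) (hij : j ≠ i)
    (h : γ.entry j = γ.entry i) : γ.entryPos j ≠ γ.entryPos i := by
  have hm := γ.ne_of_corner_ne hj hi hij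
  unfold NormalPath.entry at h
  unfold entryPos
  rcases Bool.eq_false_or_eq_true (γ.ccw i) with hi' | hi' <;>
    rcases Bool.eq_false_or_eq_true (γ.ccw j) with hj' | hj' <;>
    simp only [hi', hj', if_true, if_false, Bool.false_eq_true, EmbeddingLike.apply_eq_iff_eq]
      at h ⊢
  · rcases γ.nested j i hm h with ⟨ha, hb⟩ | ⟨ha, hb⟩ <;> intro e <;> linarith
  · have := γ.noncrossing i j hm.symm h
    intro e; linarith
  · have := γ.noncrossing j i hm h.symm
    intro e; linarith
  · rcases γ.nested j i hm h with ⟨ha, hb⟩ | ⟨ha, hb⟩ <;> intro e <;> linarith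

theorem crossingAt_exit {i : ℕ} (hi : i < γ.length) :
    γ.crossingAt (γ.exit i) (γ.exitPos i) = 1 := by
  unfold crossingAt
  rw [Finset.sum_eq_single_of_mem i (Finset.mem_range.2 hi)]
  · rw [if_pos ⟨rfl, rfl⟩, if_neg fun e => γ.entry_ne_exit i e.1]; rfl
  · intro j hj hij
    have hj := Finset.mem_range.1 hj
    rw [if_neg fun e => γ.exitPos_ne hi hj hij e.1 e.2,
      if_neg fun e => γ.entryPos_ne_exitPos hi hj e.1 e.2, sub_zero]

theorem crossingAt_entry {i : ℕ} (hi : i < γ.length) :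
    γ.crossingAt (γ.entry i) (γ.entryPos i) = -1 := by
  unfold crossingAt
  rw [Finset.sum_eq_single_of_mem i (Finset.mem_range.2 hi)]
  · rw [if_neg fun e => γ.entry_ne_exit i e.1.symm, if_pos ⟨rfl, rfl⟩]; rfl
  · intro j hj hij
    have hj := Finset.mem_range.1 hj
    rw [if_neg fun e => γ.entryPos_ne_exitPos hj hi e.1.symm e.2.symm,
      if_neg fun e => γ.entryPos_ne hi hj hij e.1 e.2, sub_zero]

/-- Across the side, directions and signs are reversed: what lay after the position now lies before
it. -/
theorem crossingBefore_flip (h : C) (x : ℝ) :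
    γ.crossingBefore (M.flip h) (1 - x) =
      γ.crossingBefore h x + γ.crossingAt h x -
        (γ.chain (M.rot (M.rot h)) - γ.chain (M.rot h)) := by
  have hs1 := sum_range_shift_of_periodic
    (fun j => if γ.entry j = h ∧ x < γ.entryPos j then (1 : ℤ) else 0) (L := γ.length) (by
      have h1 := γ.entry_add 0
      have h2 := γ.entryPos_add 0
      rw [zero_add] at h1 h2
      simp only [h1, h2])
  have hs2 := sum_range_shift_of_periodic
    (fun j => if γ.entry j = M.flip h ∧ γ.entryPos j < 1 - x then (1 : ℤ) else 0)
      (L := γ.length) (by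
      have h1 := γ.entry_add 0
      have h2 := γ.entryPos_add 0
      rw [zero_add] at h1 h2
      simp only [h1, h2])
  have hf : ∀ a, M.flip a = h ↔ a = M.flip h := fun a =>
    ⟨fun e => by rw [← e, M.flip_flip], fun e => by rw [e, M.flip_flip]⟩
  have e1 : ∀ j, (x < 1 - γ.exitPos j) ↔ γ.exitPos j < 1 - x :=
    fun j => ⟨fun _ => by linarith, fun _ => by linarith⟩
  have e2 : ∀ j, (1 - γ.exitPos j < 1 - x) ↔ x < γ.exitPos j :=
    fun j => ⟨fun _ => by linarith, fun _ => by linarith⟩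
  simp only [γ.entry_succ, γ.entryPos_succ, hf, M.flip.injective.eq_iff, e1, e2] at hs1 hs2
  rw [γ.chain_flux h]
  unfold crossingBefore crossingAt
  rw [Finset.sum_sub_distrib, hs1, ← hs2]
  rw [← Finset.sum_sub_distrib, ← Finset.sum_add_distrib, ← Finset.sum_sub_distrib]
  refine Finset.sum_congr rfl fun j _ => ?_
  have key : ∀ (p : Prop) [Decidable p] (y : ℝ), (if p then (1 : ℤ) else 0) =
      (if p ∧ y < x then 1 else 0) + (if p ∧ y = x then 1 else 0) +
        (if p ∧ x < y then 1 else 0) := by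
    intro p _ y
    by_cases hp : p
    · rcases lt_trichotomy y x with h | h | h
      · simp [hp, h, h.ne, h.not_gt]
      · simp [hp, h]
      · simp [hp, h, h.ne', h.not_gt]
    · simp [hp]
  rw [key (γ.exit j = h) (γ.exitPos j), key (γ.entry j = h) (γ.entryPos j)]
  ring

section Coloring

variable {G : Type*} [AddCommGroup G] {a : G} {β : V → G}
  (hβ : ∀ h, β (M.vertex (M.rot (M.rot h))) =
    β (M.vertex (M.rot h)) + (γ.chain (M.rot (M.rot h)) - γ.chain (M.rot h)) • a)
include hβ

/-- Continue β to the complement of the loop by adding a for each signed crossing. The color left of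
an arc is then constant along the arc, and the color right of it is smaller by a; at the entry the
left region comes first on the side, at the exit the right one. -/
theorem color_exit {i : ℕ} (hi : i < γ.length) :
    β (M.vertex (M.rot (γ.exit i))) + γ.crossingBefore (γ.exit i) (γ.exitPos i) • a =
      β (M.vertex (M.rot (γ.entry i))) +
        γ.crossingBefore (γ.entry i) (γ.entryPos i) • a - a := by
  have h1 := γ.crossingBefore_prev hi
  have h2 := γ.crossingBefore_next hi
  have h3 := hβ (M.rot (γ.corner i))
  rw [M.rot_rot_rot] at h3
  unfold NormalPath.exit NormalPath.entry exitPos entryPos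
  have hs : γ.sign i = if γ.ccw i then 1 else -1 := rfl
  rcases Bool.eq_false_or_eq_true (γ.ccw i) with hc | hc <;>
    simp only [hc, if_true, if_false, Bool.false_eq_true] at hs ⊢ <;>
    rw [h1, h2, M.rot_rot_rot, h3, hs] <;> simp only [sub_smul, neg_smul, one_smul] <;> abel

theorem color_step {i : ℕ} (hi : i < γ.length) :
    β (M.vertex (M.rot (γ.entry (i + 1)))) +
        γ.crossingBefore (γ.entry (i + 1)) (γ.entryPos (i + 1)) • a =
      β (M.vertex (M.rot (γ.entry i))) +
        γ.crossingBefore (γ.entry i) (γ.entryPos i) • a := by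
  have h1 := γ.color_exit hβ hi
  rw [γ.entry_succ, γ.entryPos_succ, crossingBefore_flip, M.vertex_rot_flip, hβ,
    γ.crossingAt_exit hi]
  rw [eq_sub_iff_add_eq] at h1
  rw [← h1]
  simp only [sub_smul, add_smul, one_smul]
  abel

theorem color_eq {i : ℕ} (hi : i < γ.length) :
    β (M.vertex (M.rot (γ.entry i))) + γ.crossingBefore (γ.entry i) (γ.entryPos i) • a =
      β (M.vertex (M.rot (γ.entry 0))) +
        γ.crossingBefore (γ.entry 0) (γ.entryPos 0) • a := by
  induction i with
  | zero => rfl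
  | succ i ih => rw [γ.color_step hβ (by omega), ih (by omega)]

/-- All regions left of the loop have the same color l and all regions right of it have the color l
- a ≠ l. So the indicator of the color l jumps exactly at the strands, and its values at the
vertices bound the loop. -/
theorem isNullHomologous_of_coloring (ha : a ≠ 0) : M.IsNullHomologous γ.chain := by
  classical
  set l := β (M.vertex (M.rot (γ.entry 0))) +
    γ.crossingBefore (γ.entry 0) (γ.entryPos 0) • a with hl
  let T : Finset ℝ := (Finset.range γ.length).image γ.exitPos ∪
    (Finset.range γ.length).image γ.entryPos
  have hTexit : ∀ j < γ.length, γ.exitPos j ∈ T := fun j hj =>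
    Finset.mem_union_left _ (Finset.mem_image_of_mem _ (Finset.mem_range.2 hj))
  have hTentry : ∀ j < γ.length, γ.entryPos j ∈ T := fun j hj =>
    Finset.mem_union_right _ (Finset.mem_image_of_mem _ (Finset.mem_range.2 hj))
  -- Along a side the change of the indicator is the number of crossings so far. The induction runs
  -- over the number of positions in `T` below x.
  have key : ∀ (h : C) (n : ℕ) (x : ℝ), (T.filter (· < x)).card = n →
      (if β (M.vertex (M.rot h)) + γ.crossingBefore h x • a = l then (1 : ℤ) else 0) -
        (if β (M.vertex (M.rot h)) = l then 1 else 0) = γ.crossingBefore h x := by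
    intro h n
    induction n using Nat.strong_induction_on with
    | _ n ih =>
      intro x hx
      rcases (T.filter (· < x)).eq_empty_or_nonempty with he | hne
      · have h0 : γ.crossingBefore h x = 0 := by
          refine Finset.sum_eq_zero fun j hj => ?_
          have hj := Finset.mem_range.1 hj
          have h1 : ∀ y ∈ T, ¬ y < x := fun y hy hyx => by
            have : y ∈ T.filter (· < x) := Finset.mem_filter.2 ⟨hy, hyx⟩
            rw [he] at this
            exact absurd this (Finset.notMem_empty _)
          rw [if_neg fun e => h1 _ (hTexit j hj) e.2, if_neg fun e => h1 _ (hTentry j hj) e.2,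
            sub_zero]
        rw [h0, zero_smul, add_zero, sub_self]
      · set y := (T.filter (· < x)).max' hne with hy
        have hyT := Finset.mem_filter.1 ((T.filter (· < x)).max'_mem hne)
        rw [← hy] at hyT
        have hlt : ∀ z ∈ T, z < x ↔ z < y ∨ z = y := fun z hz => by
          constructor
          · intro hzx
            exact lt_or_eq_of_le (Finset.le_max' _ z (Finset.mem_filter.2 ⟨hz, hzx⟩))
          · rintro (h1 | rfl)
            · exact h1.trans hyT.2
            · exact hyT.2
        have hcard : (T.filter (· < y)).card < n := by
          rw [← hx]
          refine Finset.card_lt_card (Finset.ssubset_iff_subset_ne.2 ⟨fun z hz => ?_, fun e => ?_⟩)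
          · have := Finset.mem_filter.1 hz
            exact Finset.mem_filter.2 ⟨this.1, this.2.trans hyT.2⟩
          · have : y ∈ T.filter (· < y) := by rw [e]; exact Finset.mem_filter.2 hyT
            exact lt_irrefl _ (Finset.mem_filter.1 this).2
        have hsplit : γ.crossingBefore h x = γ.crossingBefore h y + γ.crossingAt h y := by
          unfold crossingBefore crossingAt
          rw [← Finset.sum_add_distrib]
          refine Finset.sum_congr rfl fun j hj => ?_
          have hj := Finset.mem_range.1 hj
          have k : ∀ (p : Prop) [Decidable p] (z : ℝ), z ∈ T →
              (if p ∧ z < x then (1 : ℤ) else 0) =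
              (if p ∧ z < y then 1 else 0) + (if p ∧ z = y then 1 else 0) := by
            intro p _ z hz
            by_cases hp : p
            · rcases lt_trichotomy z y with h1 | h1 | h1
              · simp [hp, hlt z hz, h1, h1.ne]
              · simp [hp, h1, hyT.2]
              · simp [hp, hlt z hz, h1.not_gt, h1.ne']
            · simp [hp]
          rw [k _ _ (hTexit j hj), k _ _ (hTentry j hj)]
          ring
        have hih := ih _ hcard y rfl
        rw [hsplit, add_smul, ← add_assoc]
        by_cases hex : ∃ i < γ.length, γ.exit i = h ∧ γ.exitPos i = y
        · obtain ⟨i, hi, rfl, hiy⟩ := hex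
          have h1 := γ.color_exit hβ hi
          rw [γ.color_eq hβ hi, ← hl] at h1
          have h2 := γ.crossingAt_exit hi
          rw [hiy] at h1 h2
          -- At an exit the color changes from l - a to l; at an entry, treated next, from l to l -
          -- a.
          rw [h1, if_neg fun e => ha (sub_eq_self.1 e)] at hih
          rw [h2, h1, ← hih, one_smul, sub_add_cancel, if_pos rfl]
          ring
        · by_cases hen : ∃ i < γ.length, γ.entry i = h ∧ γ.entryPos i = y
          · obtain ⟨i, hi, rfl, hiy⟩ := hen
            have h1 := γ.color_eq hβ hi
            rw [← hl] at h1
            have h2 := γ.crossingAt_entry hi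
            rw [hiy] at h1 h2
            rw [h1, if_pos rfl] at hih
            rw [h2, h1, ← hih, neg_smul, one_smul,
              if_neg fun e => ha (neg_eq_zero.1 (add_eq_left.1 e))]
            ring
          · have h0 : γ.crossingAt h y = 0 := by
              refine Finset.sum_eq_zero fun j hj => ?_
              have hj := Finset.mem_range.1 hj
              rw [if_neg fun e => hex ⟨j, hj, e⟩, if_neg fun e => hen ⟨j, hj, e⟩, sub_zero]
            rw [h0, zero_smul, add_zero, add_zero, hih]
  have hall : ∀ h, γ.crossingBefore h 1 = γ.chain (M.rot (M.rot h)) - γ.chain (M.rot h) := by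
    intro h
    rw [γ.chain_flux]
    refine Finset.sum_congr rfl fun j _ => ?_
    have h1 := γ.distPrev_mem j
    have h2 := γ.distNext_mem j
    have h3 : γ.exitPos j < 1 := by
      unfold exitPos; split_ifs
      · linarith [h2.1]
      · exact h1.2
    have h4 : γ.entryPos j < 1 := by
      unfold entryPos; split_ifs
      · exact h1.2
      · linarith [h2.1]
    simp [h3, h4]
  refine ⟨fun v => if β v = l then 1 else 0, fun c => ?_⟩
  have h1 := key (M.rot (M.rot c)) _ 1 rfl
  rw [hall, ← hβ] at h1
  simp only [M.rot_rot_rot] at h1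
  exact h1.symm

end Coloring

end SimpleLoop

end TriangulatedSurface

namespace TriangulatedSurface

variable {C V F : Type*} {M : TriangulatedSurface C V F} [Fintype C] [DecidableEq C]

/-! ### The first cohomology of a torus -/

theorem isLocalSystem_one : M.IsLocalSystem 1 where
  ne_zero _ := one_ne_zero
  flat _ := rfl

theorem mem_sideCochains_one {g : C → ℚ} :
    g ∈ M.sideCochains 1 ↔ ∀ h, g (M.flip h) = g h := by
  simp [mem_sideCochains, monodromy, eq_comm]

/-- With trivial coefficients a left kernel vector is constant on triangles, by connectedness, and
its vertex values are determined by this constant. -/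
theorem finrank_ker_faceMatrix_transpose_le [Nonempty C] [DecidableEq V] [DecidableEq F]
    [Fintype V] [Fintype F] :
    Module.finrank ℚ (LinearMap.ker (M.faceMatrix 1).transpose.mulVecLin) ≤ 1 := by
  obtain ⟨c₀⟩ := ‹Nonempty C›
  let e : (F ⊕ V → ℚ) →ₗ[ℚ] ℚ := LinearMap.proj (Sum.inl (M.face c₀))
  have h := LinearMap.finrank_le_finrank_of_injective
    (f := e.domRestrict (LinearMap.ker (M.faceMatrix 1).transpose.mulVecLin)) (by
      rw [← LinearMap.ker_eq_bot, LinearMap.ker_eq_bot']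
      rintro ⟨y, hy⟩ h0
      have h0 : y (Sum.inl (M.face c₀)) = 0 := h0
      have hy : (M.faceMatrix 1).transpose.mulVec y = 0 := hy
      have h1 := transpose_eq_monodromy isLocalSystem_one hy
      rw [inv_one, mem_sideCochains_one] at h1
      have h2 := eq_of_rot_of_flip (M := M) (A := fun c => y (Sum.inl (M.face c)))
        (fun c => by rw [M.face_rot]) h1 c₀
      simp only [h0] at h2
      ext x
      rcases x with f | v
      · obtain ⟨c, rfl⟩ := M.face_surjective f
        exact h2 c
      · obtain ⟨c, rfl⟩ := M.vertex_surjective v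
        have := congrFun hy c
        rw [faceMatrix_transpose_mulVec, h2 c] at this
        simpa using this)
  simpa using h

/-- The kernel of the coboundary on side functions consists of constants. -/
theorem card_le_finrank_sideCoboundary [Nonempty C] :
    Fintype.card C ≤ 2 * Module.finrank ℚ ((M.sideCochains 1).map M.sideCoboundary) + 2 := by
  obtain ⟨c₀⟩ := ‹Nonempty C›
  have h1 := card_le_finrank_sideCochains (M := M) isLocalSystem_one
  let D := M.sideCoboundary.domRestrict (M.sideCochains 1)
  have h2 := LinearMap.finrank_range_add_finrank_ker D
  have h3 : LinearMap.range D = (M.sideCochains 1).map M.sideCoboundary :=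
    LinearMap.range_domRestrict _ _
  let e : (C → ℚ) →ₗ[ℚ] ℚ := LinearMap.proj c₀
  have h4 := LinearMap.finrank_le_finrank_of_injective
    (f := (e.domRestrict (M.sideCochains 1)).domRestrict (LinearMap.ker D)) (by
      refine (injective_iff_map_eq_zero _).2 ?_
      rintro ⟨⟨y, hy⟩, hy'⟩ h0
      have h0 : y c₀ = 0 := h0
      have hy' : M.sideCoboundary y = 0 := congrArg id (LinearMap.mem_ker.1 hy')
      have h2 := eq_of_rot_of_flip (M := M) (A := y)
        (fun c => by
          have := congrFun hy' (M.rot (M.rot c))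
          rw [sideCoboundary_apply, M.rot_rot_rot] at this
          exact (sub_eq_zero.1 this).symm) (mem_sideCochains_one.1 hy) c₀
      ext c
      exact (h2 c).trans h0)
  rw [h3] at h2
  rw [Module.finrank_self] at h4
  omega

/-- On a torus, a closed cochain orthogonal to an essential chain is cohomologous to a multiple of the
dual of this chain. -/
theorem IsBalanced.exists_eq_add_coboundary [Nonempty C] [DecidableEq V] [DecidableEq F]
    [Fintype V] [Fintype F] (hE : Fintype.card C = 6 * Fintype.card V) {m : C → ℤ}
    (hm : M.IsBalanced m) (h : ¬ M.IsNullHomologous m) {w : C → ℚ}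
    (hface : ∀ c, w c + w (M.rot c) + w (M.rot (M.rot c)) = 0)
    (hvertex : ∀ v, ∑ c, (if M.vertex c = v then w c else 0) = 0)
    (hw : ∑ c, (m c : ℚ) * w c = 0) :
    ∃ (μ : ℚ) (φ : C → ℚ), (∀ c, φ (M.flip c) = φ c) ∧
      ∀ c, w c = μ * (m (M.rot c) - m (M.rot (M.rot c))) + (φ (M.rot c) - φ (M.rot (M.rot c))) := by
  let Z := LinearMap.ker (M.faceMatrix 1).mulVecLin
  have memZ : ∀ x : C → ℚ, (∀ c, x c + x (M.rot c) + x (M.rot (M.rot c)) = 0) →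
      (∀ v, ∑ c, (if M.vertex c = v then x c else 0) = 0) → x ∈ Z := by
    intro x h1 h2
    refine LinearMap.mem_ker.2 ?_
    rw [Matrix.mulVecLin_apply]
    funext y
    rcases y with f | v
    · obtain ⟨c, rfl⟩ := M.face_surjective f
      rw [faceMatrix_mulVec_inl, M.sum_face]
      exact h1 c
    · rw [faceMatrix_mulVec_inr]
      simpa using h2 v
  let ev : (C → ℚ) →ₗ[ℚ] ℚ := ∑ c, (m c : ℚ) • LinearMap.proj c
  have hev : ∀ x, ev x = ∑ c, (m c : ℚ) * x c := fun x => by simp [ev]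
  have dualZ : ∀ ϑ : C → ℤ, M.IsBalanced ϑ →
      (fun c => (ϑ (M.rot c) : ℚ) - ϑ (M.rot (M.rot c))) ∈ Z := by
    intro ϑ hϑ
    refine memZ _ (fun c => ?_) fun v => hϑ.coboundary_vertex v
    simp only [M.rot_rot_rot]; ring
  obtain ⟨ϑ, hϑ, hne⟩ := hm.exists_pairing_ne_zero h
  let P := Z ⊓ LinearMap.ker ev
  have hPZ : P < Z := by
    refine lt_of_le_of_ne inf_le_left fun e => ?_
    have h1 := dualZ ϑ hϑ
    rw [← e] at h1
    have h2 := LinearMap.mem_ker.1 h1.2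
    rw [hev] at h2
    exact hne (by exact_mod_cast h2)
  let κ : C → ℚ := fun c => (m (M.rot c) : ℚ) - m (M.rot (M.rot c))
  let B := (M.sideCochains 1).map M.sideCoboundary
  let Q := B ⊔ Submodule.span ℚ {κ}
  have hBQ : B < Q := by
    refine lt_of_le_of_ne le_sup_left fun e => ?_
    have h1 : κ ∈ B := by
      rw [e]
      exact Submodule.mem_sup_right (Submodule.mem_span_singleton_self κ)
    obtain ⟨φ, hφ, hφκ⟩ := h1
    exact h (hm.isNullHomologous (mem_sideCochains_one.1 hφ) fun c => (congrFun hφκ c).symm)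
  have hκ : ∀ c, κ (M.flip c) = - κ c := fun c => by
    have := hm c
    simp only [κ]
    exact_mod_cast this
  have hQP : Q ≤ P := by
    refine sup_le ?_ ?_
    · rintro _ ⟨φ, hφ, rfl⟩
      refine ⟨LinearMap.mem_ker.2 (by
        rw [Matrix.mulVecLin_apply]
        exact faceMatrix_mulVec_sideCoboundary isLocalSystem_one hφ), LinearMap.mem_ker.2 ?_⟩
      rw [hev]
      simp only [sideCoboundary_apply]
      rw [sum_mul_coboundary (M := M) (fun c => (m c : ℚ)),
        sum_mul_eq_zero_of_balanced (M := M) κ φ hκ (mem_sideCochains_one.1 hφ), neg_zero]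
    · rw [Submodule.span_singleton_le_iff_mem]
      refine ⟨dualZ m hm, LinearMap.mem_ker.2 ?_⟩
      rw [hev]
      have h1 := sum_mul_coboundary (M := M) (fun c => (m c : ℚ)) (fun c => (m c : ℚ))
      have h2 : ∑ c, ((m (M.rot c) : ℚ) - m (M.rot (M.rot c))) * m c = ∑ c, (m c : ℚ) * κ c :=
        Finset.sum_congr rfl fun c _ => mul_comm _ _
      rw [h2] at h1
      exact self_eq_neg.1 h1
  have d1 : 2 * Module.finrank ℚ Z = _ := finrank_ker_faceMatrix (M := M) (θ := 1) hE
  have d2 := finrank_ker_faceMatrix_transpose_le (M := M)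
  have d3 : _ ≤ 2 * Module.finrank ℚ B + 2 := card_le_finrank_sideCoboundary
  have d4 := Submodule.finrank_lt_finrank_of_lt hPZ
  have d5 := Submodule.finrank_lt_finrank_of_lt hBQ
  -- dim Z ≤ |C|/2 + 1 and dim B ≥ |C|/2 - 1, so the chain B < Q ≤ P < Z leaves no room between Q
  -- and P.
  have hQP' : Q = P := Submodule.eq_of_le_of_finrank_le hQP (by omega)
  have hwQ : w ∈ Q := by
    rw [hQP']
    exact ⟨memZ w hface hvertex, LinearMap.mem_ker.2 (by rw [hev, hw])⟩
  obtain ⟨_, ⟨φ, hφ, rfl⟩, _, hy, hsum⟩ := Submodule.mem_sup.1 hwQ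
  obtain ⟨μ, rfl⟩ := Submodule.mem_span_singleton.1 hy
  refine ⟨μ, φ, mem_sideCochains_one.1 hφ, fun c => ?_⟩
  rw [← hsum, add_comm]
  rfl

namespace SimpleLoop

variable (γ : M.SimpleLoop)

/-- The integral version of `TriangulatedSurface.IsBalanced.exists_eq_add_coboundary` for a simple closed
curve. -/
theorem exists_eq_add_coboundary [Nonempty C] [DecidableEq V] [DecidableEq F]
    [Fintype V] [Fintype F] (hE : Fintype.card C = 6 * Fintype.card V)
    (h : ¬ M.IsNullHomologous γ.chain) {w : C → ℤ}
    (hface : ∀ c, w c + w (M.rot c) + w (M.rot (M.rot c)) = 0)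
    (hvertex : ∀ v, ∑ c, (if M.vertex c = v then w c else 0) = 0)
    (hw : ∑ c, γ.chain c * w c = 0) :
    ∃ (k : ℤ) (φ : C → ℚ), (∀ c, φ (M.flip c) = φ c) ∧
      (∀ c, (w c : ℚ) = k / 2 * (γ.chain (M.rot c) - γ.chain (M.rot (M.rot c))) +
        (φ (M.rot c) - φ (M.rot (M.rot c)))) ∧
      ∀ c, ∃ a : ℤ, φ c - k / 2 * (γ.chain (M.rot c) - γ.chain (M.rot (M.rot c))) = a := by
  obtain ⟨μ, φ, hφ, hμφ⟩ := γ.chain_isBalanced.exists_eq_add_coboundary (w := fun c => (w c : ℚ)) hE h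
    (fun c => by exact_mod_cast hface c) (fun v => by exact_mod_cast hvertex v)
    (by exact_mod_cast hw)
  set κ : C → ℚ := fun c => (γ.chain (M.rot c) : ℚ) - γ.chain (M.rot (M.rot c))
  have hκ : ∀ c, κ (M.flip c) = - κ c := fun c => by
    have := γ.chain_isBalanced c
    simp only [κ]
    exact_mod_cast this
  have hμφ : ∀ c, (w c : ℚ) = μ * κ c + (φ (M.rot c) - φ (M.rot (M.rot c))) := hμφ
  have hκ3 : ∀ c, κ c + κ (M.rot c) + κ (M.rot (M.rot c)) = 0 := fun c => by
    simp only [κ, M.rot_rot_rot]; ring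
  -- Modulo 1, `q c` and `q' c` are attached to the start and the end of the side c. Integrality of
  -- w and symmetry under `flip` make them depend only on the vertex there, which gives a coloring β
  -- with values in ℚ/ℤ and jump 2μ.
  let q : C → AddCircle (1 : ℚ) := fun c => ((φ c + μ * κ c : ℚ) : AddCircle (1 : ℚ))
  let q' : C → AddCircle (1 : ℚ) := fun c => ((φ c - μ * κ c : ℚ) : AddCircle (1 : ℚ))
  have hint : ∀ n : ℤ, (((n : ℚ)) : AddCircle (1 : ℚ)) = 0 := fun n => by
    rw [AddCircle.coe_eq_zero_iff]
    exact ⟨n, by simp⟩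
  have hqq' : ∀ c, q' (M.rot c) = q (M.rot (M.rot c)) := fun c => by
    have h1 : φ (M.rot c) - μ * κ (M.rot c) =
        φ (M.rot (M.rot c)) + μ * κ (M.rot (M.rot c)) + w c := by
      rw [hμφ]
      linear_combination (-μ) * hκ3 c
    simp only [q, q']
    rw [h1, AddCircle.coe_add, hint, add_zero]
  have hqflip : ∀ c, q (M.flip c) = q' c := fun c => by
    simp only [q, q', hφ, hκ, mul_neg, sub_eq_add_neg]
  obtain ⟨β, hβ⟩ := exists_vertex_function (M := M) (fun c => q (M.rot (M.rot c))) (fun c => by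
    rw [M.rot_rot_link, hqflip, hqq'])
  have hβ' : ∀ c, β (M.vertex (M.rot (M.rot c))) = β (M.vertex (M.rot c)) +
      (γ.chain (M.rot (M.rot c)) - γ.chain (M.rot c)) • ((2 * μ : ℚ) : AddCircle (1 : ℚ)) := by
    intro c
    have e1 : q (M.rot (M.rot (M.rot (M.rot c)))) = q' c := by rw [← hqq', M.rot_rot_rot]
    rw [← hβ, ← hβ, e1, M.rot_rot_rot, ← AddCircle.coe_zsmul]
    simp only [q, q']
    rw [← AddCircle.coe_add]
    congr 1
    simp only [κ, zsmul_eq_mul]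
    push_cast
    ring
  -- A nonzero jump would make the loop bound; hence 2μ is an integer.
  have hμ : ((2 * μ : ℚ) : AddCircle (1 : ℚ)) = 0 := by
    by_contra hne
    exact h (γ.isNullHomologous_of_coloring hβ' hne)
  obtain ⟨k, hk⟩ := (AddCircle.coe_eq_zero_iff 1).1 hμ
  have hk : μ = k / 2 := by
    rw [zsmul_eq_mul, mul_one] at hk
    rw [hk]; ring
  have hq' : ∀ c, q' c = q c := by
    intro c
    have := hβ' c
    rwa [hμ, smul_zero, add_zero, ← hβ, ← hβ, ← hqq', M.rot_rot_rot] at this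
  have hqrot : ∀ c, q (M.rot c) = q c := fun c => by
    have := hqq' (M.rot (M.rot c))
    rw [M.rot_rot_rot, hq'] at this
    exact this.symm
  obtain ⟨c₀⟩ := ‹Nonempty C›
  have hconst := eq_of_rot_of_flip hqrot (fun c => (hqflip c).trans (hq' c)) c₀
  -- With 2μ integral the class modulo 1 is the same for all sides, so subtracting one value makes
  -- the potential integral.
  refine ⟨k, fun c => φ c - (φ c₀ + μ * κ c₀), fun c => by simp only [hφ], fun c => ?_, fun c => ?_⟩
  · rw [hμφ c, hk]
    simp only [κ]
    ring
  · have h1 : q' c - q c₀ = 0 := by rw [hq', hconst, sub_self]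
    simp only [q, q'] at h1
    rw [← AddCircle.coe_sub, AddCircle.coe_eq_zero_iff] at h1
    obtain ⟨a, ha⟩ := h1
    refine ⟨a, ?_⟩
    rw [zsmul_eq_mul, mul_one] at ha
    rw [ha, hk]
    simp only [κ]
    ring

end SimpleLoop

end TriangulatedSurface

/-! ### The boundary surface of an ideal triangulation -/

/-- The vertex `x` of the oriented tetrahedron for which `v, w, x` and the fourth vertex form an even
permutation (for `v ≠ w`). -/
def nextVertex (v w : Fin 4) : Fin 4 :=
  (!![0, 2, 3, 1;
      3, 0, 0, 2;
      1, 3, 0, 0;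
      2, 0, 1, 0] : Matrix (Fin 4) (Fin 4) (Fin 4)) v w

theorem nextVertex_ne_left : ∀ v w, v ≠ w → v ≠ nextVertex v w := by decide

theorem nextVertex_ne_right : ∀ v w, v ≠ w → nextVertex v w ≠ w := by decide

theorem nextVertex_nextVertex_nextVertex :
    ∀ v w, v ≠ w → nextVertex v (nextVertex v (nextVertex v w)) = w := by decide

theorem eq_or_eq_nextVertex : ∀ v w x, v ≠ w → v ≠ x →
    x = w ∨ x = nextVertex v w ∨ x = nextVertex v (nextVertex v w) := by decide

theorem oppositePair_nextVertex :
    ∀ v w, v ≠ w → oppositePair v (nextVertex v w) = oppositePair v w + 1 := by decide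

theorem oppositePair_comm : ∀ v w, oppositePair v w = oppositePair w v := by decide

theorem sign_eq_ite (σ : Equiv.Perm (Fin 4)) :
    Equiv.Perm.sign σ = if nextVertex (σ 0) (σ 1) = σ 3 then -1 else 1 := by
  revert σ; decide

theorem nextVertex_apply_eq_iff (σ : Equiv.Perm (Fin 4)) :
    nextVertex (σ 0) (σ 1) = σ 2 ↔ nextVertex (σ 0) (σ 1) ≠ σ 3 := by
  revert σ; decide

/-- An odd gluing reverses the cyclic order around an ideal vertex, as it must across a common face.
-/
theorem nextVertex_of_sign_eq_neg_one (σ : Equiv.Perm (Fin 4)) (hσ : Equiv.Perm.sign σ = -1) :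
    ∀ v w, v ≠ w → nextVertex (σ v) (σ (nextVertex v w)) = σ w := by
  revert σ; decide

theorem exists_perm_eq_nextVertex : ∀ v w : Fin 4, v ≠ w →
    ∃ σ : Equiv.Perm (Fin 4), σ 0 = v ∧ σ 1 = w ∧ σ 2 = nextVertex v w := by decide

namespace Corner

variable {N : ℕ}

/-- Corners as triples. -/
def equivSubtype : Corner N ≃ Fin N × {p : Fin 4 × Fin 4 // p.1 ≠ p.2} where
  toFun c := (c.tet, ⟨(c.v, c.w), c.ne⟩)
  invFun p := ⟨p.1, p.2.1.1, p.2.1.2, p.2.2⟩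
  left_inv _ := rfl
  right_inv _ := rfl

instance : DecidableEq (Corner N) := fun a b =>
  decidable_of_iff (equivSubtype a = equivSubtype b) equivSubtype.injective.eq_iff

instance : Fintype (Corner N) := Fintype.ofEquiv _ equivSubtype.symm

theorem card : Fintype.card (Corner N) = N * 12 := by
  rw [Fintype.card_congr equivSubtype, Fintype.card_prod, Fintype.card_fin]
  rfl

theorem sum_eq {R : Type*} [AddCommMonoid R] (g : Corner N → R) :
    ∑ c, g c = ∑ t, ∑ p : {p : Fin 4 × Fin 4 // p.1 ≠ p.2}, g ⟨t, p.1.1, p.1.2, p.2⟩ := by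
  rw [← Equiv.sum_comp equivSubtype.symm, Fintype.sum_prod_type]
  rfl

/-- The pair of opposite edges to which a corner belongs. -/
def pair (c : Corner N) : Fin 3 := oppositePair c.v c.w

/-- The next corner of the same triangle, in counterclockwise order. -/
def rot (c : Corner N) : Corner N := ⟨c.tet, c.v, nextVertex c.v c.w, nextVertex_ne_left _ _ c.ne⟩

theorem rot_rot_rot (c : Corner N) : c.rot.rot.rot = c := by
  ext
  · rfl
  · rfl
  · exact congrArg Fin.val (nextVertex_nextVertex_nextVertex _ _ c.ne)

theorem face_eq_iff (c d : Corner N) :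
    (c.tet, c.v) = (d.tet, d.v) ↔ d = c ∨ d = c.rot ∨ d = c.rot.rot := by
  constructor
  · intro h
    obtain ⟨h1, h2⟩ := Prod.ext_iff.1 h
    have h1 : c.tet = d.tet := h1
    have h2 : c.v = d.v := h2
    have h3 : c.v ≠ d.w := fun e => d.ne (by rw [← e, h2])
    rcases eq_or_eq_nextVertex c.v c.w d.w c.ne h3 with e | e | e
    · left; ext <;> simp [h1, h2, e]
    · right; left; ext <;> simp [rot, h1, ← h2, e]
    · right; right; ext <;> simp [rot, h1, ← h2, e]
  · rintro (rfl | rfl | rfl) <;> rfl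

end Corner

namespace IdealTriangulation

variable {N : ℕ} (T : IdealTriangulation N)

/-- The side opposite to a corner, seen from the adjacent triangle. -/
def flipCorner (c : Corner N) : Corner N :=
  ⟨T.adj c.tet c.w, T.glue c.tet c.w c.v, T.glue c.tet c.w c.w,
    fun h => c.ne ((T.glue c.tet c.w).injective h)⟩

theorem flipCorner_flipCorner (c : Corner N) : T.flipCorner (T.flipCorner c) = c := by
  have h : T.glue (T.adj c.tet c.w) (T.glue c.tet c.w c.w) = (T.glue c.tet c.w)⁻¹ :=
    T.glue_glue c.tet c.w
  ext
  · exact congrArg Fin.val (T.adj_adj c.tet c.w)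
  · simp only [flipCorner]; rw [h]; simp
  · simp only [flipCorner]; rw [h]; simp

/-- The rotation of the corners at a vertex of the boundary surface. -/
def linkPerm : Equiv.Perm (Corner N) where
  toFun c := (T.flipCorner c.rot).rot
  invFun c := (T.flipCorner c.rot.rot).rot.rot
  left_inv c := by
    beta_reduce
    rw [Corner.rot_rot_rot, flipCorner_flipCorner, Corner.rot_rot_rot]
  right_inv c := by
    beta_reduce
    rw [Corner.rot_rot_rot, flipCorner_flipCorner, Corner.rot_rot_rot]

theorem linkPerm_apply (c : Corner N) : T.linkPerm c = (T.flipCorner c.rot).rot := rfl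

theorem linkPerm_eq (c : Corner N) : T.linkPerm c =
    ⟨T.adj c.tet (nextVertex c.v c.w), T.glue c.tet (nextVertex c.v c.w) c.v,
      T.glue c.tet (nextVertex c.v c.w) c.w,
      fun h => c.ne ((T.glue c.tet (nextVertex c.v c.w)).injective h)⟩ := by
  ext
  · rfl
  · rfl
  · exact congrArg Fin.val (nextVertex_of_sign_eq_neg_one _ (T.sign_glue _ _) _ _ c.ne)

theorem linkRel_linkPerm (c : Corner N) : T.LinkRel c (T.linkPerm c) :=
  ⟨nextVertex c.v c.w, (nextVertex_ne_left _ _ c.ne).symm, nextVertex_ne_right _ _ c.ne, by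
    rw [linkPerm_eq], by rw [linkPerm_eq], by rw [linkPerm_eq]⟩

/-- Only two faces of a tetrahedron contain a given edge; they correspond to the two directions of
rotation around it. -/
theorem eq_linkPerm_of_linkRel {c d : Corner N} (h : T.LinkRel c d) :
    d = T.linkPerm c ∨ c = T.linkPerm d := by
  obtain ⟨f, h1, h2, h3, h4, h5⟩ := h
  rcases eq_or_eq_nextVertex c.v c.w f c.ne h1.symm with e | e | e
  · exact absurd e h2
  · left
    rw [linkPerm_eq, ← e]
    ext <;> simp [h3, h4, h5]
  · right
    have hd : d = (T.flipCorner c.rot.rot).rot.rot := by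
      have h0 : nextVertex (T.glue c.tet f c.v) (T.glue c.tet f f) =
          T.glue c.tet f (nextVertex c.v c.w) := by
        rw [e]
        exact nextVertex_of_sign_eq_neg_one _ (T.sign_glue _ _) _ _ (nextVertex_ne_left _ _ c.ne)
      have h6 : nextVertex (T.glue c.tet f c.v) (T.glue c.tet f (nextVertex c.v c.w)) =
          T.glue c.tet f c.w := nextVertex_of_sign_eq_neg_one _ (T.sign_glue _ _) _ _ c.ne
      ext
      · simp only [flipCorner, Corner.rot, ← e, h3]
      · simp only [flipCorner, Corner.rot, ← e, h4]
      · simp only [flipCorner, Corner.rot, ← e, h0, h5, h6]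
    rw [hd]
    exact (T.linkPerm.apply_symm_apply c).symm

theorem sameCycle_of_vertexOf_eq {c d : Corner N} (h : T.vertexOf c = T.vertexOf d) :
    T.linkPerm.SameCycle c d := by
  have h1 := Quot.eqvGen_exact h
  induction h1 with
  | rel x y hxy =>
    rcases T.eq_linkPerm_of_linkRel hxy with e | e
    · exact ⟨1, by rw [e, zpow_one]⟩
    · exact Equiv.Perm.SameCycle.symm ⟨1, by rw [e, zpow_one]⟩
  | refl x => exact Equiv.Perm.SameCycle.refl _ _
  | symm x y _ ih => exact (ih (Quot.eqvGen_sound ‹_›)).symm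
  | trans x y z _ _ ih1 ih2 =>
    exact (ih1 (Quot.eqvGen_sound ‹_›)).trans (ih2 (Quot.eqvGen_sound ‹_›))

variable {T} in
/-- The boundary surface of an ideal triangulation with one cusp. -/
def boundarySurface (hT : T.IsOneCusped) :
    TriangulatedSurface (Corner N) T.LinkVertex (Fin N × Fin 4) where
  rot := ⟨Corner.rot, fun c => c.rot.rot, Corner.rot_rot_rot, Corner.rot_rot_rot⟩
  flip := ⟨T.flipCorner, T.flipCorner, T.flipCorner_flipCorner, T.flipCorner_flipCorner⟩
  vertex := T.vertexOf
  face c := (c.tet, c.v)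
  rot_rot_rot := Corner.rot_rot_rot
  rot_ne c h := nextVertex_ne_right _ _ c.ne (congrArg Corner.w h)
  flip_flip := T.flipCorner_flipCorner
  flip_ne c h := T.not_self_glued c.tet c.w
    (Prod.ext (congrArg Corner.tet h) (congrArg Corner.w h))
  vertex_surjective := Quot.mk_surjective
  face_surjective p := ⟨⟨p.1, p.2, p.2 + 1, by simp⟩, rfl⟩
  vertex_link c := (Quot.sound (T.linkRel_linkPerm c)).symm
  exists_link c d h := by
    obtain ⟨n, _, hn⟩ := (T.sameCycle_of_vertexOf_eq h).exists_pow_eq'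
    exact ⟨n, by rw [← hn, Equiv.Perm.coe_pow]; rfl⟩
  face_eq_iff := Corner.face_eq_iff
  connected P hrot hflip := by
    -- The property of a triangle that P holds at all of its corners descends to the set of cusps,
    -- which has a single element.
    let Q : Fin N × Fin 4 → Prop := fun x => ∀ c : Corner N, (c.tet, c.v) = x → P c
    have hrot' : ∀ c d : Corner N, (c.tet, c.v) = (d.tet, d.v) → P c → P d := by
      intro c d h hc
      rcases (Corner.face_eq_iff c d).1 h with rfl | rfl | rfl
      · exact hc
      · exact hrot _ hc
      · exact hrot _ (hrot _ hc)
    have hQ : ∀ x y, T.CuspRel x y → Q x = Q y := by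
      rintro ⟨t, v⟩ y ⟨f, hf, rfl⟩
      let c : Corner N := ⟨t, v, f, hf.symm⟩
      refine propext ⟨fun h d hd => ?_, fun h d hd => ?_⟩
      · exact hrot' (T.flipCorner c) d hd.symm (hflip c (h c rfl))
      · refine hrot' c d hd.symm ?_
        rw [← T.flipCorner_flipCorner c]
        exact hflip _ (h _ rfl)
    have hsub : Subsingleton T.Cusp := (Nat.card_eq_one_iff_unique.1 hT.card_cusp).1
    intro c d hc
    have h1 : Quot.lift Q hQ (Quot.mk _ (c.tet, c.v)) = Quot.lift Q hQ (Quot.mk _ (d.tet, d.v)) :=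
      congrArg (Quot.lift Q hQ) (hsub.elim (Quot.mk _ _) (Quot.mk _ _))
    have h2 : Q (c.tet, c.v) = Q (d.tet, d.v) := h1
    have h3 : Q (c.tet, c.v) := fun e he => hrot' c e he.symm hc
    rw [h2] at h3
    exact h3 d rfl

instance : Finite T.LinkVertex := Quot.finite _

instance : Fintype T.LinkVertex := Fintype.ofFinite _

instance : DecidableEq T.LinkVertex := Classical.decEq _

theorem IsOneCusped.card_linkVertex {T : IdealTriangulation N} (hT : T.IsOneCusped) :
    Fintype.card T.LinkVertex = 2 * N := by
  have := hT.euler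
  rw [Nat.card_eq_fintype_card] at this
  omega

theorem IsOneCusped.card_corner {T : IdealTriangulation N} (hT : T.IsOneCusped) :
    Fintype.card (Corner N) = 6 * Fintype.card T.LinkVertex := by
  rw [Corner.card, hT.card_linkVertex]; ring

theorem IsOneCusped.nonempty_corner {T : IdealTriangulation N} (hT : T.IsOneCusped) :
    Nonempty (Corner N) := by
  obtain ⟨x⟩ := (Nat.card_eq_one_iff_unique.1 hT.card_cusp).2
  obtain ⟨⟨t, _⟩, _⟩ := Quot.exists_rep x
  exact ⟨⟨t, 0, 1, by decide⟩⟩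

end IdealTriangulation

/-! ### Curves on the boundary surface -/

/-- The point with barycentric coordinates `1 - a - b`, `a`, `b` with respect to three corners. -/
def planePoint (w n m : Fin 4) (a b : ℝ) : Fin 4 → ℝ :=
  (1 - a - b) • Pi.single w (1 : ℝ) + a • Pi.single n (1 : ℝ) + b • Pi.single m (1 : ℝ)

theorem planePoint_lineMap (w n m : Fin 4) (t a₀ b₀ a₁ b₁ : ℝ) :
    (1 - t) • planePoint w n m a₀ b₀ + t • planePoint w n m a₁ b₁ =
      planePoint w n m ((1 - t) * a₀ + t * a₁) ((1 - t) * b₀ + t * b₁) := by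
  unfold planePoint
  module

/-- A segment that cuts off a corner of a triangle meets every segment with endpoints on both sides
of it. -/
theorem not_disjoint_segment (w n m : Fin 4) {x y a₀ b₀ a₁ b₁ : ℝ} (hx : 0 < x) (hy : 0 < y)
    (ha₀ : 0 ≤ a₀) (hb₀ : 0 ≤ b₀) (ha₁ : 0 ≤ a₁) (hb₁ : 0 ≤ b₁)
    (h0 : a₀ / x + b₀ / y ≤ 1) (h1 : 1 ≤ a₁ / x + b₁ / y) :
    ¬ Disjoint (segment ℝ (planePoint w n m x 0) (planePoint w n m 0 y))
      (segment ℝ (planePoint w n m a₀ b₀) (planePoint w n m a₁ b₁)) := by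
  obtain ⟨t, ht0, ht1, ht⟩ : ∃ t : ℝ, 0 ≤ t ∧ t ≤ 1 ∧
      t * ((1 - (a₀ / x + b₀ / y)) + (a₁ / x + b₁ / y - 1)) = 1 - (a₀ / x + b₀ / y) := by
    set A := 1 - (a₀ / x + b₀ / y) with hA
    set B := a₁ / x + b₁ / y - 1 with hB
    have hA0 : 0 ≤ A := by linarith
    have hB0 : 0 ≤ B := by linarith
    rcases (add_nonneg hA0 hB0).eq_or_lt with h | h
    · exact ⟨0, le_rfl, zero_le_one, by rw [zero_mul]; linarith⟩
    · exact ⟨A / (A + B), div_nonneg hA0 h.le, (div_le_one h).2 (by linarith),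
        div_mul_cancel₀ _ h.ne'⟩
  rw [Set.not_disjoint_iff]
  have ht1' : 0 ≤ 1 - t := by linarith
  set a := (1 - t) * a₀ + t * a₁ with ha
  set b := (1 - t) * b₀ + t * b₁ with hb
  have hab : a / x + b / y = 1 := by
    rw [ha, hb]
    have e : ∀ p q r s : ℝ, ((1 - t) * p + t * q) / x + ((1 - t) * r + t * s) / y =
      (p / x + r / y) + t * ((1 - (p / x + r / y)) + (q / x + s / y - 1)) := by
      intros; ring
    rw [e, ht]; ring
  refine ⟨planePoint w n m a b, ⟨a / x, b / y, by positivity, by positivity, hab, ?_⟩,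
    ⟨1 - t, t, ht1', ht0, by ring, planePoint_lineMap _ _ _ _ _ _ _ _⟩⟩
  have e : a / x = 1 - b / y := by linarith
  have e1 : (1 - b / y) * x = a := by rw [← e]; field_simp
  rw [e, planePoint_lineMap, mul_zero, mul_zero, add_zero, zero_add, e1]
  congr 1
  field_simp

theorem sidePoint_eq_left (w n m : Fin 4) (s : ℝ) : sidePoint w n s = planePoint w n m s 0 := by
  unfold sidePoint planePoint; module

theorem sidePoint_eq_right (w n m : Fin 4) (s : ℝ) : sidePoint w m s = planePoint w n m 0 s := by
  unfold sidePoint planePoint; module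

theorem sidePoint_eq_left' (w n m : Fin 4) (s : ℝ) :
    sidePoint n w s = planePoint w n m (1 - s) 0 := by
  unfold sidePoint planePoint; module

theorem sidePoint_eq_far (w n m : Fin 4) (s : ℝ) :
    sidePoint n m s = planePoint w n m (1 - s) s := by
  unfold sidePoint planePoint; module

/-- If the endpoints were in different orders on the two sides, one segment would separate the
endpoints of the other. -/
theorem nested_of_disjoint {w n m : Fin 4} {x y x' y' : ℝ} (hx : x ∈ Set.Ioo (0 : ℝ) 1)
    (hy : y ∈ Set.Ioo (0 : ℝ) 1) (hx' : x' ∈ Set.Ioo (0 : ℝ) 1) (hy' : y' ∈ Set.Ioo (0 : ℝ) 1)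
    (h : Disjoint (segment ℝ (sidePoint w n x) (sidePoint w m y))
      (segment ℝ (sidePoint w n x') (sidePoint w m y'))) :
    (x < x' ∧ y < y') ∨ (x' < x ∧ y' < y) := by
  rw [sidePoint_eq_left w n m, sidePoint_eq_right w n m, sidePoint_eq_left w n m,
    sidePoint_eq_right w n m] at h
  by_contra hcon
  rcases le_total x x' with hxx | hxx
  · have hyy : y' ≤ y := by
      by_contra hlt
      push Not at hlt
      rcases hxx.eq_or_lt with e | e
      · subst e
        exact not_disjoint_segment w n m hx.1 hy.1 hx'.1.le le_rfl le_rfl hy'.1.le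
          (by rw [div_self hx.1.ne', zero_div, add_zero])
          (by rw [zero_div, zero_add, one_le_div hy.1]; exact hlt.le) h
      · exact hcon (Or.inl ⟨e, hlt⟩)
    exact not_disjoint_segment w n m hx'.1 hy'.1 hx.1.le le_rfl le_rfl hy.1.le
      (by rw [zero_div, add_zero, div_le_one hx'.1]; exact hxx)
      (by rw [zero_div, zero_add, one_le_div hy'.1]; exact hyy) h.symm
  · have hyy : y ≤ y' := by
      by_contra hlt
      push Not at hlt
      rcases hxx.eq_or_lt with e | e
      · subst e
        exact not_disjoint_segment w n m hx'.1 hy'.1 hx.1.le le_rfl le_rfl hy.1.le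
          (by rw [div_self hx.1.ne', zero_div, add_zero])
          (by rw [zero_div, zero_add, one_le_div hy'.1]; exact hlt.le) h.symm
      · exact hcon (Or.inr ⟨e, hlt⟩)
    exact not_disjoint_segment w n m hx.1 hy.1 hx'.1.le le_rfl le_rfl hy'.1.le
      (by rw [zero_div, add_zero, div_le_one hx.1]; exact hxx)
      (by rw [zero_div, zero_add, one_le_div hy.1]; exact hyy) h

/-- If the endpoints on the common side were in the wrong order, the first segment would separate
the endpoints of the second. -/
theorem add_lt_one_of_disjoint {w n m : Fin 4} {x y x' y' : ℝ} (hx : x ∈ Set.Ioo (0 : ℝ) 1)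
    (hy : y ∈ Set.Ioo (0 : ℝ) 1) (hx' : x' ∈ Set.Ioo (0 : ℝ) 1) (hy' : y' ∈ Set.Ioo (0 : ℝ) 1)
    (h : Disjoint (segment ℝ (sidePoint w n x) (sidePoint w m y))
      (segment ℝ (sidePoint n w y') (sidePoint n m x'))) :
    x + y' < 1 := by
  rw [sidePoint_eq_left w n m, sidePoint_eq_right w n m, sidePoint_eq_left' w n m,
    sidePoint_eq_far w n m] at h
  by_contra hcon
  push Not at hcon
  refine not_disjoint_segment w n m hx.1 hy.1 (by linarith [hy'.2]) le_rfl (by linarith [hx'.2])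
    hx'.1.le ?_ ?_ h
  · rw [zero_div, add_zero, div_le_one hx.1]; linarith
  · have h1 : 1 - x' ≤ (1 - x') / x := by
      rw [le_div_iff₀ hx.1]
      nlinarith [hx.2, hx'.2]
    have h2 : x' ≤ x' / y := by
      rw [le_div_iff₀ hy.1]
      nlinarith [hy.2, hx'.1]
    linarith

theorem perm_facts (p : Equiv.Perm (Fin 4)) :
    (nextVertex (p 0) (p 1) = p 3 → nextVertex (p 0) (p 3) = p 2 ∧ nextVertex (p 0) (p 2) = p 1) ∧
    (nextVertex (p 0) (p 1) = p 2 → nextVertex (p 0) (p 2) = p 3 ∧ nextVertex (p 0) (p 3) = p 1) := by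
  revert p; decide

theorem nextVertex_eq_or (p : Equiv.Perm (Fin 4)) :
    nextVertex (p 0) (p 1) = p 3 ∨ nextVertex (p 0) (p 1) = p 2 := by
  revert p; decide

namespace IdealTriangulation

variable {N : ℕ} {T : IdealTriangulation N} (hT : T.IsOneCusped)

namespace PeripheralCurve

variable (γ : T.PeripheralCurve)

/-- The corner that an arc cuts off. -/
def cornerAt (i : Fin (γ.n + 1)) : Corner N :=
  ⟨γ.tet i, γ.flag i 0, γ.flag i 1, fun h => by simpa using (γ.flag i).injective h⟩

/-- An arc turns counterclockwise around its corner. -/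
def turnsLeft (i : Fin (γ.n + 1)) : Bool := decide (nextVertex (γ.flag i 0) (γ.flag i 1) = γ.flag i 3)

theorem turnsLeft_eq_true {i : Fin (γ.n + 1)} :
    γ.turnsLeft i = true ↔ nextVertex (γ.flag i 0) (γ.flag i 1) = γ.flag i 3 := by
  simp [turnsLeft]

theorem turnsLeft_eq_false {i : Fin (γ.n + 1)} :
    γ.turnsLeft i = false ↔ nextVertex (γ.flag i 0) (γ.flag i 1) = γ.flag i 2 := by
  simp [turnsLeft, nextVertex_apply_eq_iff]

theorem neg_sign_eq (i : Fin (γ.n + 1)) :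
    -((Equiv.Perm.sign (γ.flag i) : ℤˣ) : ℤ) = if γ.turnsLeft i then 1 else -1 := by
  rw [sign_eq_ite]
  simp only [turnsLeft, decide_eq_true_eq]
  split_ifs <;> simp

theorem exitCorner (i : Fin (γ.n + 1)) :
    (if γ.turnsLeft i then (γ.cornerAt i).rot else (γ.cornerAt i).rot.rot) =
      ⟨γ.tet i, γ.flag i 0, γ.flag i 3, fun h => by simpa using (γ.flag i).injective h⟩ := by
  have h0 := perm_facts (γ.flag i)
  split_ifs with h
  · rw [turnsLeft_eq_true] at h
    ext <;> simp [cornerAt, Corner.rot, h]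
  · rw [Bool.not_eq_true, turnsLeft_eq_false] at h
    ext <;> simp [cornerAt, Corner.rot, h, h0.2 h]

theorem entryCorner (i : Fin (γ.n + 1)) :
    (if γ.turnsLeft i then (γ.cornerAt i).rot.rot else (γ.cornerAt i).rot) =
      ⟨γ.tet i, γ.flag i 0, γ.flag i 2, fun h => by simpa using (γ.flag i).injective h⟩ := by
  have h0 := perm_facts (γ.flag i)
  split_ifs with h
  · rw [turnsLeft_eq_true] at h
    ext <;> simp [cornerAt, Corner.rot, h, h0.1 h]
  · rw [Bool.not_eq_true, turnsLeft_eq_false] at h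
    ext <;> simp [cornerAt, Corner.rot, h]

/-- The distance of the endpoint of an arc on the side towards the next corner. -/
def distPrev (i : Fin (γ.n + 1)) : ℝ := if γ.turnsLeft i then γ.entryParam i else γ.exitParam i

/-- The distance of the endpoint of an arc on the side towards the previous corner. -/
def distNext (i : Fin (γ.n + 1)) : ℝ := if γ.turnsLeft i then γ.exitParam i else γ.entryParam i

theorem distPrev_mem (i : Fin (γ.n + 1)) : γ.distPrev i ∈ Set.Ioo (0 : ℝ) 1 := by
  unfold distPrev
  split_ifs
  · exact γ.entryParam_mem i
  · exact γ.exitParam_mem i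

theorem distNext_mem (i : Fin (γ.n + 1)) : γ.distNext i ∈ Set.Ioo (0 : ℝ) 1 := by
  unfold distNext
  split_ifs
  · exact γ.exitParam_mem i
  · exact γ.entryParam_mem i

theorem segment_eq (i : Fin (γ.n + 1)) :
    segment ℝ (sidePoint (γ.flag i 1) (γ.flag i 3) (γ.entryParam i))
        (sidePoint (γ.flag i 1) (γ.flag i 2) (γ.exitParam i)) =
      segment ℝ (sidePoint (γ.cornerAt i).w (γ.cornerAt i).rot.w (γ.distPrev i))
        (sidePoint (γ.cornerAt i).w (γ.cornerAt i).rot.rot.w (γ.distNext i)) := by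
  have h0 := perm_facts (γ.flag i)
  unfold distPrev distNext
  rcases Bool.eq_false_or_eq_true (γ.turnsLeft i) with h | h
  · have h' := γ.turnsLeft_eq_true.1 h
    simp only [h, if_true, cornerAt, Corner.rot, h', h0.1 h']
  · have h' := γ.turnsLeft_eq_false.1 h
    simp only [h, cornerAt, Corner.rot, h', h0.2 h', Bool.false_eq_true, if_false]
    exact segment_symm _ _ _

theorem sidePoint_apply_left {w b : Fin 4} (h : w ≠ b) (s : ℝ) : sidePoint w b s w = 1 - s := by
  simp [sidePoint, h]

theorem sidePoint_apply_right {w b : Fin 4} (h : w ≠ b) (s : ℝ) : sidePoint w b s b = s := by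
  simp [sidePoint, h.symm]

theorem flag_one_succ (i : Fin (γ.n + 1)) :
    (γ.flag (i + 1) 1 = T.glue (γ.tet i) (γ.flag i 3) (γ.flag i 1) ∧
      γ.flag (i + 1) 3 = T.glue (γ.tet i) (γ.flag i 3) (γ.flag i 2)) ∨
    (γ.flag (i + 1) 3 = T.glue (γ.tet i) (γ.flag i 3) (γ.flag i 1) ∧
      γ.flag (i + 1) 1 = T.glue (γ.tet i) (γ.flag i 3) (γ.flag i 2)) := by
  have key : ∀ p q : Equiv.Perm (Fin 4), q 0 = p 0 → q 2 = p 3 →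
      (q 1 = p 1 ∧ q 3 = p 2) ∨ (q 3 = p 1 ∧ q 1 = p 2) := by
    intro p q h0 h2
    have hq : ∀ a, a = q 0 ∨ a = q 1 ∨ a = q 2 ∨ a = q 3 := by
      intro a
      obtain ⟨b, rfl⟩ := q.surjective a
      fin_cases b <;> simp
    have e1 : p 1 ≠ p 0 := fun h => by simpa using p.injective h
    have e2 : p 1 ≠ p 3 := fun h => by simpa using p.injective h
    have e3 : p 2 ≠ p 0 := fun h => by simpa using p.injective h
    have e4 : p 2 ≠ p 3 := fun h => by simpa using p.injective h
    have e5 : p 1 ≠ p 2 := fun h => by simpa using p.injective h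
    rcases hq (p 1) with h | h | h | h <;> rcases hq (p 2) with h' | h' | h' | h' <;>
      simp_all
  exact key ((γ.flag i).trans (T.glue (γ.tet i) (γ.flag i 3))) (γ.flag (i + 1))
    (γ.flag_zero_succ i) (γ.flag_two_succ i)

/-- A single barycentric coordinate of the matching point suffices. The next arc cuts off either the
matched corner, turning the same way, or the other end of the side, turning the opposite way and
with parameter 1 - s. -/
theorem param_succ (i : Fin (γ.n + 1)) :
    (if γ.turnsLeft (i + 1) then γ.entryParam (i + 1) else 1 - γ.entryParam (i + 1)) =
      if γ.turnsLeft i then γ.exitParam i else 1 - γ.exitParam i := by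
  have hp := γ.point_succ i (γ.flag i 1)
  have hne : γ.flag (i + 1) 1 ≠ γ.flag (i + 1) 3 := fun h => by
    simpa using (γ.flag (i + 1)).injective h
  have hne' : γ.flag i 1 ≠ γ.flag i 2 := fun h => by simpa using (γ.flag i).injective h
  have h13 : γ.flag i 0 ≠ γ.flag i 3 := fun h => by simpa using (γ.flag i).injective h
  have h12 : γ.flag i 0 ≠ γ.flag i 2 := fun h => by simpa using (γ.flag i).injective h
  have h11 : γ.flag i 0 ≠ γ.flag i 1 := fun h => by simpa using (γ.flag i).injective h
  have hg := nextVertex_of_sign_eq_neg_one _ (T.sign_glue (γ.tet i) (γ.flag i 3))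
  have h0 := perm_facts (γ.flag i)
  rw [sidePoint_apply_left hne'] at hp
  rcases γ.flag_one_succ i with ⟨h1, h3⟩ | ⟨h3, h1⟩
  · rw [← h1, sidePoint_apply_left hne] at hp
    have ht : γ.turnsLeft (i + 1) = γ.turnsLeft i := by
      rcases Bool.eq_false_or_eq_true (γ.turnsLeft i) with h | h
      · rw [h, turnsLeft_eq_true, γ.flag_zero_succ, h1, h3]
        have := hg _ _ h12
        rwa [(h0.1 (γ.turnsLeft_eq_true.1 h)).2] at this
      · rw [h, turnsLeft_eq_false, γ.flag_zero_succ, h1, γ.flag_two_succ]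
        have := hg _ _ h13
        rwa [(h0.2 (γ.turnsLeft_eq_false.1 h)).2] at this
    rw [ht]
    split_ifs <;> linarith
  · rw [← h3, sidePoint_apply_right hne] at hp
    have ht : γ.turnsLeft (i + 1) = !γ.turnsLeft i := by
      rcases Bool.eq_false_or_eq_true (γ.turnsLeft i) with h | h
      · rw [h, Bool.not_true, turnsLeft_eq_false, γ.flag_zero_succ, h1, γ.flag_two_succ]
        have := hg _ _ h13
        rwa [(h0.1 (γ.turnsLeft_eq_true.1 h)).1] at this
      · rw [h, Bool.not_false, turnsLeft_eq_true, γ.flag_zero_succ, h1, h3]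
        have := hg _ _ h11
        rwa [γ.turnsLeft_eq_false.1 h] at this
    rw [ht]
    rcases Bool.eq_false_or_eq_true (γ.turnsLeft i) with h | h <;> simp [h] <;> linarith

/-- A simple closed curve on the boundary surface as a simple loop of the triangulated surface. -/
def toSimpleLoop : (boundarySurface hT).SimpleLoop where
  corner i := γ.cornerAt (Fin.ofNat _ i)
  ccw i := γ.turnsLeft (Fin.ofNat _ i)
  step i := by
    have hi : Fin.ofNat (γ.n + 1) (i + 1) = Fin.ofNat (γ.n + 1) i + 1 := by
      ext; simp [Fin.val_add]
    rw [hi]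
    refine (γ.entryCorner _).trans (Eq.trans ?_ (congrArg T.flipCorner (γ.exitCorner _)).symm)
    ext
    · exact congrArg Fin.val (γ.tet_succ _)
    · exact congrArg Fin.val (γ.flag_zero_succ _)
    · exact congrArg Fin.val (γ.flag_two_succ _)
  length := γ.n + 1
  corner_add i := congrArg γ.cornerAt (by ext; simp)
  ccw_add i := congrArg γ.turnsLeft (by ext; simp)
  distPrev i := γ.distPrev (Fin.ofNat _ i)
  distNext i := γ.distNext (Fin.ofNat _ i)
  distPrev_add i := congrArg γ.distPrev (by ext; simp)
  distNext_add i := congrArg γ.distNext (by ext; simp)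
  distPrev_mem i := γ.distPrev_mem _
  distNext_mem i := γ.distNext_mem _
  pos_step i := by
    have hi : Fin.ofNat (γ.n + 1) (i + 1) = Fin.ofNat (γ.n + 1) i + 1 := by
      ext; simp [Fin.val_add]
    have := γ.param_succ (Fin.ofNat _ i)
    rw [hi]
    unfold distPrev distNext
    split_ifs at this ⊢ <;> linarith
  nested i j hij h := by
    have hne : Fin.ofNat (γ.n + 1) i ≠ Fin.ofNat (γ.n + 1) j := fun e => hij (by
      simpa using congrArg Fin.val e)
    have hd := γ.simple _ _ hne (congrArg Corner.tet h) (congrArg Corner.v h)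
    rw [segment_eq, segment_eq, ← h] at hd
    exact nested_of_disjoint (γ.distPrev_mem _) (γ.distNext_mem _) (γ.distPrev_mem _)
      (γ.distNext_mem _) hd
  noncrossing i j hij h := by
    have hne : Fin.ofNat (γ.n + 1) i ≠ Fin.ofNat (γ.n + 1) j := fun e => hij (by
      simpa using congrArg Fin.val e)
    have h : γ.cornerAt (Fin.ofNat _ j) = (γ.cornerAt (Fin.ofNat _ i)).rot := h
    have hd := γ.simple _ _ hne (congrArg Corner.tet h).symm (congrArg Corner.v h).symm
    rw [segment_eq, segment_eq, h, Corner.rot_rot_rot, segment_symm _ (sidePoint (γ.cornerAt _).rot.w _ _)] at hd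
    exact add_lt_one_of_disjoint (γ.distPrev_mem _) (γ.distNext_mem _) (γ.distPrev_mem _)
      (γ.distNext_mem _) hd

/-- The normal chain of a curve. -/
def chain (c : Corner N) : ℤ :=
  ∑ s, if γ.cornerAt s = c then -((Equiv.Perm.sign (γ.flag s) : ℤˣ) : ℤ) else 0

theorem toSimpleLoop_chain (c : Corner N) : (γ.toSimpleLoop hT).chain c = γ.chain c := by
  unfold TriangulatedSurface.SimpleLoop.chain chain
  rw [show (γ.toSimpleLoop hT).length = γ.n + 1 from rfl, Finset.sum_range]
  refine Finset.sum_congr rfl fun s _ => ?_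
  rw [neg_sign_eq]
  have : Fin.ofNat (γ.n + 1) s = s := by ext; simp
  simp only [toSimpleLoop, TriangulatedSurface.NormalPath.sign, this]

theorem gluing_eq (i : Fin N) (k : Fin 3) :
    γ.gluing i k = ∑ c : Corner N, if c.tet = i ∧ c.pair = k then γ.chain c else 0 := by
  symm
  unfold gluing chain
  rw [← Finset.sum_filter, Finset.sum_comm]
  refine Finset.sum_congr rfl fun s _ => ?_
  rw [Finset.sum_ite_eq]
  simp only [Finset.mem_filter, Finset.mem_univ, true_and]
  rfl

include hT in
theorem chain_sub_chain_eq (c : Corner N) : γ.chain c.rot.rot - γ.chain c.rot =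
    ∑ s, ((if γ.tet s = c.tet ∧ γ.flag s 0 = c.v ∧ γ.flag s 3 = c.w then 1 else 0) -
      (if γ.tet s = c.tet ∧ γ.flag s 0 = c.v ∧ γ.flag s 2 = c.w then 1 else 0)) := by
  have h := (γ.toSimpleLoop hT).chain_flux c
  rw [toSimpleLoop_chain, toSimpleLoop_chain, show (γ.toSimpleLoop hT).length = γ.n + 1 from rfl,
    Finset.sum_range] at h
  refine h.trans (Finset.sum_congr rfl fun s _ => ?_)
  have hs : Fin.ofNat (γ.n + 1) s = s := by ext; simp
  have h1 : (γ.toSimpleLoop hT).exit s = _ := γ.exitCorner (Fin.ofNat (γ.n + 1) s)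
  have h2 : (γ.toSimpleLoop hT).entry s = _ := γ.entryCorner (Fin.ofNat (γ.n + 1) s)
  rw [h1, h2, hs]
  simp only [Corner.ext_iff (y := c)]

-- The flux through a side is the difference of the chain at its endpoints; this makes the crossing
-- cochain the dual of the normal chain.
include hT in
theorem crossing_eq (t : Fin N) (σ : Equiv.Perm (Fin 4)) : γ.crossing t σ =
    γ.chain ⟨t, σ 0, σ 2, by simp⟩ - γ.chain ⟨t, σ 0, σ 1, by simp⟩ := by
  have h := γ.chain_sub_chain_eq hT ⟨t, σ 0, σ 3, by simp⟩
  rw [Finset.sum_sub_distrib] at h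
  unfold crossing
  simp only [Nat.card_eq_fintype_card, Fintype.card_subtype, Finset.card_filter, Nat.cast_sum,
    Nat.cast_ite, Nat.cast_one, Nat.cast_zero]
  rw [← h, sign_eq_ite]
  have h0 := perm_facts σ
  rcases nextVertex_eq_or σ with e | e
  · have e1 : (⟨t, σ 0, σ 3, by simp⟩ : Corner N).rot = ⟨t, σ 0, σ 2, by simp⟩ := by
      ext <;> simp [Corner.rot, (h0.1 e)]
    have e2 : (⟨t, σ 0, σ 2, by simp⟩ : Corner N).rot = ⟨t, σ 0, σ 1, by simp⟩ := by
      ext <;> simp [Corner.rot, (h0.1 e)]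
    rw [e1, e2, if_pos e]; simp
  · have e1 : (⟨t, σ 0, σ 3, by simp⟩ : Corner N).rot = ⟨t, σ 0, σ 1, by simp⟩ := by
      ext <;> simp [Corner.rot, (h0.2 e)]
    have e2 : (⟨t, σ 0, σ 1, by simp⟩ : Corner N).rot = ⟨t, σ 0, σ 2, by simp⟩ := by
      ext <;> simp [Corner.rot, e]
    rw [e1, e2, if_neg ((nextVertex_apply_eq_iff σ).1 e)]; simp

end PeripheralCurve

/-- Consecutive corners of a triangle already determine all differences, so directed sides of either
orientation impose the same condition. -/
theorem isCoboundary_iff (m : Corner N → ℤ) :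
    T.IsCoboundary (fun t σ => m ⟨t, σ 0, σ 2, by simp⟩ - m ⟨t, σ 0, σ 1, by simp⟩) ↔
      (boundarySurface hT).IsNullHomologous m := by
  constructor
  · rintro ⟨B, hB⟩
    refine ⟨B, fun ⟨t, v, w, hvw⟩ => ?_⟩
    obtain ⟨σ, rfl, rfl, h⟩ := exists_perm_eq_nextVertex v w hvw
    have := hB t σ
    simp only [h] at this
    exact this
  · rintro ⟨B, hB⟩
    refine ⟨B, fun t σ => ?_⟩
    have h1 : ∀ c d : Corner N, (c.tet, c.v) = (d.tet, d.v) →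
        m d - B (T.vertexOf d) = m c - B (T.vertexOf c) := by
      intro c d h
      have h2 : m c.rot - m c = B (T.vertexOf c.rot) - B (T.vertexOf c) := hB c
      have h3 : m c.rot.rot - m c.rot = B (T.vertexOf c.rot.rot) - B (T.vertexOf c.rot) :=
        hB c.rot
      rcases (Corner.face_eq_iff c d).1 h with rfl | rfl | rfl <;> linarith
    have h2 := h1 ⟨t, σ 0, σ 1, by simp⟩ ⟨t, σ 0, σ 2, by simp⟩ rfl
    linarith

theorem PeripheralCurve.IsEssential.not_isNullHomologous {γ : T.PeripheralCurve}
    (h : γ.IsEssential) : ¬ (boundarySurface hT).IsNullHomologous (γ.toSimpleLoop hT).chain := by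
  rw [show (γ.toSimpleLoop hT).chain = γ.chain from funext (γ.toSimpleLoop_chain hT),
    ← isCoboundary_iff]
  simp only [← γ.crossing_eq hT]
  exact h

theorem PeripheralCurve.SameSlope.exists_isNullHomologous {γ δ : T.PeripheralCurve}
    (h : γ.SameSlope δ) : ∃ ε : ℤ, (ε = 1 ∨ ε = -1) ∧
      (boundarySurface hT).IsNullHomologous (fun c => γ.chain c - ε * δ.chain c) := by
  rcases h with h | h
  · refine ⟨1, Or.inl rfl, (isCoboundary_iff hT _).1 ?_⟩
    simp only [γ.crossing_eq hT, δ.crossing_eq hT] at h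
    convert h using 3
    ring
  · refine ⟨-1, Or.inr rfl, (isCoboundary_iff hT _).1 ?_⟩
    simp only [γ.crossing_eq hT, δ.crossing_eq hT] at h
    convert h using 3
    ring

end IdealTriangulation

/-! ### Edges and their ends -/

namespace Corner

variable {N : ℕ}

/-- The other end of the same edge of a tetrahedron. -/
def rev : Corner N ≃ Corner N where
  toFun c := ⟨c.tet, c.w, c.v, c.ne.symm⟩
  invFun c := ⟨c.tet, c.w, c.v, c.ne.symm⟩
  left_inv _ := rfl
  right_inv _ := rfl

theorem rev_rev (c : Corner N) : c.rev.rev = c := rfl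

theorem pair_rev (c : Corner N) : c.rev.pair = c.pair := oppositePair_comm _ _

theorem pair_rot (c : Corner N) : c.rot.pair = c.pair + 1 := oppositePair_nextVertex _ _ c.ne

theorem sum_tet_pair {R : Type*} [AddCommMonoid R] (g : Corner N → R) (i : Fin N) (k : Fin 3) :
    ∑ c, (if c.tet = i ∧ c.pair = k then g c else 0) =
      ∑ p : {p : Fin 4 × Fin 4 // p.1 ≠ p.2},
        if oppositePair p.1.1 p.1.2 = k then g ⟨i, p.1.1, p.1.2, p.2⟩ else 0 := by
  rw [sum_eq, Finset.sum_eq_single_of_mem i (Finset.mem_univ _)]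
  · simp [pair]
  · intro t _ ht
    simp [ht]

theorem sum_sum_mul {R : Type*} [CommRing R] (m : Corner N → R) (g : Fin N → Fin 3 → R) :
    ∑ i, ∑ k, (∑ c, if c.tet = i ∧ c.pair = k then m c else 0) * g i k =
      ∑ c, m c * g c.tet c.pair := by
  simp only [Finset.sum_mul]
  have h : ∀ i, ∑ k, ∑ c : Corner N, (if c.tet = i ∧ c.pair = k then m c else 0) * g i k =
      ∑ c : Corner N, if c.tet = i then m c * g c.tet c.pair else 0 := by
    intro i
    rw [Finset.sum_comm]
    refine Finset.sum_congr rfl fun c _ => ?_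
    rw [Finset.sum_eq_single_of_mem c.pair (Finset.mem_univ _)]
    · by_cases hc : c.tet = i
      · subst hc; simp
      · simp [hc]
    · intro k _ hk
      simp [hk.symm]
  simp only [h]
  rw [Finset.sum_comm]
  simp

/-- The sum over the corners of an opposite pair is a sum over its two edges. -/
theorem sum_eq_sum_lt {R : Type*} [AddCommMonoid R] (g : Corner N → R) (P : Corner N → Prop)
    [DecidablePred P] (hP : ∀ c, P c.rev ↔ P c) :
    ∑ c, (if P c then g c else 0) = ∑ c : Corner N, if c.v < c.w ∧ P c then g c + g c.rev else 0 := by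
  have h1 : ∀ c : Corner N, (if c.v < c.w ∧ P c then g c + g c.rev else 0) =
      (if c.v < c.w ∧ P c then g c else 0) + (if c.v < c.w ∧ P c then g c.rev else 0) := by
    intro c; split_ifs <;> simp
  simp only [h1]
  rw [Finset.sum_add_distrib,
    ← Equiv.sum_comp rev (fun c => if c.v < c.w ∧ P c then g c.rev else 0),
    ← Finset.sum_add_distrib]
  refine Finset.sum_congr rfl fun c _ => ?_
  have hc := c.ne
  simp only [hP, rev_rev]
  change _ = _ + if c.w < c.v ∧ P c then g c else 0
  rcases lt_or_gt_of_ne hc with h | h <;> simp [h, h.not_gt]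

end Corner

namespace IdealTriangulation

variable {N : ℕ} {T : IdealTriangulation N}

theorem LinkRel.rev {c d : Corner N} (h : T.LinkRel c d) : T.LinkRel c.rev d.rev := by
  obtain ⟨f, h1, h2, h3, h4, h5⟩ := h
  exact ⟨f, h2, h1, h3, h5, h4⟩

theorem vertexOf_rev_eq {c d : Corner N} (h : T.vertexOf c = T.vertexOf d) :
    T.vertexOf c.rev = T.vertexOf d.rev := by
  have := congrArg (Quot.map (ra := T.LinkRel) (rb := T.LinkRel) Corner.rev
    fun _ _ h => LinkRel.rev h) h
  exact this

theorem edgeOf_eq_iff {c d : Corner N} :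
    T.edgeOf c = T.edgeOf d ↔ T.vertexOf d = T.vertexOf c ∨ T.vertexOf d = T.vertexOf c.rev := by
  constructor
  · intro h
    have h1 := Quot.eqvGen_exact h
    clear h
    induction h1 with
    | rel x y hxy =>
      rcases hxy with h | ⟨h1, h2, h3⟩
      · exact Or.inl (Quot.sound h).symm
      · right
        congr 1
        ext
        · exact congrArg Fin.val h1
        · exact congrArg Fin.val h2
        · exact congrArg Fin.val h3
    | refl x => exact Or.inl rfl
    | symm x y _ ih =>
      rcases ih with h | h
      · exact Or.inl h.symm
      · exact Or.inr (vertexOf_rev_eq h).symm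
    | trans x y z _ _ ih1 ih2 =>
      rcases ih1 with h | h <;> rcases ih2 with h' | h'
      · exact Or.inl (h'.trans h)
      · exact Or.inr (h'.trans (vertexOf_rev_eq h))
      · exact Or.inr (h'.trans h)
      · exact Or.inl (h'.trans (vertexOf_rev_eq h))
  · have h0 : ∀ x y, T.vertexOf x = T.vertexOf y → T.edgeOf x = T.edgeOf y := by
      intro x y h
      exact congrArg (Quot.map (ra := T.LinkRel)
        (rb := fun c d : Corner N => T.LinkRel c d ∨ (d.tet = c.tet ∧ d.v = c.w ∧ d.w = c.v))
        id fun _ _ h => Or.inl h) h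
    rintro (h | h)
    · exact (h0 _ _ h).symm
    · rw [h0 _ _ h]
      exact Quot.sound (Or.inr ⟨rfl, rfl, rfl⟩)

instance : Finite T.Edge := Quot.finite _

instance : Fintype T.Edge := Fintype.ofFinite _

instance : DecidableEq T.Edge := Classical.decEq _

theorem edgeOf_surjective : Function.Surjective T.edgeOf := Quot.mk_surjective

/-- If the Euler characteristics fit, then the two ends of an edge are different vertices of the
boundary surface. -/
theorem IsOneCusped.vertexOf_rev_ne (hT : T.IsOneCusped) (hE : Fintype.card T.Edge = N)
    (c : Corner N) : T.vertexOf c.rev ≠ T.vertexOf c := by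
  intro hc
  choose s hs using fun x : T.LinkVertex => Quot.exists_rep x
  have hs : ∀ x, T.vertexOf (s x) = x := hs
  let e : T.LinkVertex → T.Edge := fun x => T.edgeOf (s x)
  have h1 := Finset.card_eq_sum_card_fiberwise (f := e) (s := Finset.univ) (t := Finset.univ)
    (by intro x _; simp)
  have hfib : ∀ I d, T.edgeOf d = I →
      (Finset.univ.filter fun x => e x = I) ⊆ {T.vertexOf d, T.vertexOf d.rev} := by
    intro I d hd x hx
    have hx := (Finset.mem_filter.1 hx).2
    have := edgeOf_eq_iff.1 (hd.trans hx.symm)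
    rw [hs] at this
    simpa using this
  -- There are 2N ends and N edges, each with at most two ends; an edge with a single end would
  -- leave too few.
  have h2 : ∑ I : T.Edge, (Finset.univ.filter fun x => e x = I).card < ∑ _I : T.Edge, 2 := by
    refine Finset.sum_lt_sum (fun I _ => ?_) ⟨T.edgeOf c, Finset.mem_univ _, ?_⟩
    · obtain ⟨d, hd⟩ := edgeOf_surjective I
      exact (Finset.card_le_card (hfib I d hd)).trans Finset.card_le_two
    · refine (Finset.card_le_card (hfib _ c rfl)).trans_lt ?_
      rw [hc]; simp
  rw [Finset.sum_const, Finset.card_univ, hE, ← h1, Finset.card_univ, hT.card_linkVertex] at h2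
  simp at h2
  omega

theorem edgeGluing_eq_sum (I : T.Edge) (i : Fin N) (k : Fin 3) : T.edgeGluing I i k =
    ∑ c : Corner N, if c.v < c.w ∧ c.tet = i ∧ c.pair = k ∧ T.edgeOf c = I then 1 else 0 := by
  unfold edgeGluing
  rw [Nat.card_eq_fintype_card, Fintype.card_subtype, Finset.card_filter]
  push_cast
  refine Finset.sum_congr rfl fun c _ => if_congr ?_ rfl rfl
  unfold Corner.pair
  tauto

/-- As the ends of an edge are distinct, each incident edge of a tetrahedron has exactly one of its
two corners at the chosen end. -/
theorem IsOneCusped.edgeGluing_eq (hT : T.IsOneCusped) (hE : Fintype.card T.Edge = N)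
    (d : Corner N) (i : Fin N) (k : Fin 3) : T.edgeGluing (T.edgeOf d) i k =
      ∑ c : Corner N, if c.tet = i ∧ c.pair = k then
        (if T.vertexOf c = T.vertexOf d then 1 else 0) else 0 := by
  rw [edgeGluing_eq_sum]
  refine Eq.trans ?_ (Corner.sum_eq_sum_lt _ (fun c => c.tet = i ∧ c.pair = k)
    fun c => by rw [Corner.pair_rev]; rfl).symm
  refine Finset.sum_congr rfl fun c _ => ?_
  have h1 : T.vertexOf c.rev = T.vertexOf d ↔ T.vertexOf c = T.vertexOf d.rev :=
    ⟨fun h => vertexOf_rev_eq h, fun h => vertexOf_rev_eq h⟩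
  have h2 := hT.vertexOf_rev_ne hE d
  have h3 : T.edgeOf c = T.edgeOf d ↔ T.vertexOf c = T.vertexOf d ∨ T.vertexOf c = T.vertexOf d.rev := by
    rw [eq_comm, edgeOf_eq_iff]
  simp only [h1, h3]
  by_cases h4 : T.vertexOf c = T.vertexOf d
  · have h5 : T.vertexOf c ≠ T.vertexOf d.rev := by rw [h4]; exact h2.symm
    simp [h4, h2.symm, ← and_assoc]
  · by_cases h5 : T.vertexOf c = T.vertexOf d.rev <;> simp [h4, h5, h2, ← and_assoc]

/-- The gluing coefficients of a combination of edges. -/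
theorem sum_mul_edgeGluing {R : Type*} [CommRing R] (C : T.Edge → R) (i : Fin N) (k : Fin 3) :
    ∑ I, C I * (T.edgeGluing I i k : R) =
      ∑ c : Corner N, if c.v < c.w ∧ c.tet = i ∧ c.pair = k then C (T.edgeOf c) else 0 := by
  simp only [edgeGluing_eq_sum, Int.cast_sum, Finset.mul_sum]
  rw [Finset.sum_comm]
  refine Finset.sum_congr rfl fun c _ => ?_
  rw [Finset.sum_eq_single_of_mem (T.edgeOf c) (Finset.mem_univ _)]
  · simp
  · intro I _ hI
    simp [hI.symm]

/-- The gluing coefficients of a combination of vertices of the boundary surface. -/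
theorem sum_vertex_eq_sum_edge (B : T.LinkVertex → ℤ) : ∃ C : T.Edge → ℤ, ∀ i k,
    ∑ c : Corner N, (if c.tet = i ∧ c.pair = k then B (T.vertexOf c) else 0) =
      ∑ I, C I * T.edgeGluing I i k := by
  let C : T.Edge → ℤ := Quot.lift (fun c : Corner N => B (T.vertexOf c) + B (T.vertexOf c.rev)) (by
    rintro c d (h | ⟨h1, h2, h3⟩)
    · have h1 : T.vertexOf c = T.vertexOf d := Quot.sound h
      rw [h1, vertexOf_rev_eq h1]
    · have : d = c.rev := by
        ext
        · exact congrArg Fin.val h1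
        · exact congrArg Fin.val h2
        · exact congrArg Fin.val h3
      rw [this, Corner.rev_rev, add_comm])
  refine ⟨C, fun i k => ?_⟩
  have h := sum_mul_edgeGluing C i k
  simp only [Int.cast_id] at h
  rw [h, Corner.sum_eq_sum_lt _ _ fun c => by rw [Corner.pair_rev]; rfl]
  rfl

/-- Every opposite pair consists of two edges; this is the source of the linear relation between the
rows. -/
theorem sum_edgeGluing (i : Fin N) (k : Fin 3) : ∑ I, T.edgeGluing I i k = 2 := by
  have h := sum_mul_edgeGluing (T := T) (fun _ => (1 : ℤ)) i k
  simp only [one_mul, Int.cast_id] at h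
  have h2 : ∀ c : Corner N, (if c.v < c.w ∧ c.tet = i ∧ c.pair = k then (1 : ℤ) else 0) =
      if c.tet = i ∧ c.pair = k then (if c.v < c.w then 1 else 0) else 0 := by
    intro c
    by_cases h1 : c.v < c.w <;> simp [h1]
  rw [h, Finset.sum_congr rfl fun c _ => h2 c, Corner.sum_tet_pair]
  have key : ∀ k : Fin 3, ∑ p : {p : Fin 4 × Fin 4 // p.1 ≠ p.2},
      (if oppositePair p.1.1 p.1.2 = k then (if p.1.1 < p.1.2 then (1 : ℤ) else 0) else 0) = 2 := by
    decide
  exact key k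

namespace PeripheralCurve

variable (γ : T.PeripheralCurve)

theorem sum_gluing_mul {R : Type*} [CommRing R] (g : Fin N → Fin 3 → R) :
    ∑ i, ∑ k, (γ.gluing i k : R) * g i k = ∑ c, (γ.chain c : R) * g c.tet c.pair := by
  rw [← Corner.sum_sum_mul]
  simp only [gluing_eq]
  push_cast
  rfl

/-- Homologous curves have gluing equations that differ by those of the edges. -/
theorem gluing_eq_of_isNullHomologous (hT : T.IsOneCusped) {γ δ : T.PeripheralCurve} {ε : ℤ}
    (h : (boundarySurface hT).IsNullHomologous (fun c => γ.chain c - ε * δ.chain c)) :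
    ∃ (C : T.Edge → ℤ) (a : Fin N → ℤ), ∀ i k,
      γ.gluing i k = ε * δ.gluing i k + ∑ I, C I * T.edgeGluing I i k + a i := by
  obtain ⟨B, hB⟩ := h
  obtain ⟨C, hC⟩ := sum_vertex_eq_sum_edge B
  -- What is left is constant on triangles. Each vertex of a tetrahedron has one corner in every
  -- opposite pair, so the contribution `a i` is the same for all three pairs.
  let m : Corner N → ℤ := fun c => γ.chain c - ε * δ.chain c - B (T.vertexOf c)
  have hm : ∀ c : Corner N, m c.rot = m c := by
    intro c
    have h1 : γ.chain c.rot - ε * δ.chain c.rot - (γ.chain c - ε * δ.chain c) =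
      B (T.vertexOf c.rot) - B (T.vertexOf c) := hB c
    simp only [m]
    linarith
  have hm' : ∀ c d : Corner N, (c.tet, c.v) = (d.tet, d.v) → m d = m c := by
    intro c d h
    rcases (Corner.face_eq_iff c d).1 h with rfl | rfl | rfl <;> simp only [hm]
  let A : Fin N → Fin 4 → ℤ := fun t v => m ⟨t, v, v + 1, by simp⟩
  have hA : ∀ c, m c = A c.tet c.v := fun c => hm' _ _ rfl
  refine ⟨C, fun i => A i 0 + A i 1 + A i 2 + A i 3, fun i k => ?_⟩
  have h1 : ∑ c : Corner N, (if c.tet = i ∧ c.pair = k then m c else 0) =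
      A i 0 + A i 1 + A i 2 + A i 3 := by
    simp only [hA]
    rw [Corner.sum_tet_pair]
    have key : ∀ (x : Fin 4 → ℤ) (k : Fin 3), ∑ p : {p : Fin 4 × Fin 4 // p.1 ≠ p.2},
        (if oppositePair p.1.1 p.1.2 = k then x p.1.1 else 0) = x 0 + x 1 + x 2 + x 3 := by
      intro x k
      have e : ∀ v k, ∑ p : {p : Fin 4 × Fin 4 // p.1 ≠ p.2},
          (if oppositePair p.1.1 p.1.2 = k ∧ v = p.1.1 then (1 : ℤ) else 0) = 1 := by decide
      have h : ∑ v, x v * ∑ p : {p : Fin 4 × Fin 4 // p.1 ≠ p.2},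
          (if oppositePair p.1.1 p.1.2 = k ∧ v = p.1.1 then (1 : ℤ) else 0) = ∑ v, x v := by
        simp only [e, mul_one]
      rw [Fin.sum_univ_four x] at h
      rw [← h]
      simp only [Finset.mul_sum]
      rw [Finset.sum_comm]
      refine Finset.sum_congr rfl fun p _ => ?_
      by_cases hp : oppositePair p.1.1 p.1.2 = k <;> simp [hp]
    exact key (A i) k
  have h2 : ∑ c : Corner N, (if c.tet = i ∧ c.pair = k then m c else 0) =
      γ.gluing i k - ε * δ.gluing i k - ∑ I, C I * T.edgeGluing I i k := by
    rw [← hC, gluing_eq, gluing_eq, Finset.mul_sum, ← Finset.sum_sub_distrib,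
      ← Finset.sum_sub_distrib]
    refine Finset.sum_congr rfl fun c _ => ?_
    simp only [m]
    split_ifs <;> simp
  linarith

end PeripheralCurve

/-- The condition at an edge is the condition at either of its ends on the torus. -/
theorem IsFlattening.sum_vertex (hT : T.IsOneCusped) (hE : Fintype.card T.Edge = N)
    {γ : T.PeripheralCurve} {f : Fin N → Fin 3 → ℤ} (hf : T.IsFlattening γ f) (x : T.LinkVertex) :
    ∑ c : Corner N, (if T.vertexOf c = x then f c.tet c.pair else 0) = 2 := by
  obtain ⟨d, rfl⟩ := Quot.exists_rep x
  have h := hf.edge (T.edgeOf d)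
  simp only [hT.edgeGluing_eq hE] at h
  rw [Corner.sum_sum_mul] at h
  rw [← h]
  refine Finset.sum_congr rfl fun c _ => ?_
  simp only [ite_mul, one_mul, zero_mul]
  rfl

theorem IsFlattening.sum_face {γ : T.PeripheralCurve} {f : Fin N → Fin 3 → ℤ}
    (hf : T.IsFlattening γ f) (c : Corner N) :
    f c.tet c.pair + f c.rot.tet c.rot.pair + f c.rot.rot.tet c.rot.rot.pair = 1 := by
  rw [Corner.pair_rot c.rot, Corner.pair_rot c, ← hf.tet c.tet, Fin.sum_univ_three]
  have : ∀ k : Fin 3, k = 0 ∨ k = 1 ∨ k = 2 := by decide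
  change f c.tet c.pair + f c.tet (c.pair + 1) + f c.tet (c.pair + 1 + 1) = _
  rcases this c.pair with h | h | h <;> rw [h] <;> simp only [Fin.isValue, Fin.reduceAdd] <;> ring

/-- A flattening with respect to a curve is one with respect to every homologous curve. -/
theorem IsFlattening.curve_eq_zero (hT : T.IsOneCusped) (hE : Fintype.card T.Edge = N)
    {γ δ : T.PeripheralCurve} {f : Fin N → Fin 3 → ℤ} (hf : T.IsFlattening δ f)
    (hγ : γ.IsEssential) {ε : ℤ}
    (h : (boundarySurface hT).IsNullHomologous (fun c => γ.chain c - ε * δ.chain c)) :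
    ∑ i, ∑ k, γ.gluing i k * f i k = 0 := by
  have h1 := (γ.toSimpleLoop hT).rotation_eq hT.card_corner (δ.toSimpleLoop hT)
    (hγ.not_isNullHomologous hT) (ε := ε)
    (by simpa only [PeripheralCurve.toSimpleLoop_chain] using h)
    (f := fun c => f c.tet c.pair) (fun c => by exact_mod_cast hf.sum_face c)
    (fun v => by exact_mod_cast hf.sum_vertex hT hE v)
  simp only [PeripheralCurve.toSimpleLoop_chain] at h1
  have h2 := δ.sum_gluing_mul f
  have h3 := γ.sum_gluing_mul f
  simp only [Int.cast_id] at h2 h3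
  rw [h3]
  rw [hf.curve] at h2
  have h4 : ∑ c, δ.chain c * f c.tet c.pair = 0 := h2.symm
  have h5 : ∑ c, γ.chain c * f c.tet c.pair = ε * ∑ c, δ.chain c * f c.tet c.pair := by
    exact_mod_cast h1
  rw [h5, h4, mul_zero]

end IdealTriangulation

/-! ### Differences of flattenings -/

theorem Corner.sum_lt_tet_pair {N : ℕ} {R : Type*} [AddCommMonoid R] (g : Corner N → R) (i : Fin N)
    (k : Fin 3) :
    ∑ c : Corner N, (if c.v < c.w ∧ c.tet = i ∧ c.pair = k then g c else 0) =
      ∑ v, ∑ w, if h : v ≠ w then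
        (if v < w ∧ oppositePair v w = k then g ⟨i, v, w, h⟩ else 0) else 0 := by
  have h1 : ∀ c : Corner N, (if c.v < c.w ∧ c.tet = i ∧ c.pair = k then g c else 0) =
      if c.tet = i ∧ c.pair = k then (if c.v < c.w then g c else 0) else 0 := by
    intro c
    by_cases h1 : c.v < c.w <;> simp [h1]
  rw [Finset.sum_congr rfl fun c _ => h1 c, Corner.sum_tet_pair]
  rw [← Fintype.sum_prod_type' (f := fun v w : Fin 4 => if h : v ≠ w then
    (if v < w ∧ oppositePair v w = k then g ⟨i, v, w, h⟩ else 0) else 0),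
    ← Finset.sum_filter_of_ne (p := fun p : Fin 4 × Fin 4 => p.1 ≠ p.2)
      (fun p _ hp h => hp (dif_neg (not_not.2 h))),
    Finset.sum_subtype (p := fun p : Fin 4 × Fin 4 => p.1 ≠ p.2) _ (fun p => by simp)]
  refine Finset.sum_congr rfl fun p _ => ?_
  rw [dif_pos p.2]
  by_cases h2 : p.1.1 < p.1.2 <;> simp [h2]

/-- The linear algebra of a single tetrahedron. -/
theorem two_mul_eq_sub (m φ : Fin 4 → Fin 4 → ℚ) (w : Fin 3 → ℚ) (μ : ℚ)
    (hw : ∀ v x, v ≠ x → w (oppositePair v x) =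
      μ * (m v (nextVertex v x) - m v (nextVertex v (nextVertex v x))) +
        (φ v (nextVertex v x) - φ v (nextVertex v (nextVertex v x))))
    (hw0 : w 0 + w 1 + w 2 = 0) (κ C : Fin 4 → Fin 4 → ℚ)
    (hκ : ∀ v x, κ v x = m v (nextVertex v x) - m v (nextVertex v (nextVertex v x)))
    (hC : ∀ v x, C v x = φ v (nextVertex v x) - μ * κ v (nextVertex v x) +
      (φ x (nextVertex v x) + μ * κ x (nextVertex v x)))
    (y : Fin 3 → ℚ)
    (h0 : y 0 = C 0 1 + C 2 3 - 2 * μ * (m 0 1 + m 1 0 + m 2 3 + m 3 2))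
    (h1 : y 1 = C 0 2 + C 1 3 - 2 * μ * (m 0 2 + m 2 0 + m 1 3 + m 3 1))
    (h2 : y 2 = C 0 3 + C 1 2 - 2 * μ * (m 0 3 + m 3 0 + m 1 2 + m 2 1)) :
    2 * w 0 = y 2 - y 1 ∧ 2 * w 1 = y 0 - y 2 ∧ 2 * w 2 = y 1 - y 0 := by
  have n : nextVertex 0 1 = 2 ∧ nextVertex 0 2 = 3 ∧ nextVertex 0 3 = 1 ∧
    nextVertex 1 0 = 3 ∧ nextVertex 1 3 = 2 ∧ nextVertex 1 2 = 0 ∧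
    nextVertex 2 3 = 0 ∧ nextVertex 2 0 = 1 ∧ nextVertex 2 1 = 3 ∧
    nextVertex 3 2 = 1 ∧ nextVertex 3 1 = 0 ∧ nextVertex 3 0 = 2 := by decide
  obtain ⟨n01, n02, n03, n10, n13, n12, n23, n20, n21, n32, n31, n30⟩ := n
  have o : oppositePair 0 1 = 0 ∧ oppositePair 0 2 = 1 ∧ oppositePair 0 3 = 2 ∧
    oppositePair 1 0 = 0 ∧ oppositePair 1 3 = 1 ∧ oppositePair 1 2 = 2 ∧
    oppositePair 2 3 = 0 ∧ oppositePair 2 0 = 1 ∧ oppositePair 2 1 = 2 ∧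
    oppositePair 3 2 = 0 ∧ oppositePair 3 1 = 1 ∧ oppositePair 3 0 = 2 := by decide
  obtain ⟨o01, o02, o03, o10, o13, o12, o23, o20, o21, o32, o31, o30⟩ := o
  have e01 := hw 0 1 (by decide)
  have e02 := hw 0 2 (by decide)
  have e03 := hw 0 3 (by decide)
  have e13 := hw 1 3 (by decide)
  have e31 := hw 3 1 (by decide)
  have e21 := hw 2 1 (by decide)
  have e30 := hw 3 0 (by decide)
  have e32 := hw 3 2 (by decide)
  simp only [o01, o02, o03, o13, o21, o30, o31, o32,
    n01, n02, n03, n13, n12, n23, n21, n32, n31, n30] at e01 e02 e03 e13 e21 e30 e31 e32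
  simp only [hC, hκ, n01, n02, n03, n10, n13, n12, n23, n20, n21, n32, n31, n30] at h0 h1 h2
  rw [h0, h1, h2]
  -- Each value of w is expressed at the four corners of its pair; the corners used are those whose
  -- φ and m terms cancel against y.
  refine ⟨?_, ?_, ?_⟩
  · linear_combination 2 * hw0 - e02 - e30 - e13 - e21
  · linear_combination hw0 - e03 + e13 - e32
  · linear_combination hw0 - e01 + e21 - e31

namespace IdealTriangulation

variable {N : ℕ} {T : IdealTriangulation N}

/-- Rotation around an edge crosses the same face at both ends, but it is counterclockwise at one
end and clockwise at the other. -/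
theorem flipCorner_rev (c : Corner N) :
    T.flipCorner c.rev.rot.rot = (T.linkPerm c).rev.rot := by
  have key : ∀ v w, v ≠ w → nextVertex w (nextVertex w v) = nextVertex v w ∧
      nextVertex w (nextVertex v w) = v := by decide
  have h1 := key _ _ c.ne
  have h2 := nextVertex_of_sign_eq_neg_one _ (T.sign_glue c.tet (nextVertex c.v c.w)) c.w
    (nextVertex c.v c.w) (nextVertex_ne_right _ _ c.ne).symm
  rw [h1.2] at h2
  rw [linkPerm_eq]
  ext
  · simp [flipCorner, Corner.rot, Corner.rev, h1.1]
  · simp [flipCorner, Corner.rot, Corner.rev, h1.1]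
  · simp [flipCorner, Corner.rot, Corner.rev, h1.1, h2]

/-- The half-integral potential of an angle cochain that is orthogonal to a curve. -/
theorem exists_edge_potential (hT : T.IsOneCusped) {γ : T.PeripheralCurve} (hγ : γ.IsEssential)
    {w : Fin N → Fin 3 → ℤ} (hface : ∀ i, ∑ k, w i k = 0)
    (hvertex : ∀ x, ∑ c : Corner N, (if T.vertexOf c = x then w c.tet c.pair else 0) = 0)
    (hw : ∑ i, ∑ k, γ.gluing i k * w i k = 0) :
    ∃ (C : T.Edge → ℤ) (k : ℤ) (y : Fin N → Fin 3 → ℤ),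
      (∀ i q, y i q = ∑ I, C I * T.edgeGluing I i q - k * γ.gluing i q) ∧
      ∀ i, 2 * w i 0 = y i 2 - y i 1 ∧ 2 * w i 1 = y i 0 - y i 2 ∧ 2 * w i 2 = y i 1 - y i 0 := by
  have hface' : ∀ c : Corner N,
      w c.tet c.pair + w c.tet (c.pair + 1) + w c.tet (c.pair + 1 + 1) = 0 := by
    intro c
    rw [← hface c.tet, Fin.sum_univ_three]
    have : ∀ k : Fin 3, k = 0 ∨ k = 1 ∨ k = 2 := by decide
    rcases this c.pair with h | h | h <;> rw [h] <;> simp only [Fin.isValue, Fin.reduceAdd] <;> ring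
  have := hT.nonempty_corner
  obtain ⟨k, φ, hφ, hwφ, hint⟩ := (γ.toSimpleLoop hT).exists_eq_add_coboundary hT.card_corner
    (hγ.not_isNullHomologous hT) (w := fun c => w c.tet c.pair) (fun c => by
      have := hface' c
      rw [← Corner.pair_rot, ← Corner.pair_rot] at this
      exact this) hvertex (by
      have := γ.sum_gluing_mul w
      simp only [Int.cast_id] at this
      simp only [γ.toSimpleLoop_chain]
      rw [← this, hw])
  simp only [γ.toSimpleLoop_chain] at hwφ hint
  let κ : Corner N → ℚ := fun c => γ.chain c.rot - γ.chain c.rot.rot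
  have hφ : ∀ c, φ (T.flipCorner c) = φ c := hφ
  have hwφ : ∀ c : Corner N, (w c.tet c.pair : ℚ) =
    k / 2 * κ c + (φ c.rot - φ c.rot.rot) := hwφ
  have hint : ∀ c, ∃ a : ℤ, φ c - k / 2 * κ c = a := hint
  have hκ : ∀ c, κ (T.flipCorner c) = - κ c := fun c => by
    have := (γ.toSimpleLoop hT).chain_isBalanced c
    simp only [γ.toSimpleLoop_chain] at this
    have h' : γ.chain (T.flipCorner c).rot - γ.chain (T.flipCorner c).rot.rot =
      -(γ.chain c.rot - γ.chain c.rot.rot) := this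
    simp only [κ]
    exact_mod_cast h'
  have hκ3 : ∀ c, κ c + κ c.rot + κ c.rot.rot = 0 := fun c => by
    simp only [κ, Corner.rot_rot_rot]; ring
  -- The candidate for the value at an edge adds the potentials of the two boundary sides that one
  -- face containing the edge has at its ends, each with the half-integral correction at the end
  -- next to the edge.
  have hint' : ∀ c : Corner N, ∃ a : ℤ, (φ c.rot - k / 2 * κ c.rot) +
      (φ c.rev.rot.rot + k / 2 * κ c.rev.rot.rot) = a := by
    intro c
    obtain ⟨a, ha⟩ := hint c.rot
    obtain ⟨b, hb⟩ := hint c.rev.rot.rot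
    refine ⟨a + b + k * (γ.chain c.rev.rot.rot.rot - γ.chain c.rev.rot.rot.rot.rot), ?_⟩
    push_cast
    rw [← ha, ← hb]
    simp only [κ]
    ring
  choose C₀ hC₀ using hint'
  -- The other face containing the edge gives the same value, since w agrees at the two ends of the
  -- edge of the tetrahedron.
  have hrev : ∀ c, C₀ c.rev = C₀ c := by
    intro c
    have h1 := hwφ c
    have h2 := hwφ c.rev
    rw [Corner.pair_rev] at h2
    have h2 : (w c.tet c.pair : ℚ) = _ := h2
    have h3 := hC₀ c
    have h4 := hC₀ c.rev
    rw [Corner.rev_rev] at h4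
    have : (C₀ c.rev : ℚ) = C₀ c := by
      rw [← h3, ← h4]
      linear_combination h1 - h2 + (k / 2 : ℚ) * (hκ3 c - hκ3 c.rev)
    exact_mod_cast this
  -- The common face of two adjacent tetrahedra gives the same value from both, since φ is symmetric
  -- and κ skew under `flip`.
  have hlink : ∀ c, C₀ (T.linkPerm c) = C₀ c := by
    intro c
    have h3 := hC₀ c
    have h4 := hC₀ (T.linkPerm c).rev
    rw [Corner.rev_rev, hrev, ← flipCorner_rev, hφ, hκ, linkPerm_apply, Corner.rot_rot_rot, hφ,
      hκ] at h4
    have : (C₀ (T.linkPerm c) : ℚ) = C₀ c := by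
      rw [← h3, linkPerm_apply, ← h4]
      ring
    exact_mod_cast this
  let C : T.Edge → ℤ := Quot.lift C₀ (by
    rintro c d (h | ⟨h1, h2, h3⟩)
    · rcases T.eq_linkPerm_of_linkRel h with rfl | rfl
      · exact (hlink _).symm
      · exact hlink _
    · have : d = c.rev := by
        ext
        · exact congrArg Fin.val h1
        · exact congrArg Fin.val h2
        · exact congrArg Fin.val h3
      rw [this, hrev])
  refine ⟨C, k, fun i q => ∑ I, C I * T.edgeGluing I i q - k * γ.gluing i q, fun i q => rfl,
    fun i => ?_⟩
  have hsum : ∀ q, ∑ I, C I * T.edgeGluing I i q - k * γ.gluing i q =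
      ∑ v, ∑ x, if h : v ≠ x then (if v < x ∧ oppositePair v x = q then
        C₀ ⟨i, v, x, h⟩ - k * (γ.chain ⟨i, v, x, h⟩ + γ.chain ⟨i, x, v, h.symm⟩) else 0) else 0 := by
    intro q
    have h1 := sum_mul_edgeGluing C i q
    simp only [Int.cast_id] at h1
    rw [h1, γ.gluing_eq, Corner.sum_eq_sum_lt _ (fun c => c.tet = i ∧ c.pair = q)
      (fun c => by rw [Corner.pair_rev]; rfl), Finset.mul_sum, ← Finset.sum_sub_distrib]
    refine Eq.trans ?_ (Corner.sum_lt_tet_pair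
      (fun c => C₀ c - k * (γ.chain c + γ.chain c.rev)) i q)
    refine Finset.sum_congr rfl fun c _ => ?_
    split_ifs
    · rfl
    · simp
  simp only [hsum]
  -- Extension by an irrelevant value to the diagonal, so that the lemma on a single tetrahedron
  -- applies to functions of two vertices.
  obtain ⟨ext, hext⟩ : ∃ ext : (Corner N → ℚ) → Fin 4 → Fin 4 → ℚ,
      ∀ g v x (h : v ≠ x), ext g v x = g ⟨i, v, x, h⟩ :=
    ⟨fun g v x => if h : v ≠ x then g ⟨i, v, x, h⟩ else 0, fun g v x h => dif_pos h⟩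
  have hκv : ∀ v x (h : v ≠ x), ext (fun c => γ.chain c) v (nextVertex v x) -
      ext (fun c => γ.chain c) v (nextVertex v (nextVertex v x)) = κ ⟨i, v, x, h⟩ := by
    intro v x h
    rw [hext _ _ _ (nextVertex_ne_left _ _ h),
      hext _ _ _ (nextVertex_ne_left _ _ (nextVertex_ne_left _ _ h))]
    rfl
  have hCv : ∀ v x (h : v ≠ x), ext φ v (nextVertex v x) -
      k / 2 * (ext (fun c => γ.chain c) v (nextVertex v (nextVertex v x)) -
        ext (fun c => γ.chain c) v (nextVertex v (nextVertex v (nextVertex v x)))) +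
      (ext φ x (nextVertex v x) +
      k / 2 * (ext (fun c => γ.chain c) x (nextVertex x (nextVertex v x)) -
        ext (fun c => γ.chain c) x (nextVertex x (nextVertex x (nextVertex v x))))) =
      C₀ ⟨i, v, x, h⟩ := by
    intro v x h
    have h1 := nextVertex_ne_left _ _ h
    have h2 := (nextVertex_ne_right _ _ h).symm
    have h3 : (⟨i, x, nextVertex v x, h2⟩ : Corner N) =
        (Corner.rev ⟨i, v, x, h⟩).rot.rot := by
      have key : ∀ v w, v ≠ w → nextVertex v w = nextVertex w (nextVertex w v) := by decide
      ext
      · rfl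
      · rfl
      · exact congrArg Fin.val (key v x h)
    rw [hκv _ _ h1, hκv _ _ h2, hext _ _ _ h1, hext _ _ _ h2, h3]
    exact hC₀ ⟨i, v, x, h⟩
  have hwi : (w i 0 : ℚ) + w i 1 + w i 2 = 0 := by
    have := hface i
    rw [Fin.sum_univ_three] at this
    exact_mod_cast this
  have := two_mul_eq_sub (ext fun c => γ.chain c) (ext φ) (fun q => (w i q : ℚ)) (k / 2)
    (fun v x h => by
      rw [hκv _ _ h, hext _ _ _ (nextVertex_ne_left _ _ h),
        hext _ _ _ (nextVertex_ne_left _ _ (nextVertex_ne_left _ _ h))]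
      exact hwφ ⟨i, v, x, h⟩) hwi _ _ (fun v x => rfl) (fun v x => rfl)
    (fun q => ((∑ v, ∑ x, if h : v ≠ x then (if v < x ∧ oppositePair v x = q then
        C₀ ⟨i, v, x, h⟩ - k * (γ.chain ⟨i, v, x, h⟩ + γ.chain ⟨i, x, v, h.symm⟩) else 0) else 0 : ℤ) : ℚ))
    (by
      rw [hCv 0 1 (by decide), hCv 2 3 (by decide)]
      simp [Fin.sum_univ_four, oppositePair, hext]
      ring)
    (by
      rw [hCv 0 2 (by decide), hCv 1 3 (by decide)]
      simp [Fin.sum_univ_four, oppositePair, hext]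
      ring)
    (by
      rw [hCv 0 3 (by decide), hCv 1 2 (by decide)]
      simp [Fin.sum_univ_four, oppositePair, hext]
      ring)
  exact_mod_cast this

end IdealTriangulation

/-! ### Matrices whose rows add up to zero -/

namespace Matrix

variable {n R : Type*} [Fintype n] [DecidableEq n] [CommRing R] {W : Matrix n n R}

theorem det_eq_zero_of_sum_rows (hW : ∑ i, W i = 0) [Nonempty n] : W.det = 0 := by
  obtain ⟨o⟩ := ‹Nonempty n›
  have h := det_updateRow_sum W o (fun _ => 1)
  simp only [one_smul, hW] at h
  rw [← h]
  exact det_eq_zero_of_row_eq_zero o fun j => by simp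

/-- Replacing the row o by a combination of the rows of W gives a multiple of det W, which is 0. -/
theorem det_updateRow_add_rows (hW : ∑ i, W i = 0) (o : n) (c : n → R) (ε : R) (u : n → R) :
    (W.updateRow o (ε • u + ∑ k, c k • W k)).det = ε * (W.updateRow o u).det := by
  have : Nonempty n := ⟨o⟩
  rw [det_updateRow_add, det_updateRow_smul, det_updateRow_sum, det_eq_zero_of_sum_rows hW,
    smul_zero, add_zero]

/-- The omitted row is minus the sum of the others. Substituting it for the one that is kept costs a
sign, which cancels the sign of the transposition of the two rows. -/
theorem det_updateRow_eq (hW : ∑ i, W i = 0) (o o' : n) (u : n → R) :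
    (W.updateRow o u).det = (W.updateRow o' u).det := by
  by_cases h : o = o'
  · rw [h]
  let A := (W.updateRow o' u).submatrix (Equiv.swap o o') id
  have hAo : A o = u := by ext j; simp [A]
  have hAo' : A o' = W o := by ext j; simp [A, updateRow_ne h]
  have hA : ∀ k, k ≠ o → k ≠ o' → A k = W k := fun k h1 h2 => by
    ext j; simp [A, Equiv.swap_apply_of_ne_of_ne h1 h2, updateRow_ne h2]
  have h1 := det_updateRow_sum A o' (fun k => if k = o then 0 else -1)
  have h2 : ∑ k, (if k = o then (0 : R) else -1) • A k = W o' := by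
    ext j
    have hj : ∑ i, W i j = 0 := (Finset.sum_apply j Finset.univ W).symm.trans (congrFun hW j)
    have h3 : ∀ k, ((if k = o then (0 : R) else -1) • A k) j =
        - W k j + (if k = o then W o j else 0) + (if k = o' then W o' j - W o j else 0) := by
      intro k
      by_cases hk : k = o
      · subst hk; simp [h]
      · by_cases hk' : k = o'
        · subst hk'; simp only [hk, if_false, Pi.smul_apply, hAo', smul_eq_mul, if_true]; ring
        · simp [hk, hk', hA k hk hk']
    refine (Finset.sum_apply j Finset.univ _).trans ?_
    rw [Finset.sum_congr rfl fun k _ => h3 k, Finset.sum_add_distrib,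
      Finset.sum_add_distrib, Finset.sum_neg_distrib, hj]
    simp
  have h4 : A.updateRow o' (W o') = W.updateRow o u := by
    ext k j
    by_cases hk' : k = o'
    · subst hk'; simp [updateRow_ne (Ne.symm h)]
    · rw [updateRow_ne hk']
      by_cases hk : k = o
      · subst hk; rw [hAo, updateRow_self]
      · rw [hA k hk hk', updateRow_ne hk]
  rw [h2, h4, if_neg (Ne.symm h), det_permute, Equiv.Perm.sign_swap h] at h1
  rw [h1]; simp

theorem det_updateRow_reindex {ι : Type*} [Fintype ι] {W : ι → n → R} (hW : ∑ i, W i = 0)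
    (e e' : n ≃ ι) (o o' : n) (u : n → R) :
    ((of fun i => W (e i)).updateRow o u).det = ((of fun i => W (e' i)).updateRow o' u).det ∨
    ((of fun i => W (e i)).updateRow o u).det = -((of fun i => W (e' i)).updateRow o' u).det := by
  let π : Equiv.Perm n := e'.trans e.symm
  have h0 : ∑ i, (of fun i => W (e i)) i = 0 := by
    rw [← hW]; exact Equiv.sum_comp e W
  -- A change of enumeration permutes the rows and moves the omitted one.
  have h1 : (of fun i => W (e' i)).updateRow o' u =
      ((of fun i => W (e i)).updateRow (π o') u).submatrix π id := by
    ext i j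
    by_cases hi : i = o'
    · subst hi; simp
    · rw [updateRow_ne hi, submatrix_apply, updateRow_ne (by simpa using hi)]
      simp [π]
  rw [h1, det_permute, det_updateRow_eq h0 o (π o')]
  rcases Int.units_eq_one_or (Equiv.Perm.sign π) with h | h <;> rw [h] <;> simp

end Matrix

/-! ### Shape parameters -/

theorem neg_one_zpow_eq_or' (n : ℤ) : (-1 : ℂ) ^ n = 1 ∨ (-1 : ℂ) ^ n = -1 := by
  rcases n.even_or_odd with h | h
  · exact Or.inl h.neg_one_zpow
  · exact Or.inr h.neg_one_zpow

theorem zpow_eq_of_mul_eq_neg_one {a b c : ℂ} (h : a * b * c = -1) (n : ℤ) :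
    b ^ n = (-1) ^ n * (a ^ (-n) * c ^ (-n)) := by
  have hb : b = -1 * (a⁻¹ * c⁻¹) := by
    have ha : a ≠ 0 := by rintro rfl; simp at h
    have hc : c ≠ 0 := by rintro rfl; simp at h
    field_simp
    linear_combination h
  rw [hb, mul_zpow, mul_zpow, inv_zpow', inv_zpow']

section Shape

variable {z : ℂ} (h0 : z ≠ 0) (h1 : z ≠ 1)
include h0 h1

theorem shapeParam_ne_zero (k : Fin 3) : shapeParam z k ≠ 0 := by
  have h2 : 1 - z ≠ 0 := sub_ne_zero.2 h1.symm
  have h3 : 1 - z⁻¹ ≠ 0 := sub_ne_zero.2 fun h => h1 (by rw [← inv_inv z, ← h, inv_one])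
  have : ∀ k : Fin 3, k = 0 ∨ k = 1 ∨ k = 2 := by decide
  rcases this k with rfl | rfl | rfl
  · exact h0
  · exact inv_ne_zero h2
  · exact h3

theorem shapeParam_mul : shapeParam z 0 * shapeParam z 1 * shapeParam z 2 = -1 := by
  have h2 : 1 - z ≠ 0 := sub_ne_zero.2 h1.symm
  simp only [shapeParam, Matrix.cons_val_zero, Matrix.cons_val_one, Matrix.cons_val]
  field_simp
  ring

/-- The normalized entry of the 1-loop matrix. -/
def loopEntry (z : ℂ) (y : Fin 3 → ℤ) : ℂ := (z - 1) * y 0 + y 2 - z * y 1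

/-- The scaling factor of the 1-loop matrix for a quad type. -/
def loopFactor (z : ℂ) : Fin 3 → ℂ := ![z⁻¹, -1, (1 - z)⁻¹]

/-- Rotating the quad type cyclically permutes z, z', z'', so the column changes only by a scalar.
-/
theorem entry_eq_loopFactor_mul (y : Fin 3 → ℤ) (q : Fin 3) :
    ((y q - y (q + 1) : ℤ) : ℂ) * shapeParam z (q + 2) +
      ((y (q + 2) - y (q + 1) : ℤ) : ℂ) * (shapeParam z q)⁻¹ =
    loopFactor z q * loopEntry z y := by
  have h2 : 1 - z ≠ 0 := sub_ne_zero.2 h1.symm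
  have h3 : z - 1 ≠ 0 := sub_ne_zero.2 h1
  have : ∀ k : Fin 3, k = 0 ∨ k = 1 ∨ k = 2 := by decide
  have hz : 1 - z⁻¹ = (z - 1) / z := by field_simp
  rcases this q with rfl | rfl | rfl <;>
    simp [shapeParam, loopFactor, loopEntry] <;> (try rw [hz]) <;> field_simp <;> ring

/-- The relation z z' z'' = -1 eliminates the middle shape at the cost of a sign, and f + f' + f'' =
1 supplies the one extra power that matches the column factor. -/
theorem loopFactor_mul_monomial {f : Fin 3 → ℤ} (hf : ∑ k, f k = 1) (q : Fin 3) :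
    loopFactor z q * (shapeParam z q ^ f (q + 2) * shapeParam z (q + 2) ^ (-f q)) =
      z⁻¹ * (shapeParam z 0 ^ f 2 * shapeParam z 2 ^ (-f 0)) ∨
    loopFactor z q * (shapeParam z q ^ f (q + 2) * shapeParam z (q + 2) ^ (-f q)) =
      -(z⁻¹ * (shapeParam z 0 ^ f 2 * shapeParam z 2 ^ (-f 0))) := by
  have hm := shapeParam_mul h0 h1
  have n0 := shapeParam_ne_zero h0 h1 0
  have n2 := shapeParam_ne_zero h0 h1 2
  have hz : shapeParam z 0 = z := rfl
  have hz1 : (1 - z)⁻¹ = shapeParam z 1 := rfl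
  rw [Fin.sum_univ_three] at hf
  have : ∀ k : Fin 3, k = 0 ∨ k = 1 ∨ k = 2 := by decide
  rcases this q with rfl | rfl | rfl
  · left; rfl
  · change -1 * (shapeParam z 1 ^ f 0 * shapeParam z 0 ^ (-f 1)) = _ ∨
      -1 * (shapeParam z 1 ^ f 0 * shapeParam z 0 ^ (-f 1)) = _
    have e1 : shapeParam z 0 ^ (-f 1) = shapeParam z 0 ^ f 0 * shapeParam z 0 ^ f 2 * z⁻¹ := by
      rw [show -f 1 = f 0 + f 2 + -1 by linarith, zpow_add₀ n0, zpow_add₀ n0, zpow_neg_one, hz]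
    have e2 : shapeParam z 0 ^ (-f 0) * shapeParam z 0 ^ f 0 = 1 := by
      rw [← zpow_add₀ n0, neg_add_cancel, zpow_zero]
    rw [zpow_eq_of_mul_eq_neg_one hm, e1]
    rcases neg_one_zpow_eq_or' (f 0) with h | h <;> rw [h]
    · right
      linear_combination (-z⁻¹ * shapeParam z 0 ^ f 2 * shapeParam z 2 ^ (-f 0)) * e2
    · left
      linear_combination (z⁻¹ * shapeParam z 0 ^ f 2 * shapeParam z 2 ^ (-f 0)) * e2
  · change (1 - z)⁻¹ * (shapeParam z 2 ^ f 1 * shapeParam z 1 ^ (-f 2)) = _ ∨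
      (1 - z)⁻¹ * (shapeParam z 2 ^ f 1 * shapeParam z 1 ^ (-f 2)) = _
    have e1 : shapeParam z 2 ^ f 1 =
        shapeParam z 2 ^ (-f 0) * shapeParam z 2 ^ (-f 2) * shapeParam z 2 := by
      rw [show f 1 = -f 0 + -f 2 + 1 by linarith, zpow_add₀ n2, zpow_add₀ n2, zpow_one]
    have e2 : shapeParam z 2 ^ (-f 2) * shapeParam z 2 ^ f 2 = 1 := by
      rw [← zpow_add₀ n2, neg_add_cancel, zpow_zero]
    have e3 : shapeParam z 1 * shapeParam z 2 = -z⁻¹ := by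
      rw [hz] at hm
      field_simp
      linear_combination hm
    rw [zpow_eq_of_mul_eq_neg_one hm, neg_neg, e1, hz1]
    rcases neg_one_zpow_eq_or' (-f 2) with h | h <;> rw [h]
    · right
      linear_combination (shapeParam z 1 * shapeParam z 2 * shapeParam z 0 ^ f 2 *
        shapeParam z 2 ^ (-f 0)) * e2 + shapeParam z 0 ^ f 2 * shapeParam z 2 ^ (-f 0) * e3
    · left
      linear_combination -(shapeParam z 1 * shapeParam z 2 * shapeParam z 0 ^ f 2 *
        shapeParam z 2 ^ (-f 0)) * e2 - shapeParam z 0 ^ f 2 * shapeParam z 2 ^ (-f 0) * e3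

end Shape

/-! ### Comparison of monomials and of rows. -/

namespace IdealTriangulation

variable {N : ℕ} {T : IdealTriangulation N}

/-- The gluing equations for a combination of edges and the curve. -/
theorem IsShapeSolution.prod_zpow_eq_one {γ : T.PeripheralCurve} {ζ : Fin N → ℂ}
    (hζ : T.IsShapeSolution γ ζ) (C : T.Edge → ℤ) (k : ℤ) :
    ∏ i, ∏ q, shapeParam (ζ i) q ^ (∑ I, C I * T.edgeGluing I i q - k * γ.gluing i q) = 1 := by
  have hne := fun i => shapeParam_ne_zero (hζ.ne_zero i) (hζ.ne_one i)
  have hsum : ∀ i q (s : Finset T.Edge), shapeParam (ζ i) q ^ (∑ I ∈ s, C I * T.edgeGluing I i q) =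
      ∏ I ∈ s, (shapeParam (ζ i) q ^ T.edgeGluing I i q) ^ C I := by
    intro i q s
    induction s using Finset.induction_on with
    | empty => simp
    | insert a s ha ih =>
      rw [Finset.sum_insert ha, Finset.prod_insert ha, zpow_add₀ (hne i q), ih, mul_comm (C a),
        zpow_mul]
  have h1 : ∀ i q, shapeParam (ζ i) q ^ (∑ I, C I * T.edgeGluing I i q - k * γ.gluing i q) =
      (∏ I, (shapeParam (ζ i) q ^ T.edgeGluing I i q) ^ C I) *
        (shapeParam (ζ i) q ^ γ.gluing i q) ^ (-k) := by
    intro i q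
    rw [sub_eq_add_neg, zpow_add₀ (hne i q), hsum, ← zpow_mul]
    congr 2
    ring
  simp only [h1, Finset.prod_mul_distrib]
  have h2 : ∏ i, ∏ q, (shapeParam (ζ i) q ^ γ.gluing i q) ^ (-k) = 1 := by
    simp only [Finset.prod_zpow, hζ.curve, one_zpow]
  have h3 : ∏ i, ∏ q, ∏ I, (shapeParam (ζ i) q ^ T.edgeGluing I i q) ^ C I = 1 := by
    have : ∀ i, ∏ q, ∏ I, (shapeParam (ζ i) q ^ T.edgeGluing I i q) ^ C I =
      ∏ I, (∏ q, shapeParam (ζ i) q ^ T.edgeGluing I i q) ^ C I := by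
      intro i
      rw [Finset.prod_comm]
      simp only [Finset.prod_zpow]
    simp only [this]
    rw [Finset.prod_comm]
    simp only [Finset.prod_zpow, hζ.edge, one_zpow, Finset.prod_const_one]
  rw [h2, h3, one_mul]

/-- The monomials of two flattenings with respect to the same curve agree up to sign. -/
theorem IsFlattening.prod_eq_or (hT : T.IsOneCusped) (hE : Fintype.card T.Edge = N)
    {γ : T.PeripheralCurve} (hγ : γ.IsEssential) {ζ : Fin N → ℂ} (hζ : T.IsShapeSolution γ ζ)
    {f g : Fin N → Fin 3 → ℤ} (hf : T.IsFlattening γ f) (hg : T.IsFlattening γ g) :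
    ∏ i, (shapeParam (ζ i) 0 ^ f i 2 * shapeParam (ζ i) 2 ^ (-f i 0)) =
      ∏ i, (shapeParam (ζ i) 0 ^ g i 2 * shapeParam (ζ i) 2 ^ (-g i 0)) ∨
    ∏ i, (shapeParam (ζ i) 0 ^ f i 2 * shapeParam (ζ i) 2 ^ (-f i 0)) =
      -∏ i, (shapeParam (ζ i) 0 ^ g i 2 * shapeParam (ζ i) 2 ^ (-g i 0)) := by
  have hne := fun i => shapeParam_ne_zero (hζ.ne_zero i) (hζ.ne_one i)
  obtain ⟨C, k, y, hy, hwy⟩ := exists_edge_potential hT hγ (w := fun i q => f i q - g i q)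
    (fun i => by rw [Finset.sum_sub_distrib, hf.tet, hg.tet, sub_self])
    (fun x => by
      have h1 := hf.sum_vertex hT hE x
      have h2 := hg.sum_vertex hT hE x
      refine Eq.trans ?_ (sub_eq_zero.2 (h1.trans h2.symm))
      rw [← Finset.sum_sub_distrib]
      refine Finset.sum_congr rfl fun c _ => ?_
      split_ifs <;> simp)
    (by
      simp only [mul_sub, Finset.sum_sub_distrib, hf.curve, hg.curve, sub_self])
  -- The flattening pairs to 2 with every edge and to 0 with the loop.
  have hyf : ∑ i, ∑ q, y i q * f i q = 2 * ∑ I, C I := by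
    simp only [hy, sub_mul, Finset.sum_sub_distrib, mul_assoc, ← Finset.mul_sum, hf.curve,
      mul_zero, sub_zero, Finset.sum_mul]
    have : ∀ i, ∑ q, ∑ I, C I * (T.edgeGluing I i q * f i q) =
        ∑ I, C I * ∑ q, T.edgeGluing I i q * f i q := by
      intro i
      rw [Finset.sum_comm]
      simp only [Finset.mul_sum]
    simp only [this]
    rw [Finset.sum_comm]
    simp only [← Finset.mul_sum, hf.edge]
    rw [← Finset.sum_mul, mul_comm]
  -- Since f sums to 1 on each tetrahedron and the entries of y differ by even numbers, the sum of
  -- the y' has the parity of the pairing of y with f, which is even.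
  have heven : Even (∑ i, y i 1) := by
    refine ⟨∑ I, C I + ∑ i, ((f i 2 - g i 2) * f i 0 - (f i 0 - g i 0) * f i 2), ?_⟩
    have h1 : ∀ i, y i 1 = ∑ q, y i q * f i q +
        2 * ((f i 2 - g i 2) * f i 0 - (f i 0 - g i 0) * f i 2) := by
      intro i
      have h2 := hf.tet i
      obtain ⟨h3, _, h5⟩ := hwy i
      rw [Fin.sum_univ_three] at h2 ⊢
      linear_combination (-y i 1) * h2 - f i 0 * h5 + f i 2 * h3
    rw [Finset.sum_congr rfl fun i _ => h1 i, Finset.sum_add_distrib, hyf, ← Finset.mul_sum]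
    ring
  have hprod := hζ.prod_zpow_eq_one C k
  simp only [← hy] at hprod
  set X := ∏ i, (shapeParam (ζ i) 0 ^ f i 2 * shapeParam (ζ i) 2 ^ (-f i 0)) with hX
  set Y := ∏ i, (shapeParam (ζ i) 0 ^ g i 2 * shapeParam (ζ i) 2 ^ (-g i 0)) with hY
  have hXY : X ^ 2 = Y ^ 2 := by
    -- Because 2w is a difference of entries of y, multiplication by the shapes to the power y turns
    -- the square for f into the square for g, times (z z' z'') to the power y'.
    have h1 : ∀ i, (shapeParam (ζ i) 0 ^ f i 2 * shapeParam (ζ i) 2 ^ (-f i 0)) ^ 2 *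
        ∏ q, shapeParam (ζ i) q ^ y i q =
        (shapeParam (ζ i) 0 ^ g i 2 * shapeParam (ζ i) 2 ^ (-g i 0)) ^ 2 * (-1) ^ y i 1 := by
      intro i
      rw [Fin.prod_univ_three, ← shapeParam_mul (hζ.ne_zero i) (hζ.ne_one i)]
      obtain ⟨h3, _, h5⟩ := hwy i
      have e0 : f i 2 + f i 2 + y i 0 = g i 2 + g i 2 + y i 1 := by linarith
      have e2 : -f i 0 + -f i 0 + y i 2 = -g i 0 + -g i 0 + y i 1 := by linarith
      have h0 := hne i 0
      have h2 := hne i 2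
      calc _ = shapeParam (ζ i) 0 ^ (f i 2 + f i 2 + y i 0) * shapeParam (ζ i) 1 ^ y i 1 *
            shapeParam (ζ i) 2 ^ (-f i 0 + -f i 0 + y i 2) := by
            simp only [zpow_add₀ h0, zpow_add₀ h2]; ring
        _ = _ := by
            rw [e0, e2]
            simp only [zpow_add₀ h0, zpow_add₀ h2, mul_zpow]; ring
    have h2 := Finset.prod_congr (s₁ := Finset.univ) rfl fun i _ => h1 i
    rw [Finset.prod_mul_distrib, hprod, Finset.prod_mul_distrib, Finset.prod_pow, Finset.prod_pow,
      mul_one] at h2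
    have h3 : ∀ s : Finset (Fin N), ∏ i ∈ s, (-1 : ℂ) ^ y i 1 = (-1) ^ ∑ i ∈ s, y i 1 := by
      intro s
      induction s using Finset.induction_on with
      | empty => simp
      | insert a s ha ih =>
        rw [Finset.sum_insert ha, Finset.prod_insert ha, ih, zpow_add₀ (by norm_num)]
    rw [h2, h3, heven.neg_one_zpow, mul_one]
  exact sq_eq_sq_iff_eq_or_eq_neg.1 hXY

namespace NZChoice

/-- The rows of the 1-loop matrix, normalized so as not to depend on the quad type. -/
def normalizedRow (ζ : Fin N → ℂ) (r : Fin N → Fin 3 → ℤ) (j : Fin N) : ℂ := loopEntry (ζ j) (r j)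

theorem oneLoop_eq (c : T.NZChoice) {ζ : Fin N → ℂ} (h0 : ∀ i, ζ i ≠ 0) (h1 : ∀ i, ζ i ≠ 1) :
    c.oneLoop ζ = (1 / 2 : ℂ) * ((Matrix.of fun i =>
        normalizedRow ζ (T.edgeGluing (c.enum i))).updateRow c.omitted
          (normalizedRow ζ c.loop.gluing)).det *
      ∏ i, (loopFactor (ζ i) (c.quad i) * (c.z ζ i ^ c.flat i (c.quad i + 2) *
        c.z'' ζ i ^ (-c.flat i (c.quad i)))) := by
  have hM : c.A.map (Int.cast : ℤ → ℂ) * Matrix.diagonal (c.z'' ζ) +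
      c.B.map (Int.cast : ℤ → ℂ) * (Matrix.diagonal (c.z ζ))⁻¹ =
      Matrix.of fun i j => loopFactor (ζ j) (c.quad j) * ((Matrix.of fun i =>
        normalizedRow ζ (T.edgeGluing (c.enum i))).updateRow c.omitted
          (normalizedRow ζ c.loop.gluing)) i j := by
    have hz : ∀ j, c.z ζ j ≠ 0 := fun j => shapeParam_ne_zero (h0 j) (h1 j) _
    have hinv : (Matrix.diagonal (c.z ζ))⁻¹ = Matrix.diagonal fun j => (c.z ζ j)⁻¹ := by
      refine Matrix.inv_eq_right_inv ?_
      rw [Matrix.diagonal_mul_diagonal]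
      simp [hz]
    rw [hinv]
    ext i j
    rw [Matrix.add_apply, Matrix.mul_diagonal, Matrix.mul_diagonal]
    refine (entry_eq_loopFactor_mul (h0 j) (h1 j) (c.row i j) (c.quad j)).trans ?_
    rw [Matrix.of_apply]
    congr 1
    by_cases hi : i = c.omitted
    · subst hi
      rw [Matrix.updateRow_self]
      simp [normalizedRow, loopEntry, row]
    · rw [Matrix.updateRow_ne hi]
      simp [normalizedRow, loopEntry, row, hi]
  unfold oneLoop
  rw [hM, Matrix.det_mul_row]
  simp only [Finset.prod_mul_distrib]
  ring

end NZChoice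

/-- The coefficients z - 1, -z, 1 of `loopEntry` add up to 0, and all column sums equal 2. -/
theorem sum_normalizedRow (ζ : Fin N → ℂ) :
    ∑ I : T.Edge, NZChoice.normalizedRow ζ (T.edgeGluing I) = 0 := by
  ext j
  rw [Finset.sum_apply]
  have h : ∀ k, ∑ I : T.Edge, (T.edgeGluing I j k : ℂ) = 2 := fun k => by
    exact_mod_cast sum_edgeGluing (T := T) j k
  simp only [NZChoice.normalizedRow, loopEntry, Finset.sum_add_distrib, Finset.sum_sub_distrib,
    ← Finset.mul_sum, h, Pi.zero_apply]
  ring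

end IdealTriangulation

/-! ### Equality up to sign and the final comparison. -/

theorem eq_or_eq_neg_mul {R : Type*} [CommRing R] {a b a' b' : R} (h : a = b ∨ a = -b)
    (h' : a' = b' ∨ a' = -b') : a * a' = b * b' ∨ a * a' = -(b * b') := by
  rcases h with rfl | rfl <;> rcases h' with rfl | rfl <;> simp

theorem prod_eq_or_eq_neg {ι R : Type*} [CommRing R] (s : Finset ι) {f g : ι → R}
    (h : ∀ i, f i = g i ∨ f i = -g i) : ∏ i ∈ s, f i = ∏ i ∈ s, g i ∨ ∏ i ∈ s, f i = -∏ i ∈ s, g i := by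
  classical
  induction s using Finset.induction_on with
  | empty => simp
  | insert a s ha ih =>
    rw [Finset.prod_insert ha, Finset.prod_insert ha]
    exact eq_or_eq_neg_mul (h a) ih

namespace IdealTriangulation.NZChoice

variable {N : ℕ} {T : IdealTriangulation N}

theorem oneLoop_eq_or (c : T.NZChoice) {ζ : Fin N → ℂ} (h0 : ∀ i, ζ i ≠ 0) (h1 : ∀ i, ζ i ≠ 1) :
    c.oneLoop ζ = (1 / 2 : ℂ) * ((Matrix.of fun i =>
        normalizedRow ζ (T.edgeGluing (c.enum i))).updateRow c.omitted
          (normalizedRow ζ c.loop.gluing)).det * ((∏ i, (ζ i)⁻¹) *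
      ∏ i, (shapeParam (ζ i) 0 ^ c.flat i 2 * shapeParam (ζ i) 2 ^ (-c.flat i 0))) ∨
    c.oneLoop ζ = -((1 / 2 : ℂ) * ((Matrix.of fun i =>
        normalizedRow ζ (T.edgeGluing (c.enum i))).updateRow c.omitted
          (normalizedRow ζ c.loop.gluing)).det * ((∏ i, (ζ i)⁻¹) *
      ∏ i, (shapeParam (ζ i) 0 ^ c.flat i 2 * shapeParam (ζ i) 2 ^ (-c.flat i 0)))) := by
  rw [c.oneLoop_eq h0 h1, ← Finset.prod_mul_distrib]
  exact eq_or_eq_neg_mul (Or.inl rfl) (prod_eq_or_eq_neg _ fun i =>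
    loopFactor_mul_monomial (h0 i) (h1 i) (c.isFlattening.tet i) (c.quad i))

end IdealTriangulation.NZChoice

end

theorem theorem1p3 {N : ℕ} (T : IdealTriangulation N) (hT : T.IsOneCusped)
    (c₁ c₂ : T.NZChoice) (hslope : c₁.loop.SameSlope c₂.loop)
    (ζ : Fin N → ℂ) (hζ : T.IsShapeSolution c₁.loop ζ) :
    c₁.oneLoop ζ = c₂.oneLoop ζ ∨ c₁.oneLoop ζ = -c₂.oneLoop ζ := by
  -- The number of edges comes from the enumeration in a choice; it is what makes the two ends of
  -- every edge distinct.
  have hE : Fintype.card T.Edge = N := by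
    rw [← Fintype.card_congr c₁.enum, Fintype.card_fin]
  obtain ⟨ε, hε, hnull⟩ := hslope.exists_isNullHomologous hT
  -- Rotation numbers transfer the second flattening to the first loop, so both monomials can be
  -- compared using the gluing equation of that loop.
  have hflat : T.IsFlattening c₁.loop c₂.flat :=
    ⟨c₂.isFlattening.tet, c₂.isFlattening.edge,
      c₂.isFlattening.curve_eq_zero hT hE c₁.essential hnull⟩
  have hprod := c₁.isFlattening.prod_eq_or hT hE c₁.essential hζ hflat
  obtain ⟨C, a, hC⟩ := IdealTriangulation.PeripheralCurve.gluing_eq_of_isNullHomologous hT hnull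
  let W : T.Edge → Fin N → ℂ := fun I =>
    IdealTriangulation.NZChoice.normalizedRow ζ (T.edgeGluing I)
  have hW : ∑ I, W I = 0 := IdealTriangulation.sum_normalizedRow ζ
  have hW₁ : ∑ i, (Matrix.of fun i => W (c₁.enum i)) i = 0 := by
    rw [← hW]; exact Equiv.sum_comp c₁.enum W
  -- The triples `a` drop out, because the coefficients of `loopEntry` add up to 0.
  have hrow : IdealTriangulation.NZChoice.normalizedRow ζ c₁.loop.gluing =
      (ε : ℂ) • IdealTriangulation.NZChoice.normalizedRow ζ c₂.loop.gluing +
        ∑ i, (C (c₁.enum i) : ℂ) • (Matrix.of fun i => W (c₁.enum i)) i := by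
    have h1 : ∑ i, (C (c₁.enum i) : ℂ) • (Matrix.of fun i => W (c₁.enum i)) i =
        ∑ I, (C I : ℂ) • W I := Equiv.sum_comp c₁.enum fun I => (C I : ℂ) • W I
    rw [h1]
    ext j
    simp only [Pi.add_apply, Pi.smul_apply, Finset.sum_apply, smul_eq_mul, W,
      IdealTriangulation.NZChoice.normalizedRow, loopEntry, hC]
    push_cast
    simp only [mul_add, mul_sub, Finset.sum_add_distrib, Finset.sum_sub_distrib]
    have h2 : ∀ (s : ℂ) k, ∑ I, (C I : ℂ) * (s * (T.edgeGluing I j k : ℂ)) =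
        s * ∑ I, (C I : ℂ) * (T.edgeGluing I j k : ℂ) := by
      intro s k
      rw [Finset.mul_sum]
      exact Finset.sum_congr rfl fun I _ => by ring
    rw [h2, h2]
    ring
  have hdet : ((Matrix.of fun i => W (c₁.enum i)).updateRow c₁.omitted
        (IdealTriangulation.NZChoice.normalizedRow ζ c₁.loop.gluing)).det =
      ((Matrix.of fun i => W (c₂.enum i)).updateRow c₂.omitted
        (IdealTriangulation.NZChoice.normalizedRow ζ c₂.loop.gluing)).det ∨
      ((Matrix.of fun i => W (c₁.enum i)).updateRow c₁.omitted
        (IdealTriangulation.NZChoice.normalizedRow ζ c₁.loop.gluing)).det =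
      -((Matrix.of fun i => W (c₂.enum i)).updateRow c₂.omitted
        (IdealTriangulation.NZChoice.normalizedRow ζ c₂.loop.gluing)).det := by
    rw [hrow, Matrix.det_updateRow_add_rows hW₁]
    have h1 := eq_or_eq_neg_mul (a := (ε : ℂ)) (b := 1) (by rcases hε with rfl | rfl <;> simp)
      (Matrix.det_updateRow_reindex hW c₁.enum c₂.enum c₁.omitted c₂.omitted
        (IdealTriangulation.NZChoice.normalizedRow ζ c₂.loop.gluing))
    rwa [one_mul] at h1
  have h := eq_or_eq_neg_mul (eq_or_eq_neg_mul (Or.inl (Eq.refl (1 / 2 : ℂ))) hdet)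
    (eq_or_eq_neg_mul (Or.inl (Eq.refl (∏ i, (ζ i)⁻¹))) hprod)
  rcases c₁.oneLoop_eq_or hζ.ne_zero hζ.ne_one with h₁ | h₁ <;>
    rcases c₂.oneLoop_eq_or hζ.ne_zero hζ.ne_one with h₂ | h₂ <;>
    rw [h₁, h₂]
  · exact h
  · rw [neg_neg]; exact h.symm
  · rw [neg_inj, neg_eq_iff_eq_neg, or_comm]; exact h
  · rw [neg_neg, neg_inj, neg_eq_iff_eq_neg]; exact h
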